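/- Setting. Consider $$\frac{dr}{dt}=f(r,\varphi,S(t),t),\qquad \frac{d\varphi}{dt}=\omega(r)+g(r,\varphi,S(t),t),\tag{1}$$ where $\omega(r)>0$, $f(r,\varphi,S,t)$, $g(r,\varphi,S,t)$ are infinitely differentiable for $|r|\le\mathcal R$, $(\varphi,S)\in\mathbb R^2$, $t>0$, and $f,g$ are $2\pi$-periodic in $\varphi$ and in $S$. Let $q\ge1$ be an integer, let $f_j,g_j$ ($j\ge1$) be infinitely differentiable functions of $(r,\varphi,S)$, $|r|\le\mathcal R$, that are $2\pi$-periodic in $\varphi$ and $S$, and assume that for every $M\ge1$ $$f-\sum_{j=1}^{M-1}t^{-j/q}f_j=\mathcal O(t^{-M/q}),\qquad g-\sum_{j=1}^{M-1}t^{-j/q}g_j=\mathcal O(t^{-M/q}),\qquad t\to\infty,$$ uniformly in $|r|\le\mathcal R$, $(\varphi,S)\in\mathbb R^2$. Let $S(t)=s_0t+\sum_{j=1}^{q-1}s_jt^{1-j/q}+s_q\log t$ with $s_0>0$, and assume the resonance condition: there are coprime positive integers $\kappa,\varkappa$ and $0<|a|<\mathcal R$ with $\kappa s_0=\varkappa\,\omega(a)$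 and $\eta:=\omega'(a)\ne0$. Transformed system. Put $r=a+t^{-1/(2q)}R$, $\varphi=\frac{\kappa}{\varkappa}S(t)+\Psi$. Then (1) becomes $\dot R=F(R,\Psi,S(t),t)$, $\dot\Psi=G(R,\Psi,S(t),t)$ with $$F=t^{\frac1{2q}}f\big(a+t^{-\frac1{2q}}R,\tfrac{\kappa}{\varkappa}S+\Psi,S,t\big)+\tfrac{R}{2qt},\qquad G=\omega\big(a+t^{-\frac1{2q}}R\big)-\tfrac{\kappa}{\varkappa}S'(t)+g\big(a+t^{-\frac1{2q}}R,\tfrac{\kappa}{\varkappa}S+\Psi,S,t\big).$$ With $\sigma_k:=s_{k/2}\big(1-\frac k{2q}+\delta_{k,2q}\big)$ for even $k\le 2q$ and $\sigma_k:=0$ otherwise, put for $k\ge1$ $$F_k=\sum_{\substack{i+2j=k+1\\ i\ge0,\,j\ge1}}\partial_r^if_j\big(a,\tfrac{\kappa}{\varkappa}S+\Psi,S\big)\frac{R^i}{i!}+\delta_{k,2q}\frac{R}{2q},$$ $$G_k=\omega^{(k)}(a)\frac{R^k}{k!}-\frac{\kappa}{\varkappa}\sigma_k+\sum_{\substack{i+2j=k\\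 i\ge0,\,j\ge1}}\partial_r^ig_j\big(a,\tfrac{\kappa}{\varkappa}S+\Psi,S\big)\frac{R^i}{i!}.$$ Define recursively for $k=1,2,\dots$ the functions $u_k,v_k$ of $(R,\Psi,S)$ and $\Lambda_k,\Omega_k$ of $(R,\Psi)$: let $\tilde F_k$ be the coefficient of $h^k$ in the expansion at $h=0$ of $\sum_{1\le j<k}h^j\Lambda_j\big(R+\sum_{1\le i<k}h^iu_i,\ \Psi+\sum_{1\le i<k}h^iv_i\big)$ minus $$\sum_{j=1}^{k-1}\Big\{F_j\partial_R+G_j\partial_\Psi+\sigma_j\partial_S+\delta_{j,2q}\tfrac{2q-k}{2q}\Big\}u_{k-j},$$ and let $\tilde G_k$ be the same with $\Omega_j$, $v_{k-j}$ in place of $\Lambda_j$, $u_{k-j}$. Let $\Lambda_k$, $\Omega_k$ be the means over $S\in[0,2\pi\varkappa]$ of $F_k-\tilde F_k$, $G_k-\tilde G_k$, and let $u_k,v_k$ be the solutions, $2\pi\varkappa$-periodic in $S$ with zero mean, of $s_0\partial_Su_k=\Lambda_k-F_k+\tilde F_k$, $s_0\partial_Sv_k=\Omega_k-G_k+\tilde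 G_k$. For $N\ge1$ put $$U_N=R+\sum_{k=1}^Nt^{-\frac k{2q}}u_k,\qquad V_N=\Psi+\sum_{k=1}^Nt^{-\frac k{2q}}v_k .$$ For $\varsigma\in(0,1)$, $\epsilon\ge0$, $t_0\ge1$ let $\mathcal D^\epsilon_{\varsigma,t_0}=\{(R,\Psi,t):|Rt^{-\frac{1-\varsigma}{2q}}+a|<\mathcal R-\epsilon t^{-\frac{1-\varsigma}{2q}},\ t\ge t_0\}$. In the variables $\rho=U_N(R,\Psi,S(t),t)$, $\psi=V_N(R,\Psi,S(t),t)$ the system takes the form $$\frac{d\rho}{dt}=\Lambda_N(\rho,\psi,S(t),t),\qquad\frac{d\psi}{dt}=\Omega_N(\rho,\psi,S(t),t),\qquad(\rho,\psi,t)\in\mathcal D^\epsilon_{\varsigma,t_0},\tag{2}$$ where $\Lambda_N(\rho,\psi,S,t)$, $\Omega_N(\rho,\psi,S,t)$ are the values of $(\partial_t+S'(t)\partial_S+F\partial_R+G\partial_\Psi)U_N$ and $(\partial_t+S'(t)\partial_S+F\partial_R+G\partial_\Psi)V_N$ at the point $(R,\Psi)$, $(R,\Psi,t)\in\mathcal D^0_{\varsigma,t_0}$,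 with $U_N(R,\Psi,S,t)=\rho$, $V_N(R,\Psi,S,t)=\psi$. Theorem. Suppose that there are integers $n\in[1,2q]$ and $m\in[2,2q]$ such that $\Lambda_i\equiv0$ for $1\le i<n$, $\Lambda_n\not\equiv0$, $\Omega_j\equiv0$ for $1<j<m$, $\Omega_m\not\equiv0$, and suppose that $\Lambda_n(\rho,\psi)\ne0$ for all $(\rho,\psi)\in\mathbb R^2$. Then: (a) The solutions of (2) exit from any bounded domain in finite time. Precisely: for all $N\ge1$, $\varsigma\in(0,1)$, $\epsilon\in(0,\mathcal R)$, $t_0\ge1$ and every bounded set $B\subset\mathbb R^2$ there is $T_1\ge t_0$ such that, for every non-continuable solution $(\rho,\psi)$ of (2) on an interval $[T,b)$, $t_0\le T<b\le\infty$, and every $t_1\in[T,b)$ with $t_1\ge T_1$, there is $t_2\in[t_1,b)$ with $(\rho(t_2),\psi(t_2))\notin B$. (In particular, a solution that exists for all $t\ge T$ leaves every bounded set.) (b) No resonant regime with $r(t)\approx a$ occurs: for every solution $(r,\varphi)$ of (1) on $[T,\infty)$, $T>0$, with $|r(t)|\le\mathcal R$, the function $t^{1/(2q)}|r(t)-a|$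 is unbounded on $[T,\infty)$; that is, no solution satisfies $r(t)=a+\mathcal O(t^{-1/(2q)})$. -/

import Mathlib

noncomputable section

/-- The data of the perturbed oscillatory system
`dr/dt = f(r, φ, S(t), t)`, `dφ/dt = ω(r) + g(r, φ, S(t), t)`. -/
structure OscSystem where
  /-- the system is considered for `|r| ≤ Rmax` -/
  Rmax : ℝ
  ω : ℝ → ℝ
  f : ℝ → ℝ → ℝ → ℝ → ℝ
  g : ℝ → ℝ → ℝ → ℝ → ℝ
  /-- the coefficients `f_j(r, φ, S)`, `j ≥ 1`, of the asymptotic series of `f` -/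
  fc : ℕ → ℝ → ℝ → ℝ → ℝ
  /-- the coefficients `g_j(r, φ, S)`, `j ≥ 1`, of the asymptotic series of `g` -/
  gc : ℕ → ℝ → ℝ → ℝ → ℝ
  q : ℕ
  /-- the constants `s_0, …, s_q` of the phase (other values are not used) -/
  s : ℕ → ℝ
  /-- the resonant amplitude -/
  a : ℝ
  κ : ℕ
  ϰ : ℕ

/-- Mean value over the period `2πϰ`. -/
def periodMean (ϰ : ℕ) (w : ℝ → ℝ) : ℝ :=
  (1 / (2 * Real.pi * ϰ)) * ∫ x in (0 : ℝ)..(2 * Real.pi * ϰ), w x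

/-- The antiderivative whose mean value over the period `2πϰ` is zero. -/
def zeroMeanPrimitive (ϰ : ℕ) (w : ℝ → ℝ) (S : ℝ) : ℝ :=
  (∫ x in (0 : ℝ)..S, w x) - periodMean ϰ (fun y => ∫ x in (0 : ℝ)..y, w x)

/-- The coefficients of one order `k` of the near-identity transformation (`u k`, `v k`) and of
the averaged system (`Lam k`, `Om k`). -/
structure AvgCoeff where
  u : ℝ → ℝ → ℝ → ℝ
  v : ℝ → ℝ → ℝ → ℝ
  Lam : ℝ → ℝ → ℝ
  Om : ℝ → ℝ → ℝ

/-- The coefficients that vanish identically. -/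
def AvgCoeff.zero : AvgCoeff where
  u := fun _ _ _ => 0
  v := fun _ _ _ => 0
  Lam := fun _ _ => 0
  Om := fun _ _ => 0

namespace OscSystem

/-- The phase `S(t) = s₀ t + ∑_{0 < j < q} s_j t^{1 - j/q} + s_q log t` of the perturbations. -/
def phase (D : OscSystem) (t : ℝ) : ℝ :=
  D.s 0 * t + (∑ j ∈ Finset.Ico 1 D.q, D.s j * t ^ (1 - (j : ℝ) / D.q)) + D.s D.q * Real.log t

/-- The power `t^{-k/(2q)}` of the asymptotic scale. -/
def scale (D : OscSystem) (k : ℕ) (t : ℝ) : ℝ := t ^ (-(k : ℝ) / (2 * D.q))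

/-- Standing assumptions on the system: smoothness, positivity, periodicity, and the uniform
asymptotic expansions of `f` and `g` in powers of `t^{-1/q}` as `t → ∞`. -/
structure Regular (D : OscSystem) : Prop where
  q_pos : 1 ≤ D.q
  s_pos : 0 < D.s 0
  ω_smooth : ContDiffOn ℝ ((⊤ : ℕ∞) : WithTop ℕ∞) D.ω (Set.Icc (-D.Rmax) D.Rmax)
  ω_pos : ∀ r, |r| ≤ D.Rmax → 0 < D.ω r
  f_smooth : ContDiffOn ℝ ((⊤ : ℕ∞) : WithTop ℕ∞)
    (fun x : ℝ × ℝ × ℝ × ℝ => D.f x.1 x.2.1 x.2.2.1 x.2.2.2)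
    (Set.Icc (-D.Rmax) D.Rmax ×ˢ Set.univ ×ˢ Set.univ ×ˢ Set.Ioi 0)
  g_smooth : ContDiffOn ℝ ((⊤ : ℕ∞) : WithTop ℕ∞)
    (fun x : ℝ × ℝ × ℝ × ℝ => D.g x.1 x.2.1 x.2.2.1 x.2.2.2)
    (Set.Icc (-D.Rmax) D.Rmax ×ˢ Set.univ ×ˢ Set.univ ×ˢ Set.Ioi 0)
  f_periodic : ∀ r φ S t, |r| ≤ D.Rmax → 0 < t →
    D.f r (φ + 2 * Real.pi) S t = D.f r φ S t ∧ D.f r φ (S + 2 * Real.pi) t = D.f r φ S t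
  g_periodic : ∀ r φ S t, |r| ≤ D.Rmax → 0 < t →
    D.g r (φ + 2 * Real.pi) S t = D.g r φ S t ∧ D.g r φ (S + 2 * Real.pi) t = D.g r φ S t
  fc_smooth : ∀ j, 1 ≤ j → ContDiffOn ℝ ((⊤ : ℕ∞) : WithTop ℕ∞)
    (fun x : ℝ × ℝ × ℝ => D.fc j x.1 x.2.1 x.2.2)
    (Set.Icc (-D.Rmax) D.Rmax ×ˢ Set.univ ×ˢ Set.univ)
  gc_smooth : ∀ j, 1 ≤ j → ContDiffOn ℝ ((⊤ : ℕ∞) : WithTop ℕ∞)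
    (fun x : ℝ × ℝ × ℝ => D.gc j x.1 x.2.1 x.2.2)
    (Set.Icc (-D.Rmax) D.Rmax ×ˢ Set.univ ×ˢ Set.univ)
  fc_periodic : ∀ j r φ S, 1 ≤ j → |r| ≤ D.Rmax →
    D.fc j r (φ + 2 * Real.pi) S = D.fc j r φ S ∧ D.fc j r φ (S + 2 * Real.pi) = D.fc j r φ S
  gc_periodic : ∀ j r φ S, 1 ≤ j → |r| ≤ D.Rmax →
    D.gc j r (φ + 2 * Real.pi) S = D.gc j r φ S ∧ D.gc j r φ (S + 2 * Real.pi) = D.gc j r φ S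
  f_asymptotic : ∀ M : ℕ, 1 ≤ M → ∃ C t₁ : ℝ, 0 < t₁ ∧ ∀ r φ S t, |r| ≤ D.Rmax → t₁ ≤ t →
    |D.f r φ S t - ∑ j ∈ Finset.Ico 1 M, t ^ (-(j : ℝ) / D.q) * D.fc j r φ S|
      ≤ C * t ^ (-(M : ℝ) / D.q)
  g_asymptotic : ∀ M : ℕ, 1 ≤ M → ∃ C t₁ : ℝ, 0 < t₁ ∧ ∀ r φ S t, |r| ≤ D.Rmax → t₁ ≤ t →
    |D.g r φ S t - ∑ j ∈ Finset.Ico 1 M, t ^ (-(j : ℝ) / D.q) * D.gc j r φ S|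
      ≤ C * t ^ (-(M : ℝ) / D.q)

/-- The resonance condition `κ s₀ = ϰ ω(a)`, `η = ω'(a) ≠ 0`, with coprime positive integers
`κ`, `ϰ` and `0 < |a| < Rmax`. -/
structure Resonant (D : OscSystem) : Prop where
  a_ne : 0 < |D.a|
  a_lt : |D.a| < D.Rmax
  κ_pos : 1 ≤ D.κ
  ϰ_pos : 1 ≤ D.ϰ
  coprime : Nat.Coprime D.κ D.ϰ
  resonance : (D.κ : ℝ) * D.s 0 = D.ϰ * D.ω D.a
  nonisochronous : deriv D.ω D.a ≠ 0

/-- `(r, φ)` is a solution of the original system for all `t ≥ T`. -/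
def IsSolution (D : OscSystem) (T : ℝ) (r φ : ℝ → ℝ) : Prop :=
  ∀ t, T ≤ t → |r t| ≤ D.Rmax ∧
    HasDerivWithinAt r (D.f (r t) (φ t) (D.phase t) t) (Set.Ici T) t ∧
    HasDerivWithinAt φ (D.ω (r t) + D.g (r t) (φ t) (D.phase t) t) (Set.Ici T) t

/-! The system for the amplitude residual `R = t^{1/(2q)} (r - a)` and the phase shift
`Ψ = φ - (κ/ϰ) S(t)`. -/

/-- The right-hand side `F(R, Ψ, S, t)` of the equation for `R`. -/
def F (D : OscSystem) (R Ψ S t : ℝ) : ℝ :=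
  t ^ ((1 : ℝ) / (2 * D.q)) * D.f (D.a + D.scale 1 t * R) ((D.κ : ℝ) / D.ϰ * S + Ψ) S t
    + t⁻¹ * (R / (2 * D.q))

/-- The right-hand side `G(R, Ψ, S, t)` of the equation for `Ψ`. -/
def G (D : OscSystem) (R Ψ S t : ℝ) : ℝ :=
  D.ω (D.a + D.scale 1 t * R) - (D.κ : ℝ) / D.ϰ * deriv D.phase t
    + D.g (D.a + D.scale 1 t * R) ((D.κ : ℝ) / D.ϰ * S + Ψ) S t

/-- The coefficient of `t^{-k/(2q)}` in `S'(t)`, `k ≥ 1`: it is `s_{k/2} (1 - k/(2q) + δ_{k,2q})`,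
where `s_{k/2} = 0` if `k` is odd or `k > 2q`. -/
def phaseRate (D : OscSystem) (k : ℕ) : ℝ :=
  if Even k ∧ k ≤ 2 * D.q then
    D.s (k / 2) * (1 - (k : ℝ) / (2 * D.q) + if k = 2 * D.q then 1 else 0)
  else 0

/-- The coefficient `F_k(R, Ψ, S)` of `t^{-k/(2q)}` in the expansion of `F`; the sum runs over
the pairs `i ≥ 0`, `j ≥ 1` with `i + 2j = k + 1`. -/
def Fc (D : OscSystem) (k : ℕ) (R Ψ S : ℝ) : ℝ :=
  (∑ j ∈ Finset.Icc 1 ((k + 1) / 2),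
    iteratedDeriv (k + 1 - 2 * j) (fun r => D.fc j r ((D.κ : ℝ) / D.ϰ * S + Ψ) S) D.a
      * R ^ (k + 1 - 2 * j) / (Nat.factorial (k + 1 - 2 * j) : ℝ))
    + if k = 2 * D.q then R / (2 * D.q) else 0

/-- The coefficient `G_k(R, Ψ, S)` of `t^{-k/(2q)}` in the expansion of `G`; the sum runs over
the pairs `i ≥ 0`, `j ≥ 1` with `i + 2j = k`. -/
def Gc (D : OscSystem) (k : ℕ) (R Ψ S : ℝ) : ℝ :=
  iteratedDeriv k D.ω D.a * R ^ k / (Nat.factorial k : ℝ) - (D.κ : ℝ) / D.ϰ * D.phaseRate k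
    + ∑ j ∈ Finset.Icc 1 (k / 2),
      iteratedDeriv (k - 2 * j) (fun r => D.gc j r ((D.κ : ℝ) / D.ϰ * S + Ψ) S) D.a
        * R ^ (k - 2 * j) / (Nat.factorial (k - 2 * j) : ℝ)

/-! The recursive construction of the averaging transformation. In the definitions below `c j` are
the coefficients of order `j`, of which only those with `1 ≤ j < k` are used, and `W j`, `w j`
are components of them. -/

/-- The coefficient of `h ^ k` in the expansion in powers of `h` of
`∑_{1 ≤ j < k} h ^ j W_j(R + ∑_{1 ≤ i < k} h ^ i u_i, Ψ + ∑_{1 ≤ i < k} h ^ i v_i)`. -/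
def compCoeff (c : ℕ → AvgCoeff) (W : ℕ → ℝ → ℝ → ℝ) (k : ℕ) (R Ψ S : ℝ) : ℝ :=
  iteratedDeriv k (fun h : ℝ => ∑ j ∈ Finset.Ico 1 k, h ^ j *
    W j (R + ∑ i ∈ Finset.Ico 1 k, h ^ i * (c i).u R Ψ S)
      (Ψ + ∑ i ∈ Finset.Ico 1 k, h ^ i * (c i).v R Ψ S)) 0 / (Nat.factorial k : ℝ)

/-- `∑_{1 ≤ j < k} (F_j ∂_R + G_j ∂_Ψ + s_{j/2} (1 - j/(2q) + δ_{j,2q}) ∂_S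
      + δ_{j,2q} (2q - k)/(2q)) w_{k-j}`. -/
def driftCoeff (D : OscSystem) (w : ℕ → ℝ → ℝ → ℝ → ℝ) (k : ℕ) (R Ψ S : ℝ) : ℝ :=
  ∑ j ∈ Finset.Ico 1 k,
    (D.Fc j R Ψ S * deriv (fun x => w (k - j) x Ψ S) R
      + D.Gc j R Ψ S * deriv (fun x => w (k - j) R x S) Ψ
      + D.phaseRate j * deriv (fun x => w (k - j) R Ψ x) S
      + (if j = 2 * D.q then (2 * (D.q : ℝ) - k) / (2 * D.q) else 0) * w (k - j) R Ψ S)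

/-- `F_k - F̃_k` -/
def avgSourceF (D : OscSystem) (c : ℕ → AvgCoeff) (k : ℕ) (R Ψ S : ℝ) : ℝ :=
  D.Fc k R Ψ S - (compCoeff c (fun j => (c j).Lam) k R Ψ S
    - D.driftCoeff (fun j => (c j).u) k R Ψ S)

/-- `G_k - G̃_k` -/
def avgSourceG (D : OscSystem) (c : ℕ → AvgCoeff) (k : ℕ) (R Ψ S : ℝ) : ℝ :=
  D.Gc k R Ψ S - (compCoeff c (fun j => (c j).Om) k R Ψ S
    - D.driftCoeff (fun j => (c j).v) k R Ψ S)

/-- The step of the recursion: `Λ_k`, `Ω_k` are the means of `F_k - F̃_k`, `G_k - G̃_k`, and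
`u_k`, `v_k` are the solutions with zero mean in `S` of `s₀ ∂_S u_k = Λ_k - F_k + F̃_k` and
`s₀ ∂_S v_k = Ω_k - G_k + G̃_k`. -/
def avgStep (D : OscSystem) (c : ℕ → AvgCoeff) (k : ℕ) : AvgCoeff where
  Lam := fun R Ψ => periodMean D.ϰ (fun x => D.avgSourceF c k R Ψ x)
  Om := fun R Ψ => periodMean D.ϰ (fun x => D.avgSourceG c k R Ψ x)
  u := fun R Ψ S => zeroMeanPrimitive D.ϰ (fun x =>
    (periodMean D.ϰ (fun y => D.avgSourceF c k R Ψ y) - D.avgSourceF c k R Ψ x) / D.s 0) S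
  v := fun R Ψ S => zeroMeanPrimitive D.ϰ (fun x =>
    (periodMean D.ϰ (fun y => D.avgSourceG c k R Ψ y) - D.avgSourceG c k R Ψ x) / D.s 0) S

/-- The coefficients of order `k` of the averaging transformation and of the averaged system. -/
def coeff (D : OscSystem) (k : ℕ) : AvgCoeff :=
  if k = 0 then AvgCoeff.zero
  else D.avgStep (fun j => if _h : j < k then coeff D j else AvgCoeff.zero) k
termination_by k

/-- `Λ_k(ρ, ψ)` -/
def Lam (D : OscSystem) (k : ℕ) (ρ ψ : ℝ) : ℝ := (D.coeff k).Lam ρ ψ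

/-- `Ω_k(ρ, ψ)` -/
def Om (D : OscSystem) (k : ℕ) (ρ ψ : ℝ) : ℝ := (D.coeff k).Om ρ ψ

/-- `U_N(R, Ψ, S, t) = R + ∑_{k=1}^N t^{-k/(2q)} u_k(R, Ψ, S)` -/
def U (D : OscSystem) (N : ℕ) (R Ψ S t : ℝ) : ℝ :=
  R + ∑ k ∈ Finset.Icc 1 N, D.scale k t * (D.coeff k).u R Ψ S

/-- `V_N(R, Ψ, S, t) = Ψ + ∑_{k=1}^N t^{-k/(2q)} v_k(R, Ψ, S)` -/
def V (D : OscSystem) (N : ℕ) (R Ψ S t : ℝ) : ℝ :=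
  Ψ + ∑ k ∈ Finset.Icc 1 N, D.scale k t * (D.coeff k).v R Ψ S

/-- The derivative `(∂_t + S'(t) ∂_S + F ∂_R + G ∂_Ψ) W` of a function `W(R, Ψ, S(t), t)` along
the system for `(R, Ψ)`. -/
def alongFlow (D : OscSystem) (W : ℝ → ℝ → ℝ → ℝ → ℝ) (R Ψ S t : ℝ) : ℝ :=
  deriv (fun x => W R Ψ S x) t + deriv D.phase t * deriv (fun x => W R Ψ x t) S
    + D.F R Ψ S t * deriv (fun x => W x Ψ S t) R + D.G R Ψ S t * deriv (fun x => W R x S t) Ψ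

/-- The domain `𝒟^ε_{ς,τ}` of the triples `(R, Ψ, t)`. -/
def dom (D : OscSystem) (ς ε τ : ℝ) : Set (ℝ × ℝ × ℝ) :=
  {x | |x.1 * x.2.2 ^ (-(1 - ς) / (2 * D.q)) + D.a|
      < D.Rmax - ε * x.2.2 ^ (-(1 - ς) / (2 * D.q)) ∧ τ ≤ x.2.2}

/-- The inverse `(ρ, ψ) ↦ (R, Ψ)` of the averaging transformation
`ρ = U_N(R, Ψ, S, t)`, `ψ = V_N(R, Ψ, S, t)`, `(R, Ψ, t) ∈ 𝒟^0_{ς,t₀}`. -/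
def inverseTransform (D : OscSystem) (N : ℕ) (ς t₀ ρ ψ S t : ℝ) : ℝ × ℝ :=
  Function.invFunOn (fun p : ℝ × ℝ => (D.U N p.1 p.2 S t, D.V N p.1 p.2 S t))
    {p : ℝ × ℝ | (p.1, p.2, t) ∈ D.dom ς 0 t₀} (ρ, ψ)

/-- The right-hand side `Λ_N(ρ, ψ, S, t)` of the transformed system. -/
def fieldLam (D : OscSystem) (N : ℕ) (ς t₀ ρ ψ S t : ℝ) : ℝ :=
  D.alongFlow (D.U N) (D.inverseTransform N ς t₀ ρ ψ S t).1
    (D.inverseTransform N ς t₀ ρ ψ S t).2 S t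

/-- The right-hand side `Ω_N(ρ, ψ, S, t)` of the transformed system. -/
def fieldOm (D : OscSystem) (N : ℕ) (ς t₀ ρ ψ S t : ℝ) : ℝ :=
  D.alongFlow (D.V N) (D.inverseTransform N ς t₀ ρ ψ S t).1
    (D.inverseTransform N ς t₀ ρ ψ S t).2 S t

/-- The interval `[T, b)`, where `b` may be infinite. -/
def timeInterval (T : ℝ) (b : EReal) : Set ℝ := {t | T ≤ t ∧ (t : EReal) < b}

/-- `(ρ, ψ)` is a solution on `[T, b)` of the transformed system
`dρ/dt = Λ_N(ρ, ψ, S(t), t)`, `dψ/dt = Ω_N(ρ, ψ, S(t), t)`, which is considered in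
`𝒟^ε_{ς,t₀}`. -/
def IsTransformedSolution (D : OscSystem) (N : ℕ) (ς ε t₀ T : ℝ) (b : EReal)
    (ρ ψ : ℝ → ℝ) : Prop :=
  (T : EReal) < b ∧ ∀ t ∈ timeInterval T b, (ρ t, ψ t, t) ∈ D.dom ς ε t₀ ∧
    HasDerivWithinAt ρ (D.fieldLam N ς t₀ (ρ t) (ψ t) (D.phase t) t) (timeInterval T b) t ∧
    HasDerivWithinAt ψ (D.fieldOm N ς t₀ (ρ t) (ψ t) (D.phase t) t) (timeInterval T b) t

/-- A solution on `[T, b)` of the transformed system that has no continuation to a larger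
interval `[T, b')`. -/
def IsMaximalTransformedSolution (D : OscSystem) (N : ℕ) (ς ε t₀ T : ℝ) (b : EReal)
    (ρ ψ : ℝ → ℝ) : Prop :=
  D.IsTransformedSolution N ς ε t₀ T b ρ ψ ∧
    ∀ (b' : EReal) (ρ' ψ' : ℝ → ℝ), b < b' → D.IsTransformedSolution N ς ε t₀ T b' ρ' ψ' →
      ¬ ∀ t ∈ timeInterval T b, ρ' t = ρ t ∧ ψ' t = ψ t

end OscSystem

end

/-! ### Smooth dependence of integrals on parameters. -/

section

open scoped ContDiff
open Asymptotics Filter Topology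

/-! The mechanism is a slow but non-integrable drift. Let `n` be the first order with `Λ_n ≢ 0`, put
`h = t^{-1/(2q)}` and look at `U_n` along a trajectory of the `(R, Ψ)` system on which `|R| ≤ A`.
The homological equations defining `u_1, …, u_n` cancel every oscillating term up to order `h^n`,
and the averaged terms of lower order vanish, so `dU_n/dt = h^n Λ_n(R, Ψ) + O(h^{n+1})`
(`alongFlow_U_isBigO`). A nowhere zero continuous `Λ_n` has constant sign, and by periodicity in `Ψ`
and compactness it stays away from zero on the strip (`exists_sign_lower_bound`). Since `n ≤ 2q`,
the speed of `U_n` is at least a constant times `h^{2q} = 1/t`, so `U_n` drifts at least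
logarithmically; but `U_n` is bounded on the strip. Hence no trajectory with bounded `R` lives for
all large times (`not_bounded_flow`). As `R = t^{1/(2q)}(r - a)`, this is already (b).

For (a), suppose a solution of the transformed system stays in a bounded set from a late time on.
There `(U_N, V_N)` is a small Lipschitz perturbation of the identity on a strip (`GoodTime`), so the
solution pulls back to a bounded trajectory in `(R, Ψ)` (`flowAt_of_transformed`). If it exists for
all time, the drift argument applies; `N` need not be related to `n`. If it ends at a finite `b`,
the bounded trajectory continues beyond `b` (`exists_flow_extension`), and its image continues the
transformed solution, against maximality.

Uniformity in `Ψ` and `S` comes from one structural fact (`avgPoly_coeff`): the coefficients of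
order `k` are polynomials in `R` of degree at most `k` whose coefficients are smooth and periodic in
`Ψ` and `S`. Boundedness on strips needs only polynomiality; smallness of the corrections on the
whole growing domain `𝒟` needs the degree bound. -/

theorem hasFDerivAt_intervalIntegral_of_contDiff {F : Type} [NormedAddCommGroup F]
    [NormedSpace ℝ F] [CompleteSpace F] (w : ℝ × ℝ → ℝ → F)
    (hw : ContDiff ℝ 1 (fun p : (ℝ × ℝ) × ℝ => w p.1 p.2)) (x₀ : ℝ × ℝ) :
    HasFDerivAt (fun x => ∫ s in (0 : ℝ)..1, w x s)
      (∫ s in (0 : ℝ)..1, (fderiv ℝ (fun p : (ℝ × ℝ) × ℝ => w p.1 p.2) (x₀, s)).comp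
        (ContinuousLinearMap.inl ℝ (ℝ × ℝ) ℝ)) x₀ := by
  have hF' : Continuous (fun p : (ℝ × ℝ) × ℝ =>
      (fderiv ℝ (fun p : (ℝ × ℝ) × ℝ => w p.1 p.2) p).comp
        (ContinuousLinearMap.inl ℝ (ℝ × ℝ) ℝ)) :=
    (hw.continuous_fderiv one_ne_zero).clm_comp continuous_const
  have hK : IsCompact (Metric.closedBall x₀ 1 ×ˢ Set.Icc (0 : ℝ) 1) :=
    (isCompact_closedBall x₀ 1).prod isCompact_Icc
  obtain ⟨C, hC⟩ := hK.exists_bound_of_continuousOn hF'.continuousOn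
  refine intervalIntegral.hasFDerivAt_integral_of_dominated_of_fderiv_le
    (F' := fun x s => (fderiv ℝ (fun p : (ℝ × ℝ) × ℝ => w p.1 p.2) (x, s)).comp
        (ContinuousLinearMap.inl ℝ (ℝ × ℝ) ℝ)) (bound := fun _ => C)
    (Metric.closedBall_mem_nhds x₀ one_pos) ?_ ?_ ?_ ?_ ?_ ?_
  · exact Filter.Eventually.of_forall fun x =>
      (hw.continuous.comp (by fun_prop : Continuous fun s : ℝ => (x, s))).aestronglyMeasurable
  · exact (hw.continuous.comp
      (by fun_prop : Continuous fun s : ℝ => (x₀, s))).intervalIntegrable _ _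
  · exact (hF'.comp (by fun_prop : Continuous fun s : ℝ => (x₀, s))).aestronglyMeasurable
  · refine Filter.Eventually.of_forall fun s hs x hx => hC (x, s) ⟨hx, ?_⟩
    rw [Set.uIoc_of_le zero_le_one] at hs
    exact ⟨hs.1.le, hs.2⟩
  · exact intervalIntegrable_const
  · refine Filter.Eventually.of_forall fun s _ x _ => ?_
    have h1 : HasFDerivAt (fun p : (ℝ × ℝ) × ℝ => w p.1 p.2) _ (x, s) :=
      ((hw.differentiable one_ne_zero) (x, s)).hasFDerivAt
    exact HasFDerivAt.comp (f := fun x : ℝ × ℝ => (x, s)) x h1 (hasFDerivAt_prodMk_left x s)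

/-- Differentiation under the integral sign, iterated. The target space is quantified inside the
induction because each derivative takes values in a new space of linear maps. -/
theorem contDiff_nat_intervalIntegral (n : ℕ) : ∀ {F : Type} [NormedAddCommGroup F]
    [NormedSpace ℝ F] [CompleteSpace F] (w : ℝ × ℝ → ℝ → F),
    ContDiff ℝ n (fun p : (ℝ × ℝ) × ℝ => w p.1 p.2) →
    ContDiff ℝ n (fun x => ∫ s in (0 : ℝ)..1, w x s) := by
  induction n with
  | zero =>
    intro F _ _ _ w hw
    have h := contDiff_zero.1 hw
    exact contDiff_zero.2
      (intervalIntegral.continuous_parametric_intervalIntegral_of_continuous' (f := w) h 0 1)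
  | succ n ih =>
    intro F _ _ _ w hw
    have h1 : ContDiff ℝ 1 (fun p : (ℝ × ℝ) × ℝ => w p.1 p.2) := hw.of_le (by
      exact_mod_cast Nat.le_add_left 1 n)
    have hd := hasFDerivAt_intervalIntegral_of_contDiff w h1
    rw [Nat.cast_succ, contDiff_succ_iff_fderiv]
    refine ⟨fun x => (hd x).differentiableAt, by simp, ?_⟩
    rw [show fderiv ℝ (fun x => ∫ s in (0 : ℝ)..1, w x s) = _ from funext fun x => (hd x).fderiv]
    refine ih _ ?_
    have h2 : ContDiff ℝ n (fderiv ℝ (fun p : (ℝ × ℝ) × ℝ => w p.1 p.2)) :=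
      hw.fderiv_right (by exact_mod_cast le_rfl)
    exact (h2.comp contDiff_id).clm_comp contDiff_const

theorem contDiff_intervalIntegral (w : ℝ × ℝ → ℝ → ℝ)
    (hw : ContDiff ℝ ∞ (fun p : (ℝ × ℝ) × ℝ => w p.1 p.2)) :
    ContDiff ℝ ∞ (fun x => ∫ s in (0 : ℝ)..1, w x s) :=
  contDiff_infty.2 fun n => contDiff_nat_intervalIntegral n w (contDiff_infty.1 hw n)

/-- The substitution `x ↦ S x` moves the variable endpoint into the integrand, leaving a parametric
integral over `[0, 1]`. -/
theorem contDiff_primitive (c : ℝ → ℝ → ℝ) (hc : ContDiff ℝ ∞ (fun p : ℝ × ℝ => c p.1 p.2)) :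
    ContDiff ℝ ∞ (fun p : ℝ × ℝ => ∫ x in (0 : ℝ)..p.2, c p.1 x) := by
  have h : (fun p : ℝ × ℝ => ∫ x in (0 : ℝ)..p.2, c p.1 x) =
      fun p : ℝ × ℝ => p.2 * ∫ x in (0 : ℝ)..1, c p.1 (p.2 * x) := by
    funext p
    simp
  rw [h]
  refine contDiff_snd.mul (contDiff_intervalIntegral (fun p x => c p.1 (p.2 * x)) ?_)
  exact hc.comp (f := fun p : (ℝ × ℝ) × ℝ => (p.1.1, p.1.2 * p.2)) (by fun_prop)

/-! ### Smooth functions periodic in the angle and in the phase. -/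

/-- Smooth functions of `(Ψ, S)` with periods `2π` and `2πϰ`. -/
structure SmoothPeriodic (ϰ : ℕ) (c : ℝ → ℝ → ℝ) : Prop where
  smooth : ContDiff ℝ ∞ (fun p : ℝ × ℝ => c p.1 p.2)
  per_fst : ∀ Ψ S, c (Ψ + 2 * Real.pi) S = c Ψ S
  per_snd : ∀ Ψ S, c Ψ (S + 2 * Real.pi * ϰ) = c Ψ S

namespace SmoothPeriodic

variable {ϰ : ℕ} {c e : ℝ → ℝ → ℝ}

theorem const (ϰ : ℕ) (x : ℝ) : SmoothPeriodic ϰ (fun _ _ => x) :=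
  ⟨contDiff_const, fun _ _ => rfl, fun _ _ => rfl⟩

theorem add (hc : SmoothPeriodic ϰ c) (he : SmoothPeriodic ϰ e) :
    SmoothPeriodic ϰ (fun Ψ S => c Ψ S + e Ψ S) :=
  ⟨hc.smooth.add he.smooth, fun Ψ S => by rw [hc.per_fst, he.per_fst],
    fun Ψ S => by rw [hc.per_snd, he.per_snd]⟩

theorem mul (hc : SmoothPeriodic ϰ c) (he : SmoothPeriodic ϰ e) :
    SmoothPeriodic ϰ (fun Ψ S => c Ψ S * e Ψ S) :=
  ⟨hc.smooth.mul he.smooth, fun Ψ S => by rw [hc.per_fst, he.per_fst],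
    fun Ψ S => by rw [hc.per_snd, he.per_snd]⟩

theorem smooth_fst (hc : SmoothPeriodic ϰ c) (S : ℝ) : ContDiff ℝ ∞ (fun x => c x S) :=
  hc.smooth.comp (f := fun x : ℝ => (x, S)) (by fun_prop)

theorem smooth_snd (hc : SmoothPeriodic ϰ c) (Ψ : ℝ) : ContDiff ℝ ∞ (fun x => c Ψ x) :=
  hc.smooth.comp (f := fun x : ℝ => (Ψ, x)) (by fun_prop)

theorem deriv_fst (hc : SmoothPeriodic ϰ c) :
    SmoothPeriodic ϰ (fun Ψ S => deriv (fun x => c x S) Ψ) := by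
  refine ⟨?_, fun Ψ S => ?_, fun Ψ S => ?_⟩
  · have h : (fun p : ℝ × ℝ => deriv (fun x => c x p.2) p.1) =
        fun p : ℝ × ℝ => fderiv ℝ (fun p : ℝ × ℝ => c p.1 p.2) p (1, 0) := by
      funext p
      have h1 := ((hc.smooth.differentiable (by simp)) p).hasFDerivAt
      have h2 : HasDerivAt (fun x : ℝ => (x, p.2)) ((1 : ℝ), (0 : ℝ)) p.1 :=
        (hasDerivAt_id p.1).prodMk (hasDerivAt_const p.1 p.2)
      exact (HasFDerivAt.comp_hasDerivAt (f := fun x : ℝ => (x, p.2)) p.1 h1 h2).deriv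
    rw [h]
    exact (hc.smooth.fderiv_right (m := ∞) (by simp)).clm_apply contDiff_const
  · rw [← deriv_comp_add_const]
    simp_rw [hc.per_fst]
  · simp_rw [hc.per_snd]

theorem deriv_snd (hc : SmoothPeriodic ϰ c) :
    SmoothPeriodic ϰ (fun Ψ S => deriv (fun x => c Ψ x) S) := by
  refine ⟨?_, fun Ψ S => ?_, fun Ψ S => ?_⟩
  · have h : (fun p : ℝ × ℝ => deriv (fun x => c p.1 x) p.2) =
        fun p : ℝ × ℝ => fderiv ℝ (fun p : ℝ × ℝ => c p.1 p.2) p (0, 1) := by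
      funext p
      have h1 := ((hc.smooth.differentiable (by simp)) p).hasFDerivAt
      have h2 : HasDerivAt (fun x : ℝ => (p.1, x)) ((0 : ℝ), (1 : ℝ)) p.2 :=
        (hasDerivAt_const p.2 p.1).prodMk (hasDerivAt_id p.2)
      exact (HasFDerivAt.comp_hasDerivAt (f := fun x : ℝ => (p.1, x)) p.2 h1 h2).deriv
    rw [h]
    exact (hc.smooth.fderiv_right (m := ∞) (by simp)).clm_apply contDiff_const
  · simp_rw [hc.per_fst]
  · rw [← deriv_comp_add_const]
    simp_rw [hc.per_snd]

theorem mean (hc : SmoothPeriodic ϰ c) : SmoothPeriodic ϰ (fun Ψ _ => periodMean ϰ (c Ψ)) := by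
  refine ⟨?_, fun Ψ S => ?_, fun Ψ S => rfl⟩
  · have h := (contDiff_primitive c hc.smooth).comp
      (f := fun p : ℝ × ℝ => (p.1, 2 * Real.pi * (ϰ : ℝ))) (by fun_prop)
    exact contDiff_const.mul h
  · have h : c (Ψ + 2 * Real.pi) = c Ψ := funext fun S => hc.per_fst Ψ S
    rw [h]

/-- The zero-mean primitive of the zero-mean part. -/
theorem zeroMeanPrimitive (hϰ : 1 ≤ ϰ) (hc : SmoothPeriodic ϰ c) (s : ℝ) :
    SmoothPeriodic ϰ (fun Ψ S =>
      _root_.zeroMeanPrimitive ϰ (fun x => (periodMean ϰ (c Ψ) - c Ψ x) / s) S) := by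
  have hϰ' : (2 * Real.pi * ϰ : ℝ) ≠ 0 := by
    have : (0 : ℝ) < ϰ := by exact_mod_cast hϰ
    have := Real.pi_pos
    positivity
  have hd : SmoothPeriodic ϰ (fun Ψ x => (periodMean ϰ (c Ψ) - c Ψ x) / s) := by
    have := (hc.mean.add ((const ϰ (-1)).mul hc)).mul (const ϰ s⁻¹)
    convert this using 3
    ring
  have hprim := contDiff_primitive (fun Ψ x => (periodMean ϰ (c Ψ) - c Ψ x) / s) hd.smooth
  refine ⟨?_, fun Ψ S => ?_, fun Ψ S => ?_⟩
  · refine hprim.sub ?_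
    have h := (contDiff_primitive
      (fun Ψ y => ∫ x in (0 : ℝ)..y, (periodMean ϰ (c Ψ) - c Ψ x) / s) hprim).comp
      (f := fun p : ℝ × ℝ => (p.1, 2 * Real.pi * (ϰ : ℝ))) (by fun_prop)
    exact contDiff_const.mul h
  · have h : c (Ψ + 2 * Real.pi) = c Ψ := funext fun S => hc.per_fst Ψ S
    rw [h]
  · have hcont : Continuous (fun x => (periodMean ϰ (c Ψ) - c Ψ x) / s) :=
      (hd.smooth_snd Ψ).continuous
    have hper : Function.Periodic (fun x => (periodMean ϰ (c Ψ) - c Ψ x) / s)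
        (2 * Real.pi * ϰ) := fun x => hd.per_snd Ψ x
    -- Subtracting the mean makes the integral over one period vanish, which is exactly what makes
    -- the primitive periodic.
    have hint : ∫ x in (0 : ℝ)..(2 * Real.pi * ϰ), (periodMean ϰ (c Ψ) - c Ψ x) / s = 0 := by
      rw [intervalIntegral.integral_div, intervalIntegral.integral_sub
        intervalIntegrable_const ((hc.smooth_snd Ψ).continuous.intervalIntegrable _ _)]
      rw [intervalIntegral.integral_const, periodMean, smul_eq_mul]
      field_simp
      simp
    unfold _root_.zeroMeanPrimitive
    rw [← intervalIntegral.integral_add_adjacent_intervals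
      (hcont.intervalIntegrable 0 S) (hcont.intervalIntegrable S (S + 2 * Real.pi * ϰ)),
      hper.intervalIntegral_add_eq S 0, zero_add, hint, add_zero]

theorem bounded (hϰ : 1 ≤ ϰ) (hc : SmoothPeriodic ϰ c) : ∃ C, ∀ Ψ S, |c Ψ S| ≤ C := by
  have hϰ' : (0 : ℝ) < 2 * Real.pi * ϰ := by
    have : (0 : ℝ) < ϰ := by exact_mod_cast hϰ
    have := Real.pi_pos
    positivity
  obtain ⟨C, hC⟩ := ((isCompact_Icc (a := (0 : ℝ)) (b := 2 * Real.pi)).prod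
    (isCompact_Icc (a := (0 : ℝ)) (b := 2 * Real.pi * ϰ))).exists_bound_of_continuousOn
    hc.smooth.continuous.continuousOn
  refine ⟨C, fun Ψ S => ?_⟩
  obtain ⟨y, hy, hy'⟩ := Function.Periodic.exists_mem_Ico₀
    (show Function.Periodic (fun x => c x S) (2 * Real.pi) from fun x => hc.per_fst x S)
    Real.two_pi_pos Ψ
  obtain ⟨z, hz, hz'⟩ := Function.Periodic.exists_mem_Ico₀
    (show Function.Periodic (fun x => c y x) (2 * Real.pi * ϰ) from fun x => hc.per_snd y x)
    hϰ' S
  have := hC (y, z) ⟨⟨hy.1, hy.2.le⟩, ⟨hz.1, hz.2.le⟩⟩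
  rw [show c Ψ S = c y S from hy', show c y S = c y z from hz']
  exact this

end SmoothPeriodic

/-! ### Polynomials in `R` with periodic coefficients. -/

/-- Polynomials in `R` of degree at most `d` whose coefficients are smooth functions of `(Ψ, S)`
with periods `2π` and `2πϰ`. -/
inductive PolyClass (ϰ d : ℕ) : (ℝ → ℝ → ℝ → ℝ) → Prop
  | monomial (i : ℕ) (c : ℝ → ℝ → ℝ) (hi : i ≤ d) (hc : SmoothPeriodic ϰ c) :
      PolyClass ϰ d (fun R Ψ S => R ^ i * c Ψ S)
  | add (w z : ℝ → ℝ → ℝ → ℝ) (hw : PolyClass ϰ d w) (hz : PolyClass ϰ d z) :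
      PolyClass ϰ d (fun R Ψ S => w R Ψ S + z R Ψ S)

namespace PolyClass

variable {ϰ d e : ℕ} {w z : ℝ → ℝ → ℝ → ℝ}

theorem mono (hw : PolyClass ϰ d w) (h : d ≤ e) : PolyClass ϰ e w := by
  induction hw with
  | monomial i c hi hc => exact monomial i c (hi.trans h) hc
  | add w z _ _ h1 h2 => exact add w z h1 h2

theorem coeff {c : ℝ → ℝ → ℝ} (hc : SmoothPeriodic ϰ c) (d : ℕ) :
    PolyClass ϰ d (fun _ Ψ S => c Ψ S) := by
  simpa using monomial (d := d) 0 c (Nat.zero_le _) hc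

theorem const (ϰ d : ℕ) (x : ℝ) : PolyClass ϰ d (fun _ _ _ => x) :=
  coeff (SmoothPeriodic.const ϰ x) d

theorem id (ϰ : ℕ) (hd : 1 ≤ d) : PolyClass ϰ d (fun R _ _ => R) := by
  simpa using monomial (d := d) 1 _ hd (SmoothPeriodic.const ϰ 1)

theorem const_mul (x : ℝ) (hw : PolyClass ϰ d w) :
    PolyClass ϰ d (fun R Ψ S => x * w R Ψ S) := by
  induction hw with
  | monomial i c hi hc =>
    convert monomial i _ hi ((SmoothPeriodic.const ϰ x).mul hc) using 4
    ring
  | add w z _ _ h1 h2 =>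
    convert add _ _ h1 h2 using 4
    ring

theorem sub (hw : PolyClass ϰ d w) (hz : PolyClass ϰ d z) :
    PolyClass ϰ d (fun R Ψ S => w R Ψ S - z R Ψ S) := by
  convert add _ _ hw (hz.const_mul (-1)) using 4
  ring

theorem sum {ι : Type*} (s : Finset ι) (w : ι → ℝ → ℝ → ℝ → ℝ)
    (h : ∀ i ∈ s, PolyClass ϰ d (w i)) :
    PolyClass ϰ d (fun R Ψ S => ∑ i ∈ s, w i R Ψ S) := by
  classical
  induction s using Finset.induction_on with
  | empty => simpa using const ϰ d 0
  | insert i s hi ih =>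
    simp_rw [Finset.sum_insert hi]
    exact add _ _ (h i (Finset.mem_insert_self i s))
      (ih fun j hj => h j (Finset.mem_insert_of_mem hj))

theorem mul (hw : PolyClass ϰ d w) (hz : PolyClass ϰ e z) :
    PolyClass ϰ (d + e) (fun R Ψ S => w R Ψ S * z R Ψ S) := by
  induction hw with
  | monomial i c hi hc =>
    induction hz with
    | monomial j b hj hb =>
      convert monomial (d := d + e) (i + j) _ (by omega) (hc.mul hb) using 4
      ring
    | add w z _ _ h1 h2 =>
      convert add _ _ h1 h2 using 4
      ring
  | add w z _ _ h1 h2 =>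
    convert add _ _ h1 h2 using 4
    ring

theorem smooth (hw : PolyClass ϰ d w) :
    ContDiff ℝ ∞ (fun p : ℝ × ℝ × ℝ => w p.1 p.2.1 p.2.2) := by
  induction hw with
  | monomial i c hi hc =>
    exact (contDiff_fst.pow i).mul (hc.smooth.comp contDiff_snd)
  | add w z _ _ h1 h2 => exact h1.add h2

theorem smooth₁ (hw : PolyClass ϰ d w) (Ψ S : ℝ) : ContDiff ℝ ∞ (fun x => w x Ψ S) :=
  hw.smooth.comp (f := fun x : ℝ => (x, Ψ, S)) (by fun_prop)

theorem smooth₂ (hw : PolyClass ϰ d w) (R S : ℝ) : ContDiff ℝ ∞ (fun x => w R x S) :=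
  hw.smooth.comp (f := fun x : ℝ => (R, x, S)) (by fun_prop)

theorem smooth₃ (hw : PolyClass ϰ d w) (R Ψ : ℝ) : ContDiff ℝ ∞ (fun x => w R Ψ x) :=
  hw.smooth.comp (f := fun x : ℝ => (R, Ψ, x)) (by fun_prop)

theorem deriv₁ (hw : PolyClass ϰ d w) :
    PolyClass ϰ d (fun R Ψ S => deriv (fun x => w x Ψ S) R) := by
  induction hw with
  | monomial i c hi hc =>
    convert monomial (d := d) (i - 1) _ (by omega) ((SmoothPeriodic.const ϰ i).mul hc) using 4
    simp
    ring
  | add w z hw hz h1 h2 =>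
    convert add _ _ h1 h2 using 4
    exact deriv_add ((hw.smooth₁ _ _).differentiable (by simp) _)
      ((hz.smooth₁ _ _).differentiable (by simp) _)

theorem deriv₂ (hw : PolyClass ϰ d w) :
    PolyClass ϰ d (fun R Ψ S => deriv (fun x => w R x S) Ψ) := by
  induction hw with
  | monomial i c hi hc =>
    convert monomial (d := d) i _ hi hc.deriv_fst using 4
    simp
  | add w z hw hz h1 h2 =>
    convert add _ _ h1 h2 using 4
    exact deriv_add ((hw.smooth₂ _ _).differentiable (by simp) _)
      ((hz.smooth₂ _ _).differentiable (by simp) _)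

theorem deriv₃ (hw : PolyClass ϰ d w) :
    PolyClass ϰ d (fun R Ψ S => deriv (fun x => w R Ψ x) S) := by
  induction hw with
  | monomial i c hi hc =>
    convert monomial (d := d) i _ hi hc.deriv_snd using 4
    simp
  | add w z hw hz h1 h2 =>
    convert add _ _ h1 h2 using 4
    exact deriv_add ((hw.smooth₃ _ _).differentiable (by simp) _)
      ((hz.smooth₃ _ _).differentiable (by simp) _)

theorem mean (hw : PolyClass ϰ d w) :
    PolyClass ϰ d (fun R Ψ _ => periodMean ϰ (w R Ψ)) := by
  induction hw with
  | monomial i c hi hc =>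
    convert monomial (d := d) i _ hi hc.mean using 4
    simp only [periodMean, intervalIntegral.integral_const_mul]
    ring
  | add w z hw hz h1 h2 =>
    convert add _ _ h1 h2 using 4
    simp only [periodMean]
    rw [intervalIntegral.integral_add ((hw.smooth₃ _ _).continuous.intervalIntegrable _ _)
      ((hz.smooth₃ _ _).continuous.intervalIntegrable _ _), mul_add]

theorem _root_.zeroMeanPrimitive_const_mul (ϰ : ℕ) (x : ℝ) (w : ℝ → ℝ) (S : ℝ) :
    _root_.zeroMeanPrimitive ϰ (fun y => x * w y) S = x * _root_.zeroMeanPrimitive ϰ w S := by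
  simp only [_root_.zeroMeanPrimitive, periodMean, intervalIntegral.integral_const_mul]
  ring

theorem _root_.zeroMeanPrimitive_add (ϰ : ℕ) {w z : ℝ → ℝ} (hw : Continuous w)
    (hz : Continuous z) (S : ℝ) :
    _root_.zeroMeanPrimitive ϰ (fun y => w y + z y) S =
      _root_.zeroMeanPrimitive ϰ w S + _root_.zeroMeanPrimitive ϰ z S := by
  have h : ∀ y, ∫ x in (0 : ℝ)..y, (w x + z x) =
      (∫ x in (0 : ℝ)..y, w x) + ∫ x in (0 : ℝ)..y, z x := fun y =>
    intervalIntegral.integral_add (hw.intervalIntegrable _ _) (hz.intervalIntegrable _ _)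
  simp only [_root_.zeroMeanPrimitive, periodMean, h]
  rw [intervalIntegral.integral_add]
  · ring
  · exact (intervalIntegral.continuous_primitive
      (fun a b => hw.intervalIntegrable a b) 0).intervalIntegrable _ _
  · exact (intervalIntegral.continuous_primitive
      (fun a b => hz.intervalIntegrable a b) 0).intervalIntegrable _ _

theorem zeroMeanPrimitive (hϰ : 1 ≤ ϰ) (s : ℝ) (hw : PolyClass ϰ d w) :
    PolyClass ϰ d (fun R Ψ S =>
      _root_.zeroMeanPrimitive ϰ (fun x => (periodMean ϰ (w R Ψ) - w R Ψ x) / s) S) := by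
  induction hw with
  | monomial i c hi hc =>
    convert monomial (d := d) i _ hi (hc.zeroMeanPrimitive hϰ s) using 4 with R Ψ S
    rw [← zeroMeanPrimitive_const_mul]
    congr 1
    funext x
    simp only [periodMean, intervalIntegral.integral_const_mul]
    ring
  | add w z hw hz h1 h2 =>
    convert add _ _ h1 h2 using 4 with R Ψ S
    have cw := (hw.smooth₃ R Ψ).continuous
    have cz := (hz.smooth₃ R Ψ).continuous
    rw [← zeroMeanPrimitive_add _ (by fun_prop) (by fun_prop)]
    congr 1
    funext x
    simp only [periodMean]
    rw [intervalIntegral.integral_add (cw.intervalIntegrable _ _) (cz.intervalIntegrable _ _)]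
    ring

/-- The explicit power of `1 + |R|` matters on the domain `𝒟`, where `|R|` may grow almost like
`t^{1/(2q)}`: a factor `t^{-k/(2q)}` compensates degree `k` but no more. -/
theorem bounded (hϰ : 1 ≤ ϰ) (hw : PolyClass ϰ d w) :
    ∃ C, 0 ≤ C ∧ ∀ R Ψ S, |w R Ψ S| ≤ C * (1 + |R|) ^ d := by
  induction hw with
  | monomial i c hi hc =>
    obtain ⟨C, hC⟩ := hc.bounded hϰ
    have hC0 : 0 ≤ C := (abs_nonneg _).trans (hC 0 0)
    refine ⟨C, hC0, fun R Ψ S => ?_⟩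
    rw [abs_mul, abs_pow, mul_comm]
    refine mul_le_mul (hC Ψ S) ?_ (by positivity) hC0
    calc |R| ^ i ≤ (1 + |R|) ^ i := by gcongr; linarith [abs_nonneg R]
      _ ≤ (1 + |R|) ^ d := pow_le_pow_right₀ (by linarith [abs_nonneg R]) hi
  | add w z _ _ h1 h2 =>
    obtain ⟨C, hC0, hC⟩ := h1
    obtain ⟨E, hE0, hE⟩ := h2
    refine ⟨C + E, add_nonneg hC0 hE0, fun R Ψ S => ?_⟩
    rw [add_mul]
    exact (abs_add_le _ _).trans (add_le_add (hC R Ψ S) (hE R Ψ S))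

theorem bounded_strip (hϰ : 1 ≤ ϰ) (hw : PolyClass ϰ d w) (A : ℝ) :
    ∃ C, 0 ≤ C ∧ ∀ R Ψ S, |R| ≤ A → |w R Ψ S| ≤ C := by
  obtain ⟨C, hC0, hC⟩ := hw.bounded hϰ
  refine ⟨C * (1 + |A|) ^ d, by positivity, fun R Ψ S hR => (hC R Ψ S).trans ?_⟩
  exact mul_le_mul_of_nonneg_left (pow_le_pow_left₀ (by positivity)
    (by linarith [hR.trans (le_abs_self A)]) d) hC0

theorem periodic_angle (hw : PolyClass ϰ d w) (R Ψ S : ℝ) :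
    w R (Ψ + 2 * Real.pi) S = w R Ψ S := by
  induction hw with
  | monomial i c hi hc => simp only [hc.per_fst]
  | add w z _ _ h1 h2 => simp only [h1, h2]

end PolyClass

/-! ### Taylor coefficients in `h` and the count of degrees. -/

/-- Families `E(h, R, Ψ, S)` whose `m`-th Taylor coefficient in `h` at `0` is in
`PolyClass ϰ (m + d)`. -/
structure TaylorClass (ϰ d : ℕ) (E : ℝ → ℝ → ℝ → ℝ → ℝ) : Prop where
  smooth : ∀ R Ψ S, ContDiff ℝ ∞ (fun h => E h R Ψ S)
  coeff : ∀ m, PolyClass ϰ (m + d) (fun R Ψ S => iteratedDeriv m (fun h => E h R Ψ S) 0)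

namespace TaylorClass

variable {ϰ d e : ℕ} {E H : ℝ → ℝ → ℝ → ℝ → ℝ} {w : ℝ → ℝ → ℝ → ℝ}

theorem mono (hE : TaylorClass ϰ d E) (h : d ≤ e) : TaylorClass ϰ e E :=
  ⟨hE.smooth, fun m => (hE.coeff m).mono (by omega)⟩

theorem of_polyClass (hw : PolyClass ϰ d w) : TaylorClass ϰ d (fun _ R Ψ S => w R Ψ S) := by
  refine ⟨fun _ _ _ => contDiff_const, fun m => ?_⟩
  rcases m with _ | m
  · simpa using hw
  · simpa [iteratedDeriv_const] using PolyClass.const ϰ (m + 1 + d) 0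

theorem add (hE : TaylorClass ϰ d E) (hH : TaylorClass ϰ d H) :
    TaylorClass ϰ d (fun h R Ψ S => E h R Ψ S + H h R Ψ S) := by
  refine ⟨fun R Ψ S => (hE.smooth R Ψ S).add (hH.smooth R Ψ S), fun m => ?_⟩
  convert PolyClass.add _ _ (hE.coeff m) (hH.coeff m) using 4 with R Ψ S
  exact iteratedDeriv_fun_add ((hE.smooth R Ψ S).contDiffAt.of_le (by exact_mod_cast le_top))
    ((hH.smooth R Ψ S).contDiffAt.of_le (by exact_mod_cast le_top))

theorem iteratedDeriv_mul_eq {f g : ℝ → ℝ} (hf : ContDiff ℝ ∞ f) (hg : ContDiff ℝ ∞ g)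
    (n : ℕ) (x : ℝ) : iteratedDeriv n (fun y => f y * g y) x = ∑ i ∈ Finset.range (n + 1),
      (n.choose i : ℝ) * iteratedDeriv i f x * iteratedDeriv (n - i) g x := by
  simp only [← iteratedDerivWithin_univ]
  exact iteratedDerivWithin_mul (Set.mem_univ x) uniqueDiffOn_univ
    (hf.contDiffAt.of_le (by exact_mod_cast le_top)).contDiffWithinAt
    (hg.contDiffAt.of_le (by exact_mod_cast le_top)).contDiffWithinAt

theorem mul (hE : TaylorClass ϰ d E) (hH : TaylorClass ϰ e H) :
    TaylorClass ϰ (d + e) (fun h R Ψ S => E h R Ψ S * H h R Ψ S) := by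
  refine ⟨fun R Ψ S => (hE.smooth R Ψ S).mul (hH.smooth R Ψ S), fun m => ?_⟩
  simp_rw [fun R Ψ S => iteratedDeriv_mul_eq (hE.smooth R Ψ S) (hH.smooth R Ψ S) m 0]
  refine PolyClass.sum _ _ fun i hi => ?_
  have him : i ≤ m := Nat.lt_succ_iff.1 (Finset.mem_range.1 hi)
  exact (((hE.coeff i).const_mul _).mul (hH.coeff (m - i))).mono (by omega)

theorem pow (hE : TaylorClass ϰ d E) (l : ℕ) :
    TaylorClass ϰ (l * d) (fun h R Ψ S => E h R Ψ S ^ l) := by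
  induction l with
  | zero => simpa using of_polyClass (PolyClass.const ϰ 0 1)
  | succ l ih =>
    simp_rw [pow_succ, Nat.succ_mul]
    exact ih.mul hE

theorem sum {ι : Type*} (s : Finset ι) (E : ι → ℝ → ℝ → ℝ → ℝ → ℝ)
    (h : ∀ i ∈ s, TaylorClass ϰ d (E i)) :
    TaylorClass ϰ d (fun h R Ψ S => ∑ i ∈ s, E i h R Ψ S) := by
  classical
  induction s using Finset.induction_on with
  | empty => simpa using of_polyClass (PolyClass.const ϰ d 0)
  | insert i s hi ih =>
    simp_rw [Finset.sum_insert hi]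
    exact (h i (Finset.mem_insert_self i s)).add
      (ih fun j hj => h j (Finset.mem_insert_of_mem hj))

/-- The factor `h ^ d` shifts Taylor coefficients by `d`. In Leibniz's rule only `i = d` survives,
with degree `(m - d) + d = m`, so the excess `d` is absorbed. -/
theorem h_pow_mul (hE : TaylorClass ϰ d E) :
    TaylorClass ϰ 0 (fun h R Ψ S => h ^ d * E h R Ψ S) := by
  refine ⟨fun R Ψ S => (contDiff_id.pow d).mul (hE.smooth R Ψ S), fun m => ?_⟩
  have hp : ContDiff ℝ ∞ (fun x : ℝ => x ^ d) := contDiff_id.pow d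
  simp_rw [fun R Ψ S => iteratedDeriv_mul_eq hp (hE.smooth R Ψ S) m 0]
  refine PolyClass.sum _ _ fun i hi => ?_
  have him : i ≤ m := Nat.lt_succ_iff.1 (Finset.mem_range.1 hi)
  by_cases hid : i = d
  · exact ((hE.coeff (m - i)).const_mul _).mono (by omega)
  · have h0 : iteratedDeriv i (fun x : ℝ => x ^ d) 0 = 0 := by
      rw [iteratedDeriv_fun_pow_zero]
      simp [hid]
    simp_rw [h0, mul_zero, zero_mul]
    exact PolyClass.const ϰ _ 0

/-- Composition of a smooth periodic function with a perturbation of the angle. -/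
theorem comp_angle (hE : TaylorClass ϰ 0 E) (h0 : ∀ R Ψ S, E 0 R Ψ S = 0) {c : ℝ → ℝ → ℝ}
    (hc : SmoothPeriodic ϰ c) : TaylorClass ϰ 0 (fun h R Ψ S => c (Ψ + E h R Ψ S) S) := by
  have hs : ∀ c, SmoothPeriodic ϰ c → ∀ R Ψ S,
      ContDiff ℝ ∞ (fun h => c (Ψ + E h R Ψ S) S) := fun c hc R Ψ S =>
    (hc.smooth_fst S).comp (contDiff_const.add (hE.smooth R Ψ S))
  refine ⟨hs c hc, fun m => ?_⟩
  induction m using Nat.strong_induction_on generalizing c with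
  | _ m ih =>
    rcases m with _ | m
    · simpa [h0] using PolyClass.coeff hc 0
    -- One derivative in `h` gives `c'(Ψ + E) E'`. Leibniz's rule of order `m` then involves only
    -- orders `i ≤ m` of the first factor, so the induction applies with `c` replaced by `c'`; this
    -- is why `c` is generalized.
    · have hd : ∀ R Ψ S, deriv (fun h => c (Ψ + E h R Ψ S) S) = fun h =>
          deriv (fun x => c x S) (Ψ + E h R Ψ S) * deriv (fun h => E h R Ψ S) h := by
        intro R Ψ S
        funext h
        have h1 := ((hc.smooth_fst S).differentiable (by simp) (Ψ + E h R Ψ S)).hasDerivAt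
        have h2 := (((hE.smooth R Ψ S).differentiable (by simp) h).hasDerivAt).const_add Ψ
        exact (h1.comp h h2).deriv
      have hdE : ∀ R Ψ S, ContDiff ℝ ∞ (deriv fun h => E h R Ψ S) := fun R Ψ S =>
        (contDiff_infty_iff_deriv.1 (hE.smooth R Ψ S)).2
      simp_rw [iteratedDeriv_succ', hd,
        fun R Ψ S => iteratedDeriv_mul_eq (hs _ hc.deriv_fst R Ψ S) (hdE R Ψ S) m 0]
      refine PolyClass.sum _ _ fun i hi => ?_
      have him : i ≤ m := Nat.lt_succ_iff.1 (Finset.mem_range.1 hi)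
      have hE' := hE.coeff (m - i + 1)
      simp_rw [iteratedDeriv_succ'] at hE'
      exact (((ih i (by omega) hc.deriv_fst).const_mul _).mul hE').mono (by omega)

/-- Substitution of perturbed arguments into a function of `PolyClass`. -/
theorem comp_polyClass {X Y : ℝ → ℝ → ℝ → ℝ → ℝ} (hX : TaylorClass ϰ 0 X)
    (hY : TaylorClass ϰ 0 Y) (hY0 : ∀ R Ψ S, Y 0 R Ψ S = 0) (hw : PolyClass ϰ d w) :
    TaylorClass ϰ d (fun h R Ψ S => w (R + X h R Ψ S) (Ψ + Y h R Ψ S) S) := by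
  induction hw with
  | monomial i c hi hc =>
    have h1 : TaylorClass ϰ 1 (fun h R Ψ S => R + X h R Ψ S) :=
      (of_polyClass (PolyClass.id ϰ le_rfl)).add (hX.mono zero_le_one)
    exact ((h1.pow i).mul (hY.comp_angle hY0 hc)).mono (by omega)
  | add w z _ _ h1 h2 => exact h1.add h2

end TaylorClass

/-- Order in `h` and degree in `R` balance: each `h ^ i u_i`, `h ^ i v_i` and `h ^ j W_j` has excess
degree zero, and substitution preserves this balance. So the coefficient of `h ^ k` has degree at
most `k`. -/
theorem polyClass_compCoeff {ϰ k : ℕ} (c : ℕ → AvgCoeff) (W : ℕ → ℝ → ℝ → ℝ)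
    (hu : ∀ j ∈ Finset.Ico 1 k, PolyClass ϰ j (c j).u)
    (hv : ∀ j ∈ Finset.Ico 1 k, PolyClass ϰ j (c j).v)
    (hW : ∀ j ∈ Finset.Ico 1 k, PolyClass ϰ j (fun R Ψ _ => W j R Ψ)) :
    PolyClass ϰ k (OscSystem.compCoeff c W k) := by
  have hX := TaylorClass.sum _ (fun i h R Ψ S => h ^ i * (c i).u R Ψ S)
    fun i hi => (TaylorClass.of_polyClass (hu i hi)).h_pow_mul
  have hY := TaylorClass.sum _ (fun i h R Ψ S => h ^ i * (c i).v R Ψ S)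
    fun i hi => (TaylorClass.of_polyClass (hv i hi)).h_pow_mul
  have hY0 : ∀ R Ψ S : ℝ, ∑ i ∈ Finset.Ico 1 k, (0 : ℝ) ^ i * (c i).v R Ψ S = 0 :=
    fun R Ψ S => Finset.sum_eq_zero fun i hi => by
      rw [zero_pow (by have := (Finset.mem_Ico.1 hi).1; omega), zero_mul]
  have h := TaylorClass.sum _ (fun j h R Ψ S => h ^ j *
      W j (R + ∑ i ∈ Finset.Ico 1 k, h ^ i * (c i).u R Ψ S)
        (Ψ + ∑ i ∈ Finset.Ico 1 k, h ^ i * (c i).v R Ψ S))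
    fun j hj => (TaylorClass.comp_polyClass hX hY hY0 (hW j hj)).h_pow_mul
  have hk := (h.coeff k).const_mul ((Nat.factorial k : ℝ)⁻¹)
  rw [add_zero] at hk
  convert hk using 4 with R Ψ S
  unfold OscSystem.compCoeff
  rw [div_eq_inv_mul]

/-! ### Derivatives in `r` of the coefficients of the perturbations. -/

/-- Smooth functions of `(r, φ, S)`, `|r| ≤ Rmax`, that are `2π`-periodic in `φ` and `S`. -/
structure PeriodicCoeff (Rmax : ℝ) (f : ℝ → ℝ → ℝ → ℝ) : Prop where
  smooth : ContDiffOn ℝ ∞ (fun x : ℝ × ℝ × ℝ => f x.1 x.2.1 x.2.2)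
    (Set.Icc (-Rmax) Rmax ×ˢ Set.univ ×ˢ Set.univ)
  periodic : ∀ r φ S, |r| ≤ Rmax →
    f r (φ + 2 * Real.pi) S = f r φ S ∧ f r φ (S + 2 * Real.pi) = f r φ S

namespace PeriodicCoeff

variable {Rmax : ℝ} {f : ℝ → ℝ → ℝ → ℝ}

theorem isOpen_dom (Rmax : ℝ) :
    IsOpen (Set.Ioo (-Rmax) Rmax ×ˢ (Set.univ : Set (ℝ × ℝ))) :=
  isOpen_Ioo.prod isOpen_univ

/-- The open interval is needed because `iteratedDeriv` is two-sided, while nothing is known about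
`f` outside `|r| ≤ Rmax`. -/
theorem smooth_iteratedDeriv (hf : PeriodicCoeff Rmax f) (i : ℕ) :
    ContDiffOn ℝ ∞ (fun x : ℝ × ℝ × ℝ => iteratedDeriv i (fun r => f r x.2.1 x.2.2) x.1)
      (Set.Ioo (-Rmax) Rmax ×ˢ Set.univ) := by
  induction i with
  | zero =>
    simp only [iteratedDeriv_zero]
    refine hf.smooth.mono ?_
    rintro ⟨r, φ, S⟩ ⟨hr, _⟩
    exact ⟨Set.Ioo_subset_Icc_self hr, trivial, trivial⟩
  | succ i ih =>
    have hfd : ContDiffOn ℝ ∞ (fun x => fderiv ℝ (fun x : ℝ × ℝ × ℝ =>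
        iteratedDeriv i (fun r => f r x.2.1 x.2.2) x.1) x (1, 0, 0))
        (Set.Ioo (-Rmax) Rmax ×ˢ Set.univ) :=
      (ih.fderiv_of_isOpen (isOpen_dom Rmax) (m := ∞) (by simp)).clm_apply contDiffOn_const
    refine hfd.congr fun x hx => ?_
    rw [iteratedDeriv_succ]
    have h1 := ((ih.contDiffAt ((isOpen_dom Rmax).mem_nhds hx)).differentiableAt
      (by simp)).hasFDerivAt
    have h2 : HasDerivAt (fun r : ℝ => (r, x.2.1, x.2.2)) ((1 : ℝ), (0 : ℝ), (0 : ℝ)) x.1 :=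
      (hasDerivAt_id x.1).prodMk (hasDerivAt_const x.1 x.2)
    exact (HasFDerivAt.comp_hasDerivAt (f := fun r : ℝ => (r, x.2.1, x.2.2)) x.1 h1 h2).deriv

theorem periodic_iteratedDeriv (hf : PeriodicCoeff Rmax f) (i : ℕ) {r : ℝ} (hr : |r| < Rmax)
    (φ S : ℝ) :
    iteratedDeriv i (fun r => f r (φ + 2 * Real.pi) S) r = iteratedDeriv i (fun r => f r φ S) r ∧
    iteratedDeriv i (fun r => f r φ (S + 2 * Real.pi)) r =
      iteratedDeriv i (fun r => f r φ S) r := by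
  have h : ∀ᶠ x in nhds r, |x| ≤ Rmax :=
    (continuous_abs.continuousAt.eventually_lt continuousAt_const hr).mono fun x hx => hx.le
  exact ⟨Filter.EventuallyEq.iteratedDeriv_eq i (h.mono fun x hx => (hf.periodic x φ S hx).1),
    Filter.EventuallyEq.iteratedDeriv_eq i (h.mono fun x hx => (hf.periodic x φ S hx).2)⟩

theorem bounded_iteratedDeriv (hf : PeriodicCoeff Rmax f) (i : ℕ) {b : ℝ} (hb : b < Rmax) :
    ∃ C, 0 ≤ C ∧ ∀ r φ S, |r| ≤ b → |iteratedDeriv i (fun r => f r φ S) r| ≤ C := by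
  have hK : IsCompact (Set.Icc (-b) b ×ˢ Set.Icc (0 : ℝ) (2 * Real.pi) ×ˢ
      Set.Icc (0 : ℝ) (2 * Real.pi)) := isCompact_Icc.prod (isCompact_Icc.prod isCompact_Icc)
  obtain ⟨C, hC⟩ := hK.exists_bound_of_continuousOn
    ((hf.smooth_iteratedDeriv i).continuousOn.mono (by
      rintro ⟨r, φ, S⟩ ⟨hr, _⟩
      exact ⟨⟨by linarith [hr.1], by linarith [hr.2]⟩, trivial⟩))
  refine ⟨|C|, abs_nonneg C, fun r φ S hr => ?_⟩
  obtain ⟨y, hy, hy'⟩ := Function.Periodic.exists_mem_Ico₀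
    (show Function.Periodic (fun x => iteratedDeriv i (fun r => f r x S) r) (2 * Real.pi) from
      fun x => (hf.periodic_iteratedDeriv i (hr.trans_lt hb) x S).1) Real.two_pi_pos φ
  obtain ⟨z, hz, hz'⟩ := Function.Periodic.exists_mem_Ico₀
    (show Function.Periodic (fun x => iteratedDeriv i (fun r => f r y x) r) (2 * Real.pi) from
      fun x => (hf.periodic_iteratedDeriv i (hr.trans_lt hb) y x).2) Real.two_pi_pos S
  rw [show iteratedDeriv i (fun r => f r φ S) r = iteratedDeriv i (fun r => f r y S) r from hy',
    show iteratedDeriv i (fun r => f r y S) r = iteratedDeriv i (fun r => f r y z) r from hz']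
  exact (hC (r, y, z) ⟨abs_le.1 hr, ⟨hy.1, hy.2.le⟩, ⟨hz.1, hz.2.le⟩⟩).trans (le_abs_self C)

/-- The Taylor coefficients at `a` on the resonant phase. -/
theorem smoothPeriodic (hf : PeriodicCoeff Rmax f) (i κ : ℕ) {ϰ : ℕ} (hϰ : 1 ≤ ϰ) {a : ℝ}
    (ha : |a| < Rmax) : SmoothPeriodic ϰ
      (fun Ψ S => iteratedDeriv i (fun r => f r ((κ : ℝ) / ϰ * S + Ψ) S) a) := by
  have hper := hf.periodic_iteratedDeriv i ha
  refine ⟨?_, fun Ψ S => ?_, fun Ψ S => ?_⟩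
  · have h := (hf.smooth_iteratedDeriv i).comp
      (f := fun p : ℝ × ℝ => (a, (κ : ℝ) / ϰ * p.2 + p.1, p.2)) (s := Set.univ)
      (by fun_prop) (fun p _ => ⟨abs_lt.1 ha, trivial⟩)
    exact contDiffOn_univ.1 h
  · rw [← add_assoc]
    exact (hper _ S).1
  -- Shifting `S` by `2πϰ` turns the angle `κ/ϰ S + Ψ` by `κ` full periods; this explains the common
  -- period `2πϰ`.
  · have h1 : (κ : ℝ) / ϰ * (S + 2 * Real.pi * ϰ) + Ψ =
        (κ : ℝ) / ϰ * S + Ψ + κ * (2 * Real.pi) := by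
      have : (ϰ : ℝ) ≠ 0 := by positivity
      field_simp
      ring
    have h2 : S + 2 * Real.pi * ϰ = S + ϰ * (2 * Real.pi) := by ring
    rw [h1, h2]
    exact ((show Function.Periodic (fun x => iteratedDeriv i (fun r => f r _ x) a) (2 * Real.pi)
      from fun x => (hper _ x).2).nat_mul ϰ S).trans
      ((show Function.Periodic (fun x => iteratedDeriv i (fun r => f r x S) a) (2 * Real.pi)
      from fun x => (hper x S).1).nat_mul κ _)

end PeriodicCoeff

/-! ### Degree bounds for the averaging recursion. -/

namespace OscSystem

variable {D : OscSystem}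

theorem Regular.periodicCoeff_fc (hD : D.Regular) {j : ℕ} (hj : 1 ≤ j) :
    PeriodicCoeff D.Rmax (D.fc j) :=
  ⟨hD.fc_smooth j hj, fun r φ S hr => hD.fc_periodic j r φ S hj hr⟩

theorem Regular.periodicCoeff_gc (hD : D.Regular) {j : ℕ} (hj : 1 ≤ j) :
    PeriodicCoeff D.Rmax (D.gc j) :=
  ⟨hD.gc_smooth j hj, fun r φ S hr => hD.gc_periodic j r φ S hj hr⟩

theorem polyClass_taylorTerm {f : ℝ → ℝ → ℝ → ℝ} {Rmax a : ℝ} (hf : PeriodicCoeff Rmax f)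
    (ha : |a| < Rmax) {ϰ : ℕ} (hϰ : 1 ≤ ϰ) (κ i : ℕ) {d : ℕ} (hid : i ≤ d) :
    PolyClass ϰ d (fun R Ψ S => iteratedDeriv i (fun r => f r ((κ : ℝ) / ϰ * S + Ψ) S) a
      * R ^ i / (Nat.factorial i : ℝ)) := by
  convert (PolyClass.monomial (d := d) i _ hid (hf.smoothPeriodic i κ hϰ ha)).const_mul
    ((Nat.factorial i : ℝ)⁻¹) using 4
  ring

theorem polyClass_Fc (hD : D.Regular) (hres : D.Resonant) {k : ℕ} (hk : 1 ≤ k) :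
    PolyClass D.ϰ k (D.Fc k) := by
  refine PolyClass.add _ _ (PolyClass.sum _ _ fun j hj => ?_) ?_
  · have := Finset.mem_Icc.1 hj
    exact polyClass_taylorTerm (hD.periodicCoeff_fc this.1) hres.a_lt hres.ϰ_pos _ _ (by omega)
  · split_ifs
    · convert (PolyClass.id D.ϰ hk).const_mul ((2 * D.q : ℝ)⁻¹) using 4
      ring
    · exact PolyClass.const _ _ 0

theorem polyClass_Gc (hD : D.Regular) (hres : D.Resonant) (k : ℕ) :
    PolyClass D.ϰ k (D.Gc k) := by
  refine PolyClass.add _ _ (PolyClass.sub ?_ (PolyClass.const _ _ _))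
    (PolyClass.sum _ _ fun j hj => ?_)
  · convert PolyClass.monomial (d := k) k _ le_rfl (SmoothPeriodic.const D.ϰ
      (iteratedDeriv k D.ω D.a / (Nat.factorial k : ℝ))) using 4
    ring
  · have := Finset.mem_Icc.1 hj
    exact polyClass_taylorTerm (hD.periodicCoeff_gc this.1) hres.a_lt hres.ϰ_pos _ _ (by omega)

theorem polyClass_driftCoeff (hD : D.Regular) (hres : D.Resonant) (w : ℕ → ℝ → ℝ → ℝ → ℝ)
    {k : ℕ} (hw : ∀ j ∈ Finset.Ico 1 k, PolyClass D.ϰ j (w j)) :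
    PolyClass D.ϰ k (D.driftCoeff w k) := by
  refine PolyClass.sum _ _ fun j hj => ?_
  have hj' := Finset.mem_Ico.1 hj
  have hwj := hw (k - j) (Finset.mem_Ico.2 (by omega))
  exact PolyClass.add _ _ (PolyClass.add _ _ (PolyClass.add _ _
    (((polyClass_Fc hD hres hj'.1).mul hwj.deriv₁).mono (by omega))
    (((polyClass_Gc hD hres j).mul hwj.deriv₂).mono (by omega)))
    ((hwj.deriv₃.const_mul _).mono (by omega))) ((hwj.const_mul _).mono (by omega))

/-- All four coefficients of order `k` are polynomials of degree at most `k` in `R`. -/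
structure AvgPoly (ϰ k : ℕ) (c : AvgCoeff) : Prop where
  u : PolyClass ϰ k c.u
  v : PolyClass ϰ k c.v
  Lam : PolyClass ϰ k (fun R Ψ _ => c.Lam R Ψ)
  Om : PolyClass ϰ k (fun R Ψ _ => c.Om R Ψ)

theorem polyClass_avgSourceF (hD : D.Regular) (hres : D.Resonant) (c : ℕ → AvgCoeff) {k : ℕ}
    (hk : 1 ≤ k) (hc : ∀ j ∈ Finset.Ico 1 k, AvgPoly D.ϰ j (c j)) :
    PolyClass D.ϰ k (D.avgSourceF c k) :=
  (polyClass_Fc hD hres hk).sub ((polyClass_compCoeff c _ (fun j hj => (hc j hj).u)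
    (fun j hj => (hc j hj).v) (fun j hj => (hc j hj).Lam)).sub
      (polyClass_driftCoeff hD hres _ fun j hj => (hc j hj).u))

theorem polyClass_avgSourceG (hD : D.Regular) (hres : D.Resonant) (c : ℕ → AvgCoeff) {k : ℕ}
    (hc : ∀ j ∈ Finset.Ico 1 k, AvgPoly D.ϰ j (c j)) :
    PolyClass D.ϰ k (D.avgSourceG c k) :=
  (polyClass_Gc hD hres k).sub ((polyClass_compCoeff c _ (fun j hj => (hc j hj).u)
    (fun j hj => (hc j hj).v) (fun j hj => (hc j hj).Om)).sub
      (polyClass_driftCoeff hD hres _ fun j hj => (hc j hj).v))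

/-- The coefficients of orders below `k`. -/
noncomputable def coeffBelow (D : OscSystem) (k j : ℕ) : AvgCoeff :=
  if j < k then D.coeff j else AvgCoeff.zero

theorem coeff_eq {k : ℕ} (hk : 1 ≤ k) : D.coeff k = D.avgStep (D.coeffBelow k) k := by
  rw [coeff, if_neg (by omega)]
  rfl

/-- Strong induction on the order: composition, products with `F_j` and `G_j`, derivatives, means
and zero-mean primitives all respect the rule that order `k` has degree at most `k`. -/
theorem avgPoly_coeff (hD : D.Regular) (hres : D.Resonant) {k : ℕ} (hk : 1 ≤ k) :
    AvgPoly D.ϰ k (D.coeff k) := by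
  induction k using Nat.strong_induction_on with
  | _ k ih =>
    have hc : ∀ j ∈ Finset.Ico 1 k, AvgPoly D.ϰ j (D.coeffBelow k j) := fun j hj => by
      have hj' := Finset.mem_Ico.1 hj
      rw [coeffBelow, if_pos hj'.2]
      exact ih j hj'.2 hj'.1
    rw [coeff_eq hk]
    have hF := polyClass_avgSourceF hD hres _ hk hc
    have hG := polyClass_avgSourceG hD hres _ hc
    exact ⟨hF.zeroMeanPrimitive hres.ϰ_pos _, hG.zeroMeanPrimitive hres.ϰ_pos _, hF.mean, hG.mean⟩

end OscSystem

/-! ### Taylor remainders and products of truncated expansions. -/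

/-- The derivative of the remainder of order `n + 1` of `g` is the remainder of order `n` of `g'`,
so induction and the mean value inequality suffice. The factor `1/n!` is given up, since only the
order in `x` and uniformity of `C` matter. -/
theorem abs_sub_taylor_le {g : ℝ → ℝ} {l u a C : ℝ} (ha : a ∈ Set.Ioo l u) (n : ℕ)
    (hg : ContDiffOn ℝ ∞ g (Set.Ioo l u))
    (hC : ∀ y ∈ Set.Ioo l u, |iteratedDeriv n g y| ≤ C) {x : ℝ} (hx : a + x ∈ Set.Ioo l u) :
    |g (a + x) - ∑ i ∈ Finset.range n, iteratedDeriv i g a * x ^ i / (Nat.factorial i : ℝ)|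
      ≤ C * |x| ^ n := by
  induction n generalizing g x with
  | zero => simpa using hC _ hx
  | succ n ih =>
    have hseg : ∀ y ∈ Set.uIcc 0 x, a + y ∈ Set.Ioo l u := by
      intro y hy
      rcases Set.mem_uIcc.1 hy with h | h <;> constructor <;>
        linarith [ha.1, ha.2, hx.1, hx.2, h.1, h.2]
    have hdg : ContDiffOn ℝ ∞ (deriv g) (Set.Ioo l u) :=
      ((contDiffOn_infty_iff_deriv_of_isOpen isOpen_Ioo).1 hg).2
    have hdiff : ∀ y ∈ Set.uIcc 0 x, HasDerivWithinAt
        (fun y => g (a + y) - ∑ i ∈ Finset.range (n + 1),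
          iteratedDeriv i g a * y ^ i / (Nat.factorial i : ℝ))
        (deriv g (a + y) - ∑ i ∈ Finset.range n,
          iteratedDeriv i (deriv g) a * y ^ i / (Nat.factorial i : ℝ)) (Set.uIcc 0 x) y := by
      intro y hy
      have h1 : HasDerivAt (fun y => g (a + y)) (deriv g (a + y)) y :=
        HasDerivAt.comp_const_add a y ((hg.contDiffAt (isOpen_Ioo.mem_nhds
          (hseg y hy))).differentiableAt (by simp)).hasDerivAt
      have h2 : HasDerivAt (fun y => ∑ i ∈ Finset.range (n + 1),
          iteratedDeriv i g a * y ^ i / (Nat.factorial i : ℝ))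
          (∑ i ∈ Finset.range (n + 1),
            iteratedDeriv i g a * (i * y ^ (i - 1)) / (Nat.factorial i : ℝ)) y :=
        HasDerivAt.fun_sum fun i _ => ((hasDerivAt_pow i y).const_mul _).div_const _
      have h3 : ∑ i ∈ Finset.range (n + 1),
            iteratedDeriv i g a * (i * y ^ (i - 1)) / (Nat.factorial i : ℝ) =
          ∑ i ∈ Finset.range n,
            iteratedDeriv i (deriv g) a * y ^ i / (Nat.factorial i : ℝ) := by
        rw [Finset.sum_range_succ']
        simp only [Nat.cast_zero, zero_mul, mul_zero, zero_div, add_zero]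
        refine Finset.sum_congr rfl fun i _ => ?_
        rw [← iteratedDeriv_succ', Nat.factorial_succ, Nat.add_sub_cancel]
        push_cast
        have : (Nat.factorial i : ℝ) ≠ 0 := by exact_mod_cast Nat.factorial_ne_zero i
        field_simp
      rw [h3] at h2
      exact (h1.sub h2).hasDerivWithinAt
    have hC0 : 0 ≤ C := (abs_nonneg _).trans (hC _ hx)
    have hbd : ∀ y ∈ Set.uIcc 0 x, ‖deriv g (a + y) - ∑ i ∈ Finset.range n,
        iteratedDeriv i (deriv g) a * y ^ i / (Nat.factorial i : ℝ)‖ ≤ C * |x| ^ n := by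
      intro y hy
      refine (ih hdg (fun z hz => by rw [← iteratedDeriv_succ']; exact hC z hz)
        (hseg y hy)).trans ?_
      refine mul_le_mul_of_nonneg_left (pow_le_pow_left₀ (abs_nonneg y) ?_ n) hC0
      simpa using Set.abs_sub_left_of_mem_uIcc hy
    have := (convex_uIcc (0 : ℝ) x).norm_image_sub_le_of_norm_hasDerivWithin_le hdiff hbd
      Set.left_mem_uIcc Set.right_mem_uIcc
    have hz : ∑ i ∈ Finset.range (n + 1),
        iteratedDeriv i g a * (0 : ℝ) ^ i / (Nat.factorial i : ℝ) = g a := by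
      simp [Finset.sum_range_succ']
    rw [hz] at this
    simpa [pow_succ, mul_assoc] using this

section Algebra

variable {X : Type*} {l : Filter X} {h : X → ℝ}

theorem isBigO_pow_of_le (hh : h =O[l] (fun _ => (1 : ℝ))) {m n : ℕ} (hmn : n ≤ m) :
    (fun x => h x ^ m) =O[l] fun x => h x ^ n := by
  obtain ⟨k, rfl⟩ := Nat.exists_eq_add_of_le hmn
  simpa [pow_add] using (isBigO_refl (fun x => h x ^ n) l).mul (hh.pow k)

theorem isBigO_pow_mul (hh : h =O[l] (fun _ => (1 : ℝ))) {m n : ℕ} (hmn : n ≤ m) {b : X → ℝ}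
    (hb : b =O[l] (fun _ => (1 : ℝ))) :
    (fun x => h x ^ m * b x) =O[l] fun x => h x ^ n := by
  simpa using (isBigO_pow_of_le hh hmn).mul hb

/-- Cauchy product of truncated expansions. -/
theorem isBigO_cauchy (hh : h =O[l] (fun _ => (1 : ℝ))) (n : ℕ) {x y : X → ℝ} {a b : ℕ → X → ℝ}
    (ha : ∀ k ∈ Finset.Icc 1 n, a k =O[l] (fun _ => (1 : ℝ)))
    (hb : ∀ k ∈ Finset.Icc 1 n, b k =O[l] (fun _ => (1 : ℝ)))
    (hx : (fun p => x p - ∑ k ∈ Finset.Icc 1 n, h p ^ k * a k p) =O[l] fun p => h p ^ (n + 1))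
    (hy : ∀ p, y p = ∑ k ∈ Finset.Icc 1 n, h p ^ k * b k p) :
    (fun p => x p * y p - ∑ m ∈ Finset.Icc 1 n, h p ^ m *
      ∑ j ∈ Finset.Ico 1 m, a j p * b (m - j) p) =O[l] fun p => h p ^ (n + 1) := by
  have hy1 : y =O[l] (fun _ => (1 : ℝ)) := by
    rw [show y = _ from funext hy]
    refine IsBigO.fun_sum fun k hk => ?_
    simpa using isBigO_pow_mul hh (Nat.zero_le k) (hb k hk)
  have h1 : (fun p => (x p - ∑ k ∈ Finset.Icc 1 n, h p ^ k * a k p) * y p) =O[l]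
      fun p => h p ^ (n + 1) := by simpa using hx.mul hy1
  -- The double product contains pairs of total order above `n`; these go into the error, and the
  -- remaining pairs regroup by total order `m`.
  have h2 : (fun p => ∑ z ∈ (Finset.Icc 1 n ×ˢ Finset.Icc 1 n).filter
      (fun z => ¬ z.1 + z.2 ≤ n), h p ^ (z.1 + z.2) * (a z.1 p * b z.2 p)) =O[l]
      fun p => h p ^ (n + 1) := by
    refine IsBigO.fun_sum fun z hz => ?_
    obtain ⟨hz1, hz2⟩ := Finset.mem_filter.1 hz
    obtain ⟨hz3, hz4⟩ := Finset.mem_product.1 hz1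
    refine isBigO_pow_mul hh (by omega) ?_
    simpa using (ha _ hz3).mul (hb _ hz4)
  refine (h1.add h2).congr_left fun p => ?_
  have h3 : (∑ k ∈ Finset.Icc 1 n, h p ^ k * a k p) * y p =
      ∑ z ∈ Finset.Icc 1 n ×ˢ Finset.Icc 1 n, h p ^ (z.1 + z.2) * (a z.1 p * b z.2 p) := by
    rw [hy, Finset.sum_mul_sum, Finset.sum_product]
    refine Finset.sum_congr rfl fun i _ => Finset.sum_congr rfl fun j _ => ?_
    rw [pow_add]
    ring
  have h4 : ∑ m ∈ Finset.Icc 1 n, h p ^ m * ∑ j ∈ Finset.Ico 1 m, a j p * b (m - j) p =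
      ∑ z ∈ (Finset.Icc 1 n ×ˢ Finset.Icc 1 n).filter (fun z => z.1 + z.2 ≤ n),
        h p ^ (z.1 + z.2) * (a z.1 p * b z.2 p) := by
    simp_rw [Finset.mul_sum]
    rw [Finset.sum_sigma']
    refine Finset.sum_nbij' (fun s => (s.2, s.1 - s.2)) (fun z => ⟨z.1 + z.2, z.1⟩) ?_ ?_ ?_ ?_ ?_
    · rintro ⟨m, j⟩ hs
      simp only [Finset.mem_sigma, Finset.mem_Icc, Finset.mem_Ico, Finset.mem_filter,
        Finset.mem_product] at hs ⊢
      omega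
    · rintro ⟨j, k⟩ hz
      simp only [Finset.mem_sigma, Finset.mem_Icc, Finset.mem_Ico, Finset.mem_filter,
        Finset.mem_product] at hz ⊢
      omega
    · rintro ⟨m, j⟩ hs
      simp only [Finset.mem_sigma, Finset.mem_Icc, Finset.mem_Ico] at hs
      simp only [Sigma.mk.injEq, heq_eq_eq, and_true]
      omega
    · rintro ⟨j, k⟩ _
      simp
    · rintro ⟨m, j⟩ hs
      simp only [Finset.mem_sigma, Finset.mem_Icc, Finset.mem_Ico] at hs
      simp only
      rw [Nat.add_sub_cancel' (by omega)]
  rw [h4, sub_mul, h3, ← Finset.sum_filter_add_sum_filter_not _ (fun z : ℕ × ℕ => z.1 + z.2 ≤ n)]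
  ring

end Algebra

/-! ### Expansions in powers of `h` uniform on strips. -/

/-- The points `(R, Ψ, S, t)` with `|R| ≤ A`, as `t → ∞`. -/
noncomputable def stripFilter (A : ℝ) : Filter (ℝ × ℝ × ℝ × ℝ) :=
  comap (fun x => x.2.2.2) atTop ⊓ 𝓟 {x | |x.1| ≤ A}

/-- The filter restricts neither `Ψ` nor `S`, so estimates along it are automatically uniform in
both. -/
theorem eventually_stripFilter {A : ℝ} {p : ℝ × ℝ × ℝ × ℝ → Prop} :
    (∀ᶠ x in stripFilter A, p x) ↔
      ∃ t₁, ∀ R Ψ S t, |R| ≤ A → t₁ ≤ t → p (R, Ψ, S, t) := by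
  rw [stripFilter, eventually_inf_principal]
  simp only [eventually_comap, eventually_atTop]
  constructor
  · rintro ⟨t₁, h⟩
    exact ⟨t₁, fun R Ψ S t hR ht => h t ht (R, Ψ, S, t) rfl hR⟩
  · rintro ⟨t₁, h⟩
    refine ⟨t₁, fun t ht x hx hR => ?_⟩
    obtain ⟨R, Ψ, S, t'⟩ := x
    exact h R Ψ S t' hR (by rw [show t' = t from hx]; exact ht)

theorem tendsto_time_stripFilter (A : ℝ) :
    Tendsto (fun x : ℝ × ℝ × ℝ × ℝ => x.2.2.2) (stripFilter A) atTop :=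
  tendsto_comap.mono_left inf_le_left

theorem eventually_strip (A : ℝ) : ∀ᶠ x in stripFilter A, |x.1| ≤ A :=
  eventually_stripFilter.2 ⟨0, fun _ _ _ _ hR _ => hR⟩

theorem PolyClass.isBigO_one {ϰ d : ℕ} (hϰ : 1 ≤ ϰ) {w : ℝ → ℝ → ℝ → ℝ} (hw : PolyClass ϰ d w)
    (A : ℝ) : (fun x : ℝ × ℝ × ℝ × ℝ => w x.1 x.2.1 x.2.2.1) =O[stripFilter A]
      (fun _ => (1 : ℝ)) := by
  obtain ⟨C, _, hC⟩ := hw.bounded_strip hϰ A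
  refine IsBigO.of_bound C ((eventually_strip A).mono fun x hx => ?_)
  simpa using hC x.1 x.2.1 x.2.2.1 hx

namespace OscSystem

variable {D : OscSystem}

theorem scale_eq_pow (D : OscSystem) (k : ℕ) {t : ℝ} (ht : 0 < t) :
    D.scale k t = D.scale 1 t ^ k := by
  unfold scale
  rw [← Real.rpow_natCast, ← Real.rpow_mul ht.le]
  congr 1
  push_cast
  ring

theorem scale_one_pos (D : OscSystem) {t : ℝ} (ht : 0 < t) : 0 < D.scale 1 t :=
  Real.rpow_pos_of_pos ht _

theorem rpow_neg_div_q (hD : D.Regular) (j : ℕ) {t : ℝ} (ht : 0 < t) :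
    t ^ (-(j : ℝ) / D.q) = D.scale 1 t ^ (2 * j) := by
  rw [← scale_eq_pow D _ ht]
  unfold scale
  congr 1
  have : (D.q : ℝ) ≠ 0 := by exact_mod_cast (Nat.one_le_iff_ne_zero.1 hD.q_pos)
  push_cast
  field_simp

theorem rpow_inv_two_q (D : OscSystem) {t : ℝ} (ht : 0 < t) :
    t ^ ((1 : ℝ) / (2 * D.q)) = (D.scale 1 t)⁻¹ := by
  unfold scale
  rw [← Real.rpow_neg ht.le]
  congr 1
  push_cast
  ring

theorem inv_eq_scale_pow (hD : D.Regular) {t : ℝ} (ht : 0 < t) :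
    t⁻¹ = D.scale 1 t ^ (2 * D.q) := by
  rw [← rpow_neg_div_q hD _ ht, neg_div, div_self, Real.rpow_neg_one]
  exact_mod_cast (Nat.one_le_iff_ne_zero.1 hD.q_pos)

theorem tendsto_scale_one (hD : D.Regular) : Tendsto (D.scale 1) atTop (𝓝 0) := by
  have hq : (0 : ℝ) < D.q := by exact_mod_cast hD.q_pos
  have := tendsto_rpow_neg_atTop (y := 1 / (2 * (D.q : ℝ))) (by positivity)
  refine this.congr fun t => ?_
  unfold scale
  congr 1
  push_cast
  ring

theorem tendsto_scale_stripFilter (hD : D.Regular) (A : ℝ) :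
    Tendsto (fun x : ℝ × ℝ × ℝ × ℝ => D.scale 1 x.2.2.2) (stripFilter A) (𝓝 0) :=
  (tendsto_scale_one hD).comp (tendsto_time_stripFilter A)

theorem scale_isBigO_one (hD : D.Regular) (A : ℝ) :
    (fun x : ℝ × ℝ × ℝ × ℝ => D.scale 1 x.2.2.2) =O[stripFilter A] (fun _ => (1 : ℝ)) :=
  (tendsto_scale_stripFilter hD A).isBigO_one ℝ

theorem eventually_time_pos (A : ℝ) : ∀ᶠ x : ℝ × ℝ × ℝ × ℝ in stripFilter A, 0 < x.2.2.2 :=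
  (tendsto_time_stripFilter A).eventually_gt_atTop 0

/-- Eventually the amplitude stays within any neighbourhood of `a`. -/
theorem eventually_amplitude (hD : D.Regular) (A : ℝ) {δ : ℝ} (hδ : 0 < δ) :
    ∀ᶠ x : ℝ × ℝ × ℝ × ℝ in stripFilter A, |D.scale 1 x.2.2.2 * x.1| < δ := by
  have h : Tendsto (fun x : ℝ × ℝ × ℝ × ℝ => |D.scale 1 x.2.2.2| * |A|) (stripFilter A)
      (𝓝 0) := by
    simpa using ((tendsto_scale_stripFilter hD A).abs).mul_const |A|
  filter_upwards [h.eventually_lt_const hδ, eventually_strip A] with x hx hA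
  rw [abs_mul]
  exact (mul_le_mul_of_nonneg_left (hA.trans (le_abs_self A)) (abs_nonneg _)).trans_lt hx

theorem taylor_isBigO (hD : D.Regular) (hres : D.Resonant) {f : ℝ → ℝ → ℝ → ℝ}
    (hf : PeriodicCoeff D.Rmax f) (A : ℝ) (n : ℕ) :
    (fun x : ℝ × ℝ × ℝ × ℝ =>
      f (D.a + D.scale 1 x.2.2.2 * x.1) ((D.κ : ℝ) / D.ϰ * x.2.2.1 + x.2.1) x.2.2.1
      - ∑ i ∈ Finset.range n, D.scale 1 x.2.2.2 ^ i *
        (iteratedDeriv i (fun r => f r ((D.κ : ℝ) / D.ϰ * x.2.2.1 + x.2.1) x.2.2.1) D.a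
          * x.1 ^ i / (Nat.factorial i : ℝ))) =O[stripFilter A]
      fun x => D.scale 1 x.2.2.2 ^ n := by
  -- A buffer between `|a|` and `Rmax`: the derivatives are bounded uniformly for `|r| ≤ b`, and `a
  -- + h R` lies in `(-b, b)` at late times.
  obtain ⟨b, hab, hb⟩ := exists_between hres.a_lt
  have hb0 : 0 < b := hres.a_ne.trans hab
  obtain ⟨C, hC0, hC⟩ := hf.bounded_iteratedDeriv n hb
  refine IsBigO.of_bound (C * |A| ^ n) ?_
  filter_upwards [eventually_amplitude hD A (sub_pos.2 hab), eventually_strip A] with x hx hA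
  have ha : D.a ∈ Set.Ioo (-b) b := abs_lt.1 hab
  have hax : D.a + D.scale 1 x.2.2.2 * x.1 ∈ Set.Ioo (-b) b := by
    refine abs_lt.1 ((abs_add_le _ _).trans_lt ?_)
    linarith
  have hsm : ContDiffOn ℝ ∞
      (fun r => f r ((D.κ : ℝ) / D.ϰ * x.2.2.1 + x.2.1) x.2.2.1) (Set.Ioo (-b) b) := by
    refine hf.smooth.comp (f := fun r : ℝ => (r, (D.κ : ℝ) / D.ϰ * x.2.2.1 + x.2.1, x.2.2.1))
      (by fun_prop) fun r hr => ⟨⟨by linarith [hr.1], by linarith [hr.2]⟩, trivial, trivial⟩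
  have h := abs_sub_taylor_le ha n hsm (fun y hy => hC y _ _ (abs_le.2 ⟨hy.1.le, hy.2.le⟩)) hax
  have hsum : ∀ i, D.scale 1 x.2.2.2 ^ i *
        (iteratedDeriv i (fun r => f r ((D.κ : ℝ) / D.ϰ * x.2.2.1 + x.2.1) x.2.2.1) D.a
          * x.1 ^ i / (Nat.factorial i : ℝ)) =
      iteratedDeriv i (fun r => f r ((D.κ : ℝ) / D.ϰ * x.2.2.1 + x.2.1) x.2.2.1) D.a
          * (D.scale 1 x.2.2.2 * x.1) ^ i / (Nat.factorial i : ℝ) := fun i => by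
    rw [mul_pow]
    ring
  simp_rw [hsum, Real.norm_eq_abs]
  refine h.trans ?_
  rw [abs_mul, mul_pow, abs_pow, mul_assoc C, mul_comm (|A| ^ n)]
  refine mul_le_mul_of_nonneg_left (mul_le_mul_of_nonneg_left ?_ (by positivity)) hC0
  exact pow_le_pow_left₀ (abs_nonneg _) (hA.trans (le_abs_self A)) n

/-- The expansion of `f(a + h R, κ/ϰ S + Ψ, S, t)` in powers of `h = t^{-1/(2q)}`. -/
theorem expansion_isBigO (hD : D.Regular) (hres : D.Resonant) {f : ℝ → ℝ → ℝ → ℝ → ℝ}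
    {fc : ℕ → ℝ → ℝ → ℝ → ℝ} (hfc : ∀ j, 1 ≤ j → PeriodicCoeff D.Rmax (fc j))
    (hf : ∀ M : ℕ, 1 ≤ M → ∃ C t₁ : ℝ, 0 < t₁ ∧ ∀ r φ S t, |r| ≤ D.Rmax → t₁ ≤ t →
      |f r φ S t - ∑ j ∈ Finset.Ico 1 M, t ^ (-(j : ℝ) / D.q) * fc j r φ S|
        ≤ C * t ^ (-(M : ℝ) / D.q)) (A : ℝ) (n : ℕ) :
    (fun x : ℝ × ℝ × ℝ × ℝ =>
      f (D.a + D.scale 1 x.2.2.2 * x.1) ((D.κ : ℝ) / D.ϰ * x.2.2.1 + x.2.1) x.2.2.1 x.2.2.2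
      - ∑ k ∈ Finset.Icc 1 n, D.scale 1 x.2.2.2 ^ k * ∑ j ∈ Finset.Icc 1 (k / 2),
        iteratedDeriv (k - 2 * j)
          (fun r => fc j r ((D.κ : ℝ) / D.ϰ * x.2.2.1 + x.2.1) x.2.2.1) D.a
          * x.1 ^ (k - 2 * j) / (Nat.factorial (k - 2 * j) : ℝ)) =O[stripFilter A]
      fun x => D.scale 1 x.2.2.2 ^ (n + 1) := by
  have hh := scale_isBigO_one hD A
  obtain ⟨C, t₁, ht₁, hC⟩ := hf (n + 1) (by omega)
  have h1 : (fun x : ℝ × ℝ × ℝ × ℝ =>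
      f (D.a + D.scale 1 x.2.2.2 * x.1) ((D.κ : ℝ) / D.ϰ * x.2.2.1 + x.2.1) x.2.2.1 x.2.2.2
      - ∑ j ∈ Finset.Ico 1 (n + 1), D.scale 1 x.2.2.2 ^ (2 * j) *
        fc j (D.a + D.scale 1 x.2.2.2 * x.1) ((D.κ : ℝ) / D.ϰ * x.2.2.1 + x.2.1) x.2.2.1)
      =O[stripFilter A] fun x => D.scale 1 x.2.2.2 ^ (n + 1) := by
    refine IsBigO.trans (IsBigO.of_bound (g := fun x => D.scale 1 x.2.2.2 ^ (2 * (n + 1))) C ?_)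
      (isBigO_pow_of_le hh (by omega))
    filter_upwards [eventually_amplitude hD A (sub_pos.2 hres.a_lt),
      (tendsto_time_stripFilter A).eventually_ge_atTop t₁] with x hx ht
    have ht0 : 0 < x.2.2.2 := ht₁.trans_le ht
    have hr : |D.a + D.scale 1 x.2.2.2 * x.1| ≤ D.Rmax := by
      refine (abs_add_le _ _).trans ?_
      linarith
    have := hC _ ((D.κ : ℝ) / D.ϰ * x.2.2.1 + x.2.1) x.2.2.1 _ hr ht
    simp_rw [rpow_neg_div_q hD _ ht0] at this
    rw [Real.norm_eq_abs, Real.norm_eq_abs, abs_of_pos (pow_pos (scale_one_pos D ht0) _)]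
    exact this
  -- The coefficient `f_j` comes with `h ^ (2j)`, hence is expanded only to order `n + 1 - 2j`. If
  -- `2j ≥ n + 1`, the truncated subtraction gives an empty Taylor sum and boundedness of `f_j` is
  -- enough.
  have h2 : (fun x : ℝ × ℝ × ℝ × ℝ => ∑ j ∈ Finset.Ico 1 (n + 1),
      D.scale 1 x.2.2.2 ^ (2 * j) *
        (fc j (D.a + D.scale 1 x.2.2.2 * x.1) ((D.κ : ℝ) / D.ϰ * x.2.2.1 + x.2.1) x.2.2.1
        - ∑ i ∈ Finset.range (n + 1 - 2 * j), D.scale 1 x.2.2.2 ^ i *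
          (iteratedDeriv i (fun r => fc j r ((D.κ : ℝ) / D.ϰ * x.2.2.1 + x.2.1) x.2.2.1) D.a
          * x.1 ^ i / (Nat.factorial i : ℝ)))) =O[stripFilter A]
      fun x => D.scale 1 x.2.2.2 ^ (n + 1) := by
    refine IsBigO.fun_sum fun j hj => ?_
    have h3 := (isBigO_refl (fun x : ℝ × ℝ × ℝ × ℝ => D.scale 1 x.2.2.2 ^ (2 * j))
      (stripFilter A)).mul
      (taylor_isBigO hD hres (hfc j (Finset.mem_Ico.1 hj).1) A (n + 1 - 2 * j))
    simp_rw [← pow_add] at h3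
    exact h3.trans (isBigO_pow_of_le hh (by omega))
  refine (h1.add h2).congr_left fun x => ?_
  -- Regrouping by the total order `k = i + 2j`.
  have h4 : ∑ k ∈ Finset.Icc 1 n, D.scale 1 x.2.2.2 ^ k * ∑ j ∈ Finset.Icc 1 (k / 2),
        iteratedDeriv (k - 2 * j)
          (fun r => fc j r ((D.κ : ℝ) / D.ϰ * x.2.2.1 + x.2.1) x.2.2.1) D.a
          * x.1 ^ (k - 2 * j) / (Nat.factorial (k - 2 * j) : ℝ) =
      ∑ j ∈ Finset.Ico 1 (n + 1), D.scale 1 x.2.2.2 ^ (2 * j) *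
        ∑ i ∈ Finset.range (n + 1 - 2 * j), D.scale 1 x.2.2.2 ^ i *
          (iteratedDeriv i (fun r => fc j r ((D.κ : ℝ) / D.ϰ * x.2.2.1 + x.2.1) x.2.2.1) D.a
          * x.1 ^ i / (Nat.factorial i : ℝ)) := by
    simp_rw [Finset.mul_sum]
    rw [Finset.sum_sigma', Finset.sum_sigma']
    refine Finset.sum_nbij' (fun s => ⟨s.2, s.1 - 2 * s.2⟩) (fun z => ⟨2 * z.1 + z.2, z.1⟩)
      ?_ ?_ ?_ ?_ ?_
    · rintro ⟨k, j⟩ hs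
      simp only [Finset.mem_sigma, Finset.mem_Icc, Finset.mem_Ico, Finset.mem_range] at hs ⊢
      omega
    · rintro ⟨j, i⟩ hz
      simp only [Finset.mem_sigma, Finset.mem_Icc, Finset.mem_Ico, Finset.mem_range] at hz ⊢
      omega
    · rintro ⟨k, j⟩ hs
      simp only [Finset.mem_sigma, Finset.mem_Icc] at hs
      simp only [Sigma.mk.injEq, heq_eq_eq, and_true]
      omega
    · rintro ⟨j, i⟩ _
      simp
    · rintro ⟨k, j⟩ hs
      simp only [Finset.mem_sigma, Finset.mem_Icc] at hs
      simp only
      rw [← mul_assoc, ← pow_add, Nat.add_sub_cancel' (by omega)]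
  rw [h4]
  simp_rw [mul_sub]
  rw [Finset.sum_sub_distrib]
  ring

end OscSystem

/-! ### Expansions of `S'`, `F` and `G`; the equations for `u_k`. -/

namespace OscSystem

variable {D : OscSystem}

theorem hasDerivAt_phase (D : OscSystem) {t : ℝ} (ht : 0 < t) :
    HasDerivAt D.phase (D.s 0 + (∑ j ∈ Finset.Ico 1 D.q,
      D.s j * ((1 - (j : ℝ) / D.q) * t ^ (1 - (j : ℝ) / D.q - 1))) + D.s D.q * t⁻¹) t := by
  have h1 : HasDerivAt (fun t => D.s 0 * t) (D.s 0) t := by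
    simpa using (hasDerivAt_id t).const_mul (D.s 0)
  have h2 : HasDerivAt (fun t : ℝ => ∑ j ∈ Finset.Ico 1 D.q, D.s j * t ^ (1 - (j : ℝ) / D.q)) _ t :=
    HasDerivAt.fun_sum fun j _ =>
      (Real.hasDerivAt_rpow_const (p := 1 - (j : ℝ) / D.q) (Or.inl ht.ne')).const_mul (D.s j)
  exact (h1.add h2).add ((Real.hasDerivAt_log ht.ne').const_mul (D.s D.q))

/-- No remainder appears: `S'` is a finite sum of powers. Odd orders vanish, and the logarithm
supplies order `2q`, where the factor `1 - k/(2q)` is zero and the Kronecker delta restores `1`. -/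
theorem deriv_phase_eq (hD : D.Regular) {t : ℝ} (ht : 0 < t) :
    deriv D.phase t = D.s 0 + ∑ k ∈ Finset.Icc 1 (2 * D.q), D.scale 1 t ^ k * D.phaseRate k := by
  have hq : (D.q : ℝ) ≠ 0 := by exact_mod_cast (Nat.one_le_iff_ne_zero.1 hD.q_pos)
  have h1 : ∑ k ∈ Finset.Icc 1 (2 * D.q), D.scale 1 t ^ k * D.phaseRate k =
      ∑ j ∈ Finset.Icc 1 D.q, D.scale 1 t ^ (2 * j) * D.phaseRate (2 * j) := by
    symm
    refine Finset.sum_of_injOn (fun j => 2 * j) (fun i _ j _ hij => by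
      simpa using hij) ?_ ?_ (fun _ _ => rfl)
    · intro j hj
      simp only [Finset.coe_Icc, Set.mem_Icc] at hj ⊢
      omega
    · intro k hk hk'
      have : ¬ Even k := by
        rintro ⟨j, rfl⟩
        refine hk' ⟨j, ?_, by simp only; omega⟩
        simp only [Finset.mem_Icc, Finset.coe_Icc, Set.mem_Icc] at hk ⊢
        omega
      simp [phaseRate, this]
  rw [h1, (D.hasDerivAt_phase ht).deriv, add_assoc]
  congr 1
  rw [← Finset.Ico_insert_right hD.q_pos, Finset.sum_insert (by simp), add_comm]
  congr 1
  · rw [inv_eq_scale_pow hD ht, phaseRate, if_pos ⟨even_two_mul _, le_rfl⟩]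
    have : 1 - ((2 * D.q : ℕ) : ℝ) / (2 * D.q) + 1 = 1 := by
      push_cast
      field_simp
      ring
    rw [if_pos rfl, this, Nat.mul_div_cancel_left _ two_pos]
    ring
  · refine Finset.sum_congr rfl fun j hj => ?_
    have hj' := Finset.mem_Ico.1 hj
    rw [phaseRate, if_pos ⟨even_two_mul _, by omega⟩, if_neg (by omega),
      Nat.mul_div_cancel_left _ two_pos, ← rpow_neg_div_q hD j ht]
    have h2 : 1 - (j : ℝ) / D.q - 1 = -(j : ℝ) / D.q := by ring
    have h3 : 1 - ((2 * j : ℕ) : ℝ) / (2 * D.q) = 1 - (j : ℝ) / D.q := by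
      push_cast
      field_simp
    rw [h2, h3]
    ring

theorem phase_expansion (hD : D.Regular) (A : ℝ) {n : ℕ} (hn : n ≤ 2 * D.q) :
    (fun x : ℝ × ℝ × ℝ × ℝ => deriv D.phase x.2.2.2 - D.s 0
      - ∑ k ∈ Finset.Icc 1 n, D.scale 1 x.2.2.2 ^ k * D.phaseRate k) =O[stripFilter A]
      fun x => D.scale 1 x.2.2.2 ^ (n + 1) := by
  have h1 : (fun x : ℝ × ℝ × ℝ × ℝ => ∑ k ∈ Finset.Ioc n (2 * D.q),
      D.scale 1 x.2.2.2 ^ k * D.phaseRate k) =O[stripFilter A]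
      fun x => D.scale 1 x.2.2.2 ^ (n + 1) :=
    IsBigO.fun_sum fun k hk => isBigO_pow_mul (scale_isBigO_one hD A)
      (Finset.mem_Ioc.1 hk).1 (isBigO_const_const _ one_ne_zero _)
  refine h1.congr' ?_ EventuallyEq.rfl
  filter_upwards [eventually_time_pos A] with x hx
  rw [deriv_phase_eq hD hx]
  have := Finset.sum_Ioc_consecutive (fun k => D.scale 1 x.2.2.2 ^ k * D.phaseRate k)
    (Nat.zero_le n) hn
  have hIcc : ∀ m, Finset.Icc 1 m = Finset.Ioc 0 m := fun m => by
    ext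
    simp [Nat.succ_le_iff]
  rw [hIcc, hIcc, ← this]
  ring

theorem F_expansion (hD : D.Regular) (hres : D.Resonant) (A : ℝ) {n : ℕ} (hn : n ≤ 2 * D.q) :
    (fun x : ℝ × ℝ × ℝ × ℝ => D.F x.1 x.2.1 x.2.2.1 x.2.2.2
      - ∑ k ∈ Finset.Icc 1 n, D.scale 1 x.2.2.2 ^ k * D.Fc k x.1 x.2.1 x.2.2.1)
      =O[stripFilter A] fun x => D.scale 1 x.2.2.2 ^ (n + 1) := by
  have hh := scale_isBigO_one hD A
  -- The prefactor `t^{1/(2q)} = h⁻¹` costs one order, so `f` is expanded to order `n + 1`.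
  have h1 := (isBigO_refl (fun x : ℝ × ℝ × ℝ × ℝ => (D.scale 1 x.2.2.2)⁻¹) (stripFilter A)).mul
    (expansion_isBigO hD hres (fun j hj => hD.periodicCoeff_fc hj) hD.f_asymptotic A (n + 1))
  have hR : (fun x : ℝ × ℝ × ℝ × ℝ => x.1 / (2 * D.q)) =O[stripFilter A] (fun _ => (1 : ℝ)) := by
    refine IsBigO.of_bound (A * |(2 * (D.q : ℝ))⁻¹|) ((eventually_strip A).mono fun x hx => ?_)
    rw [div_eq_mul_inv, norm_mul, norm_one, mul_one, Real.norm_eq_abs, Real.norm_eq_abs]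
    exact mul_le_mul_of_nonneg_right hx (abs_nonneg _)
  -- The term `R/(2qt)` has order exactly `2q`: it belongs to the sum if `n = 2q` and to the error
  -- otherwise.
  have h2 : (fun x : ℝ × ℝ × ℝ × ℝ => D.scale 1 x.2.2.2 ^ (2 * D.q) *
      (if n = 2 * D.q then 0 else x.1 / (2 * D.q)))
      =O[stripFilter A] fun x => D.scale 1 x.2.2.2 ^ (n + 1) := by
    by_cases h : n = 2 * D.q
    · simpa [h] using isBigO_zero _ _
    · simp only [if_neg h]
      exact isBigO_pow_mul hh (by omega) hR
  refine IsBigO.congr' (IsBigO.add (h1.trans_eventuallyEq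
    (g₂ := fun x => D.scale 1 x.2.2.2 ^ (n + 1)) ?_) h2) ?_ EventuallyEq.rfl
  · filter_upwards [eventually_time_pos A] with x hx
    rw [pow_succ' _ (n + 1), inv_mul_cancel_left₀ (D.scale_one_pos hx).ne']
  · filter_upwards [eventually_time_pos A] with x hx
    have hne := (D.scale_one_pos hx).ne'
    rw [F, D.rpow_inv_two_q hx, inv_eq_scale_pow hD hx]
    have h3 : ∑ k ∈ Finset.Icc 1 n, D.scale 1 x.2.2.2 ^ k * D.Fc k x.1 x.2.1 x.2.2.1 =
        (D.scale 1 x.2.2.2)⁻¹ * (∑ k ∈ Finset.Icc 1 (n + 1), D.scale 1 x.2.2.2 ^ k *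
          ∑ j ∈ Finset.Icc 1 (k / 2), iteratedDeriv (k - 2 * j)
          (fun r => D.fc j r ((D.κ : ℝ) / D.ϰ * x.2.2.1 + x.2.1) x.2.2.1) D.a
          * x.1 ^ (k - 2 * j) / (Nat.factorial (k - 2 * j) : ℝ)) +
        ∑ k ∈ Finset.Icc 1 n, D.scale 1 x.2.2.2 ^ k *
          (if k = 2 * D.q then x.1 / (2 * D.q) else 0) := by
      simp_rw [Fc, mul_add]
      rw [Finset.sum_add_distrib]
      congr 1
      rw [← Finset.Ico_add_one_right_eq_Icc 1 (n + 1),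
        Finset.sum_Ico_eq_sum_range, ← Finset.Ico_add_one_right_eq_Icc 1 n,
        Finset.sum_Ico_eq_sum_range]
      simp only [Nat.add_sub_cancel]
      -- The index shift caused by `h⁻¹` drops the term `k = 1`, which is zero because no `j ≥ 1`
      -- has `2j ≤ 1`.
      rw [Finset.sum_range_succ' _ n]
      simp only [Nat.reduceDiv, add_zero, zero_lt_one, Finset.Icc_eq_empty_of_lt, Finset.sum_empty,
        mul_zero]
      rw [Finset.mul_sum]
      refine Finset.sum_congr rfl fun k _ => ?_
      rw [show 1 + (k + 1) = 1 + k + 1 by ring, pow_succ' _ (1 + k), mul_assoc,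
        inv_mul_cancel_left₀ hne]
    have h4 : ∑ k ∈ Finset.Icc 1 n, D.scale 1 x.2.2.2 ^ k *
          (if k = 2 * D.q then x.1 / (2 * D.q) else 0) =
        D.scale 1 x.2.2.2 ^ (2 * D.q) * (if n = 2 * D.q then x.1 / (2 * D.q) else 0) := by
      simp only [mul_ite, mul_zero, Finset.sum_ite_eq', Finset.mem_Icc]
      have := hD.q_pos
      by_cases h : n = 2 * D.q
      · rw [if_pos h, if_pos (by omega)]
      · rw [if_neg h, if_neg (by omega)]
    rw [h3, h4]
    split_ifs <;> ring

/-- There is no term of order zero: the resonance condition cancels `ω(a)` against `κ/ϰ s₀`. The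
frequency is expanded as a coefficient independent of `φ` and `S`. -/
theorem G_expansion (hD : D.Regular) (hres : D.Resonant) (A : ℝ) {n : ℕ} (hn : n ≤ 2 * D.q) :
    (fun x : ℝ × ℝ × ℝ × ℝ => D.G x.1 x.2.1 x.2.2.1 x.2.2.2
      - ∑ k ∈ Finset.Icc 1 n, D.scale 1 x.2.2.2 ^ k * D.Gc k x.1 x.2.1 x.2.2.1)
      =O[stripFilter A] fun x => D.scale 1 x.2.2.2 ^ (n + 1) := by
  have hω : PeriodicCoeff D.Rmax (fun r _ _ => D.ω r) :=
    ⟨hD.ω_smooth.comp contDiffOn_fst fun x hx => hx.1, fun _ _ _ _ => ⟨rfl, rfl⟩⟩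
  have h1 := taylor_isBigO hD hres hω A (n + 1)
  have h2 := (phase_expansion hD A hn).const_mul_left (-((D.κ : ℝ) / D.ϰ))
  have h3 := expansion_isBigO hD hres (fun j hj => hD.periodicCoeff_gc hj) hD.g_asymptotic A n
  refine ((h1.add h2).add h3).congr_left fun x => ?_
  have h0 : (D.κ : ℝ) / D.ϰ * D.s 0 = D.ω D.a := by
    have : (D.ϰ : ℝ) ≠ 0 := by exact_mod_cast (Nat.one_le_iff_ne_zero.1 hres.ϰ_pos)
    field_simp
    exact hres.resonance
  have h4 : ∑ i ∈ Finset.range (n + 1), D.scale 1 x.2.2.2 ^ i *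
        (iteratedDeriv i D.ω D.a * x.1 ^ i / (Nat.factorial i : ℝ)) = D.ω D.a +
      ∑ i ∈ Finset.Icc 1 n, D.scale 1 x.2.2.2 ^ i *
        (iteratedDeriv i D.ω D.a * x.1 ^ i / (Nat.factorial i : ℝ)) := by
    rw [Finset.range_eq_Ico, Finset.sum_eq_sum_Ico_succ_bot (by omega)]
    simp only [Finset.Ico_add_one_right_eq_Icc]
    simp
  simp only [G, Gc, mul_add, mul_sub, Finset.sum_add_distrib, Finset.sum_sub_distrib, h4,
    Finset.mul_sum]
  have h5 : ∀ k, D.scale 1 x.2.2.2 ^ k * ((D.κ : ℝ) / D.ϰ * D.phaseRate k) =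
    (D.κ : ℝ) / D.ϰ * (D.scale 1 x.2.2.2 ^ k * D.phaseRate k) := fun k => by ring
  simp only [h5, neg_mul, Finset.sum_neg_distrib, ← Finset.mul_sum]
  linarith

theorem deriv_u (hD : D.Regular) (hres : D.Resonant) {k : ℕ} (hk : 1 ≤ k) (R Ψ S : ℝ) :
    D.s 0 * deriv (fun x => (D.coeff k).u R Ψ x) S =
      D.Lam k R Ψ - D.avgSourceF (D.coeffBelow k) k R Ψ S := by
  have hc : ∀ j ∈ Finset.Ico 1 k, AvgPoly D.ϰ j (D.coeffBelow k j) := fun j hj => by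
    have hj' := Finset.mem_Ico.1 hj
    rw [coeffBelow, if_pos hj'.2]
    exact avgPoly_coeff hD hres hj'.1
  have hcont := ((polyClass_avgSourceF hD hres _ hk hc).smooth₃ R Ψ).continuous
  have h1 : HasDerivAt (fun x => (D.coeff k).u R Ψ x)
      ((D.Lam k R Ψ - D.avgSourceF (D.coeffBelow k) k R Ψ S) / D.s 0) S := by
    rw [Lam, coeff_eq hk]
    simp only [avgStep, zeroMeanPrimitive]
    refine HasDerivAt.sub_const _ ?_
    exact (Continuous.integral_hasStrictDerivAt (f := fun x => (periodMean D.ϰ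
      (fun y => D.avgSourceF (D.coeffBelow k) k R Ψ y) -
        D.avgSourceF (D.coeffBelow k) k R Ψ x) / D.s 0) (by fun_prop) 0 S).hasDerivAt
  rw [h1.deriv, mul_div_cancel₀ _ hD.s_pos.ne']

end OscSystem

/-! ### Cancellation of the oscillating terms and the drift of `U_n`. -/

namespace OscSystem

variable {D : OscSystem}

theorem compCoeff_eq_zero {c : ℕ → AvgCoeff} {W : ℕ → ℝ → ℝ → ℝ} {k : ℕ}
    (hW : ∀ j ∈ Finset.Ico 1 k, ∀ R Ψ, W j R Ψ = 0) (R Ψ S : ℝ) :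
    compCoeff c W k R Ψ S = 0 := by
  unfold compCoeff
  have h : (fun h : ℝ => ∑ j ∈ Finset.Ico 1 k, h ^ j *
      W j (R + ∑ i ∈ Finset.Ico 1 k, h ^ i * (c i).u R Ψ S)
      (Ψ + ∑ i ∈ Finset.Ico 1 k, h ^ i * (c i).v R Ψ S)) = fun _ => 0 :=
    funext fun h => Finset.sum_eq_zero fun j hj => by rw [hW j hj, mul_zero]
  rw [h]
  simp

/-- The homological equation of order `k` when the averaged coefficients of lower order vanish. -/
theorem homological_eq (hD : D.Regular) (hres : D.Resonant) {k : ℕ} (hk : 1 ≤ k)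
    (hkq : k ≤ 2 * D.q) (hLam : ∀ i, 1 ≤ i → i < k → ∀ ρ ψ, D.Lam i ρ ψ = 0) (R Ψ S : ℝ) :
    D.Fc k R Ψ S + D.s 0 * deriv (fun x => (D.coeff k).u R Ψ x) S
      + ∑ j ∈ Finset.Ico 1 k, D.Fc j R Ψ S * deriv (fun x => (D.coeff (k - j)).u x Ψ S) R
      + ∑ j ∈ Finset.Ico 1 k, D.Gc j R Ψ S * deriv (fun x => (D.coeff (k - j)).u R x S) Ψ
      + ∑ j ∈ Finset.Ico 1 k, D.phaseRate j * deriv (fun x => (D.coeff (k - j)).u R Ψ x) S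
      = D.Lam k R Ψ := by
  have hdrift : D.driftCoeff (fun j => (D.coeffBelow k j).u) k R Ψ S =
      ∑ j ∈ Finset.Ico 1 k, D.Fc j R Ψ S * deriv (fun x => (D.coeff (k - j)).u x Ψ S) R
      + ∑ j ∈ Finset.Ico 1 k, D.Gc j R Ψ S * deriv (fun x => (D.coeff (k - j)).u R x S) Ψ
      + ∑ j ∈ Finset.Ico 1 k, D.phaseRate j * deriv (fun x => (D.coeff (k - j)).u R Ψ x) S := by
    rw [← Finset.sum_add_distrib, ← Finset.sum_add_distrib]
    refine Finset.sum_congr rfl fun j hj => ?_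
    have hj' := Finset.mem_Ico.1 hj
    have h1 : D.coeffBelow k (k - j) = D.coeff (k - j) := if_pos (by omega)
    simp only [h1]
    -- The term with `δ_{j,2q}` is absent since `j < k ≤ 2q`.
    rw [if_neg (by omega)]
    ring
  have hcomp : compCoeff (D.coeffBelow k) (fun j => (D.coeffBelow k j).Lam) k R Ψ S = 0 := by
    refine compCoeff_eq_zero (fun j hj R Ψ => ?_) R Ψ S
    have hj' := Finset.mem_Ico.1 hj
    rw [coeffBelow, if_pos hj'.2]
    exact hLam j hj'.1 hj'.2 R Ψ
  have h := deriv_u hD hres hk R Ψ S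
  rw [avgSourceF, hcomp, hdrift] at h
  linarith

theorem hasDerivAt_scale (D : OscSystem) (k : ℕ) {t : ℝ} (ht : 0 < t) :
    HasDerivAt (D.scale k) (-(k : ℝ) / (2 * D.q) * (t⁻¹ * D.scale k t)) t := by
  have h := Real.hasDerivAt_rpow_const (x := t) (p := -(k : ℝ) / (2 * D.q)) (Or.inl ht.ne')
  rw [Real.rpow_sub_one ht.ne'] at h
  rw [div_eq_inv_mul (t ^ (-(k : ℝ) / (2 * D.q))) t] at h
  exact h

/-- The derivative of `U_n` along the flow in terms of the derivatives of `u_k`. -/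
theorem alongFlow_U (hD : D.Regular) (hres : D.Resonant) (n : ℕ) (R Ψ S : ℝ) {t : ℝ}
    (ht : 0 < t) :
    D.alongFlow (D.U n) R Ψ S t =
      t⁻¹ * (∑ k ∈ Finset.Icc 1 n, D.scale 1 t ^ k * (-(k : ℝ) / (2 * D.q) * (D.coeff k).u R Ψ S))
      + deriv D.phase t * ∑ k ∈ Finset.Icc 1 n, D.scale 1 t ^ k *
        deriv (fun x => (D.coeff k).u R Ψ x) S
      + D.F R Ψ S t * (1 + ∑ k ∈ Finset.Icc 1 n, D.scale 1 t ^ k *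
        deriv (fun x => (D.coeff k).u x Ψ S) R)
      + D.G R Ψ S t * ∑ k ∈ Finset.Icc 1 n, D.scale 1 t ^ k *
        deriv (fun x => (D.coeff k).u R x S) Ψ := by
  have hk : ∀ k ∈ Finset.Icc 1 n, PolyClass D.ϰ k (D.coeff k).u := fun k hk =>
    (avgPoly_coeff hD hres (Finset.mem_Icc.1 hk).1).u
  have h1 : HasDerivAt (fun x => D.U n R Ψ S x) (∑ k ∈ Finset.Icc 1 n,
      -(k : ℝ) / (2 * D.q) * (t⁻¹ * D.scale k t) * (D.coeff k).u R Ψ S) t :=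
    (HasDerivAt.fun_sum fun k _ => (D.hasDerivAt_scale k ht).mul_const _).const_add R
  have h2 : HasDerivAt (fun x => D.U n R Ψ x t) (∑ k ∈ Finset.Icc 1 n,
      D.scale k t * deriv (fun x => (D.coeff k).u R Ψ x) S) S :=
    (HasDerivAt.fun_sum fun k hk' => (((hk k hk').smooth₃ R Ψ).differentiable (by simp)
      S).hasDerivAt.const_mul _).const_add R
  have h3 : HasDerivAt (fun x => D.U n x Ψ S t) (1 + ∑ k ∈ Finset.Icc 1 n,
      D.scale k t * deriv (fun x => (D.coeff k).u x Ψ S) R) R :=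
    (hasDerivAt_id R).add (HasDerivAt.fun_sum fun k hk' =>
      (((hk k hk').smooth₁ Ψ S).differentiable (by simp) R).hasDerivAt.const_mul _)
  have h4 : HasDerivAt (fun x => D.U n R x S t) (∑ k ∈ Finset.Icc 1 n,
      D.scale k t * deriv (fun x => (D.coeff k).u R x S) Ψ) Ψ :=
    (HasDerivAt.fun_sum fun k hk' => (((hk k hk').smooth₂ R S).differentiable (by simp)
      Ψ).hasDerivAt.const_mul _).const_add R
  unfold alongFlow
  rw [h1.deriv, h2.deriv, h3.deriv, h4.deriv]
  have hsc := fun k => D.scale_eq_pow k ht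
  generalize D.scale 1 t = y at hsc ⊢
  simp only [hsc]
  refine congrArg₂ _ (congrArg₂ _ (congrArg₂ _ ?_ rfl) rfl) rfl
  rw [Finset.mul_sum]
  exact Finset.sum_congr rfl fun k _ => by ring

/-- If the averaged coefficients of order below `n ≤ 2q` vanish, then `U_n` moves with the
velocity `t^{-n/(2q)} Λ_n + O(t^{-(n+1)/(2q)})`. -/
theorem alongFlow_U_isBigO (hD : D.Regular) (hres : D.Resonant) (A : ℝ) {n : ℕ} (hn1 : 1 ≤ n)
    (hn : n ≤ 2 * D.q) (hLam : ∀ i, 1 ≤ i → i < n → ∀ ρ ψ, D.Lam i ρ ψ = 0) :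
    (fun x : ℝ × ℝ × ℝ × ℝ => D.alongFlow (D.U n) x.1 x.2.1 x.2.2.1 x.2.2.2
      - D.scale 1 x.2.2.2 ^ n * D.Lam n x.1 x.2.1) =O[stripFilter A]
      fun x => D.scale 1 x.2.2.2 ^ (n + 1) := by
  have hh := scale_isBigO_one hD A
  have hϰ := hres.ϰ_pos
  have hu : ∀ k ∈ Finset.Icc 1 n, PolyClass D.ϰ k (D.coeff k).u := fun k hk =>
    (avgPoly_coeff hD hres (Finset.mem_Icc.1 hk).1).u
  have eF := F_expansion hD hres A hn
  have eG := G_expansion hD hres A hn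
  have eS := phase_expansion hD A hn
  have cF := isBigO_cauchy hh n
    (fun k hk => (polyClass_Fc hD hres (Finset.mem_Icc.1 hk).1).isBigO_one hϰ A)
    (fun k hk => (hu k hk).deriv₁.isBigO_one hϰ A) eF (fun _ => rfl)
  have cG := isBigO_cauchy hh n (fun k _ => (polyClass_Gc hD hres k).isBigO_one hϰ A)
    (fun k hk => (hu k hk).deriv₂.isBigO_one hϰ A) eG (fun _ => rfl)
  have cS := isBigO_cauchy hh n (a := fun k _ => D.phaseRate k)
    (fun k _ => isBigO_const_const _ one_ne_zero _)
    (fun k hk => (hu k hk).deriv₃.isBigO_one hϰ A) eS (fun _ => rfl)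
  -- The explicit time derivative contributes orders `2q + k` with `k ≥ 1`, all beyond `n` because
  -- `n ≤ 2q`.
  have cT : (fun x : ℝ × ℝ × ℝ × ℝ => ∑ k ∈ Finset.Icc 1 n, D.scale 1 x.2.2.2 ^ (2 * D.q + k) *
      (-(k : ℝ) / (2 * D.q) * (D.coeff k).u x.1 x.2.1 x.2.2.1)) =O[stripFilter A]
      fun x => D.scale 1 x.2.2.2 ^ (n + 1) :=
    IsBigO.fun_sum fun k hk => isBigO_pow_mul hh (by have := (Finset.mem_Icc.1 hk).1; omega)
      (((hu k hk).isBigO_one hϰ A).const_mul_left _)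
  refine ((((eF.add cF).add cG).add cS).add cT).congr' ?_ EventuallyEq.rfl
  filter_upwards [eventually_time_pos A] with x hx
  obtain ⟨R, Ψ, S, t⟩ := x
  simp only at hx ⊢
  rw [alongFlow_U hD hres n R Ψ S hx]
  -- The coefficient of `h ^ m` is the left side of the homological equation, hence equals `Λ_m`;
  -- only `m = n` survives.
  have hsum : ∑ m ∈ Finset.Icc 1 n, D.scale 1 t ^ m * (D.Fc m R Ψ S
      + D.s 0 * deriv (fun x => (D.coeff m).u R Ψ x) S
      + ∑ j ∈ Finset.Ico 1 m, D.Fc j R Ψ S * deriv (fun x => (D.coeff (m - j)).u x Ψ S) R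
      + ∑ j ∈ Finset.Ico 1 m, D.Gc j R Ψ S * deriv (fun x => (D.coeff (m - j)).u R x S) Ψ
      + ∑ j ∈ Finset.Ico 1 m, D.phaseRate j * deriv (fun x => (D.coeff (m - j)).u R Ψ x) S)
      = D.scale 1 t ^ n * D.Lam n R Ψ := by
    rw [Finset.sum_eq_single_of_mem n (Finset.mem_Icc.2 ⟨hn1, le_rfl⟩)]
    · rw [homological_eq hD hres hn1 hn hLam]
    · intro m hm hmn
      have hm' := Finset.mem_Icc.1 hm
      rw [homological_eq hD hres hm'.1 (by omega) (fun i h1 h2 => hLam i h1 (by omega)),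
        hLam m hm'.1 (by omega), mul_zero]
  have hT : t⁻¹ * (∑ k ∈ Finset.Icc 1 n, D.scale 1 t ^ k *
      (-(k : ℝ) / (2 * D.q) * (D.coeff k).u R Ψ S)) =
      ∑ k ∈ Finset.Icc 1 n, D.scale 1 t ^ (2 * D.q + k) *
      (-(k : ℝ) / (2 * D.q) * (D.coeff k).u R Ψ S) := by
    rw [inv_eq_scale_pow hD hx, Finset.mul_sum]
    refine Finset.sum_congr rfl fun k _ => ?_
    rw [pow_add]
    ring
  have hs0 : ∑ k ∈ Finset.Icc 1 n, D.scale 1 t ^ k *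
      (D.s 0 * deriv (fun x => (D.coeff k).u R Ψ x) S) = D.s 0 * ∑ k ∈ Finset.Icc 1 n,
      D.scale 1 t ^ k * deriv (fun x => (D.coeff k).u R Ψ x) S := by
    rw [Finset.mul_sum]
    exact Finset.sum_congr rfl fun k _ => by ring
  rw [hT, ← hsum]
  simp only [mul_add, Finset.sum_add_distrib, hs0]
  ring

end OscSystem

/-! ### Trajectories with bounded `R` cannot be global. -/

/-- Total derivative of a function of four variables in terms of partial derivatives. -/
theorem hasDerivWithinAt_comp_four {W : ℝ → ℝ → ℝ → ℝ → ℝ} {R Ψ S : ℝ → ℝ} {R' Ψ' S' t : ℝ}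
    {s : Set ℝ}
    (hW : DifferentiableAt ℝ (fun x : ℝ × ℝ × ℝ × ℝ => W x.1 x.2.1 x.2.2.1 x.2.2.2)
      (R t, Ψ t, S t, t))
    (hR : HasDerivWithinAt R R' s t) (hΨ : HasDerivWithinAt Ψ Ψ' s t)
    (hS : HasDerivWithinAt S S' s t) :
    HasDerivWithinAt (fun τ => W (R τ) (Ψ τ) (S τ) τ)
      (deriv (fun x => W (R t) (Ψ t) (S t) x) t + S' * deriv (fun x => W (R t) (Ψ t) x t) (S t)
        + R' * deriv (fun x => W x (Ψ t) (S t) t) (R t)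
        + Ψ' * deriv (fun x => W (R t) x (S t) t) (Ψ t)) s t := by
  set w := fun x : ℝ × ℝ × ℝ × ℝ => W x.1 x.2.1 x.2.2.1 x.2.2.2
  set x₀ : ℝ × ℝ × ℝ × ℝ := (R t, Ψ t, S t, t)
  have hw := hW.hasFDerivAt
  have h1 : HasDerivAt (fun x => W x (Ψ t) (S t) t) (fderiv ℝ w x₀ (1, 0, 0, 0)) (R t) :=
    HasFDerivAt.comp_hasDerivAt (f := fun x : ℝ => (x, Ψ t, S t, t)) (R t) hw
      ((hasDerivAt_id _).prodMk (hasDerivAt_const _ _))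
  have h2 : HasDerivAt (fun x => W (R t) x (S t) t) (fderiv ℝ w x₀ (0, 1, 0, 0)) (Ψ t) :=
    HasFDerivAt.comp_hasDerivAt (f := fun x : ℝ => (R t, x, S t, t)) (Ψ t) hw
      ((hasDerivAt_const _ _).prodMk ((hasDerivAt_id _).prodMk (hasDerivAt_const _ _)))
  have h3 : HasDerivAt (fun x => W (R t) (Ψ t) x t) (fderiv ℝ w x₀ (0, 0, 1, 0)) (S t) :=
    HasFDerivAt.comp_hasDerivAt (f := fun x : ℝ => (R t, Ψ t, x, t)) (S t) hw
      ((hasDerivAt_const _ _).prodMk ((hasDerivAt_const _ _).prodMk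
        ((hasDerivAt_id _).prodMk (hasDerivAt_const _ _))))
  have h4 : HasDerivAt (fun x => W (R t) (Ψ t) (S t) x) (fderiv ℝ w x₀ (0, 0, 0, 1)) t :=
    HasFDerivAt.comp_hasDerivAt (f := fun x : ℝ => (R t, Ψ t, S t, x)) t hw
      ((hasDerivAt_const _ _).prodMk ((hasDerivAt_const _ _).prodMk
        ((hasDerivAt_const _ _).prodMk (hasDerivAt_id _))))
  have h := HasFDerivAt.comp_hasDerivWithinAt (f := fun τ => (R τ, Ψ τ, S τ, τ)) t hw
    (hR.prodMk (hΨ.prodMk (hS.prodMk (hasDerivWithinAt_id t s))))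
  rw [h1.deriv, h2.deriv, h3.deriv, h4.deriv]
  refine HasDerivWithinAt.congr_deriv h ?_
  have hdec : ((R', Ψ', S', 1) : ℝ × ℝ × ℝ × ℝ) = (0, 0, 0, 1) + S' • (0, 0, 1, 0)
      + R' • (1, 0, 0, 0) + Ψ' • (0, 1, 0, 0) := by simp
  rw [hdec, map_add, map_add, map_add, map_smul, map_smul, map_smul]
  simp only [smul_eq_mul]

namespace OscSystem

variable {D : OscSystem}

theorem contDiffAt_scale (D : OscSystem) (k : ℕ) {t : ℝ} (ht : 0 < t) :
    ContDiffAt ℝ ∞ (D.scale k) t :=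
  Real.contDiffAt_rpow_const_of_ne ht.ne'

theorem contDiffAt_phase (D : OscSystem) {t : ℝ} (ht : 0 < t) : ContDiffAt ℝ ∞ D.phase t := by
  refine ContDiffAt.add (ContDiffAt.add (contDiffAt_const.mul contDiffAt_id)
    (ContDiffAt.sum fun j _ => contDiffAt_const.mul ?_)) (contDiffAt_const.mul ?_)
  · exact Real.contDiffAt_rpow_const_of_ne ht.ne'
  · exact Real.contDiffAt_log.2 ht.ne'

theorem contDiffAt_scale_sum (D : OscSystem) {w : ℕ → ℝ → ℝ → ℝ → ℝ} {N : ℕ}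
    (hw : ∀ k ∈ Finset.Icc 1 N, PolyClass D.ϰ k (w k)) {x : ℝ × ℝ × ℝ × ℝ}
    (hx : 0 < x.2.2.2) :
    ContDiffAt ℝ ∞ (fun x : ℝ × ℝ × ℝ × ℝ =>
      ∑ k ∈ Finset.Icc 1 N, D.scale k x.2.2.2 * w k x.1 x.2.1 x.2.2.1) x := by
  refine ContDiffAt.sum fun k hk => ContDiffAt.mul ?_ ?_
  · exact (D.contDiffAt_scale k hx).comp x (f := fun x : ℝ × ℝ × ℝ × ℝ => x.2.2.2) (by fun_prop)
  · exact ((hw k hk).smooth.comp (f := fun x : ℝ × ℝ × ℝ × ℝ => (x.1, x.2.1, x.2.2.1))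
      (by fun_prop)).contDiffAt

theorem contDiffAt_U (hD : D.Regular) (hres : D.Resonant) (N : ℕ) {x : ℝ × ℝ × ℝ × ℝ}
    (hx : 0 < x.2.2.2) :
    ContDiffAt ℝ ∞ (fun x : ℝ × ℝ × ℝ × ℝ => D.U N x.1 x.2.1 x.2.2.1 x.2.2.2) x :=
  contDiffAt_fst.add (D.contDiffAt_scale_sum
    (fun _ hk => (avgPoly_coeff hD hres (Finset.mem_Icc.1 hk).1).u) hx)

theorem contDiffAt_V (hD : D.Regular) (hres : D.Resonant) (N : ℕ) {x : ℝ × ℝ × ℝ × ℝ}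
    (hx : 0 < x.2.2.2) :
    ContDiffAt ℝ ∞ (fun x : ℝ × ℝ × ℝ × ℝ => D.V N x.1 x.2.1 x.2.2.1 x.2.2.2) x :=
  (contDiffAt_fst.comp x contDiffAt_snd).add (D.contDiffAt_scale_sum
    (fun _ hk => (avgPoly_coeff hD hres (Finset.mem_Icc.1 hk).1).v) hx)

/-- `(R, Ψ)` satisfies the system for the amplitude residual and the phase shift at time `t`,
with derivatives within `s`. -/
structure FlowAt (D : OscSystem) (R Ψ : ℝ → ℝ) (s : Set ℝ) (t : ℝ) : Prop where
  left : HasDerivWithinAt R (D.F (R t) (Ψ t) (D.phase t) t) s t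
  right : HasDerivWithinAt Ψ (D.G (R t) (Ψ t) (D.phase t) t) s t

theorem FlowAt.hasDerivWithinAt {R Ψ : ℝ → ℝ} {s : Set ℝ} {t : ℝ} (h : D.FlowAt R Ψ s t)
    (ht : 0 < t) {W : ℝ → ℝ → ℝ → ℝ → ℝ}
    (hW : ContDiffAt ℝ ∞ (fun x : ℝ × ℝ × ℝ × ℝ => W x.1 x.2.1 x.2.2.1 x.2.2.2)
      (R t, Ψ t, D.phase t, t)) :
    HasDerivWithinAt (fun τ => W (R τ) (Ψ τ) (D.phase τ) τ)
      (D.alongFlow W (R t) (Ψ t) (D.phase t) t) s t :=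
  hasDerivWithinAt_comp_four (hW.differentiableAt (by simp)) h.left h.right
    (D.hasDerivAt_phase ht).differentiableAt.hasDerivAt.hasDerivWithinAt

/-- The plane is connected, so a nowhere zero continuous function has one sign `σ` there.
Periodicity in `Ψ` reduces the infinite strip to the compact rectangle `[-A, A] × [0, 2π]`, where
the minimum is attained. -/
theorem exists_sign_lower_bound (hD : D.Regular) (hres : D.Resonant) {n : ℕ} (hn1 : 1 ≤ n)
    (hne : ∀ ρ ψ, D.Lam n ρ ψ ≠ 0) (A : ℝ) :
    ∃ σ c : ℝ, |σ| = 1 ∧ 0 < c ∧ ∀ R Ψ, |R| ≤ A → c ≤ σ * D.Lam n R Ψ := by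
  have hP := (avgPoly_coeff hD hres hn1).Lam
  have hcont : Continuous (fun p : ℝ × ℝ => D.Lam n p.1 p.2) :=
    hP.smooth.continuous.comp (f := fun p : ℝ × ℝ => (p.1, p.2, (0 : ℝ))) (by fun_prop)
  have hsign : ∃ σ : ℝ, |σ| = 1 ∧ ∀ p : ℝ × ℝ, 0 < σ * D.Lam n p.1 p.2 := by
    by_contra! hcon
    obtain ⟨p, hp⟩ := hcon 1 (by simp)
    obtain ⟨z, hz⟩ := hcon (-1) (by simp)
    obtain ⟨y, hy⟩ := mem_range_of_exists_le_of_exists_ge hcont (c := 0)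
      ⟨p, by linarith⟩ ⟨z, by linarith⟩
    exact hne _ _ hy
  obtain ⟨σ, hσ, hpos⟩ := hsign
  rcases lt_or_ge A 0 with hA | hA
  · exact ⟨σ, 1, hσ, one_pos, fun R Ψ hR => absurd ((abs_nonneg R).trans hR) (not_le.2 hA)⟩
  obtain ⟨z, hz, hmin⟩ := ((isCompact_Icc (a := -A) (b := A)).prod
    (isCompact_Icc (a := (0 : ℝ)) (b := 2 * Real.pi))).exists_isMinOn
    ⟨(0, 0), ⟨⟨by linarith, hA⟩, ⟨le_rfl, Real.two_pi_pos.le⟩⟩⟩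
    (hcont.const_smul σ).continuousOn
  refine ⟨σ, σ * D.Lam n z.1 z.2, hσ, hpos z, fun R Ψ hR => ?_⟩
  obtain ⟨y, hy, hy'⟩ := Function.Periodic.exists_mem_Ico₀
    (show Function.Periodic (fun x => D.Lam n R x) (2 * Real.pi) from
      fun x => hP.periodic_angle R x 0) Real.two_pi_pos Ψ
  rw [show D.Lam n R Ψ = D.Lam n R y from hy']
  exact hmin (show (R, y) ∈ _ from ⟨abs_le.1 hR, hy.1, hy.2.le⟩)

theorem U_isBigO_one (hD : D.Regular) (hres : D.Resonant) (A : ℝ) (n : ℕ) :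
    (fun x : ℝ × ℝ × ℝ × ℝ => D.U n x.1 x.2.1 x.2.2.1 x.2.2.2) =O[stripFilter A]
      (fun _ => (1 : ℝ)) := by
  have h0 : (fun x : ℝ × ℝ × ℝ × ℝ => x.1) =O[stripFilter A] (fun _ => (1 : ℝ)) :=
    (PolyClass.id (d := 1) D.ϰ le_rfl).isBigO_one hres.ϰ_pos A
  have h1 : (fun x : ℝ × ℝ × ℝ × ℝ => ∑ k ∈ Finset.Icc 1 n, D.scale 1 x.2.2.2 ^ k *
      (D.coeff k).u x.1 x.2.1 x.2.2.1) =O[stripFilter A] (fun _ => (1 : ℝ)) :=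
    IsBigO.fun_sum fun k hk => by
      simpa using isBigO_pow_mul (scale_isBigO_one hD A) (Nat.zero_le k)
        ((avgPoly_coeff hD hres (Finset.mem_Icc.1 hk).1).u.isBigO_one hres.ϰ_pos A)
  refine (h0.add h1).congr' ?_ EventuallyEq.rfl
  filter_upwards [eventually_time_pos A] with x hx
  unfold U
  congr 1
  exact Finset.sum_congr rfl fun k _ => by rw [← D.scale_eq_pow k hx]

/-- No trajectory with bounded amplitude residual exists for all large times. -/
theorem not_bounded_flow (hD : D.Regular) (hres : D.Resonant) {n : ℕ} (hn1 : 1 ≤ n)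
    (hn : n ≤ 2 * D.q) (hLam : ∀ i, 1 ≤ i → i < n → ∀ ρ ψ, D.Lam i ρ ψ = 0)
    (hne : ∀ ρ ψ, D.Lam n ρ ψ ≠ 0) {R Ψ : ℝ → ℝ} {A t₀ : ℝ} (hA : ∀ t, t₀ ≤ t → |R t| ≤ A)
    (hflow : ∀ t, t₀ ≤ t → D.FlowAt R Ψ (Set.Ici t₀) t) : False := by
  obtain ⟨σ, c, hσ, hc, hbound⟩ := exists_sign_lower_bound hD hres hn1 hne A
  obtain ⟨C, hC⟩ := (alongFlow_U_isBigO hD hres A hn1 hn hLam).bound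
  obtain ⟨K, hK⟩ := (U_isBigO_one hD hres A n).bound
  -- The error `C h^{n+1}` is at most half of the guaranteed drift `c h^n` once `C h < c/2`.
  have hsmall : ∀ᶠ x : ℝ × ℝ × ℝ × ℝ in stripFilter A, C * D.scale 1 x.2.2.2 < c / 2 := by
    have := (tendsto_scale_stripFilter hD A).const_mul C
    rw [mul_zero] at this
    exact this.eventually_lt_const (by positivity)
  have hrate : ∀ᶠ x : ℝ × ℝ × ℝ × ℝ in stripFilter A, 0 < x.2.2.2 ∧
      c / 2 * x.2.2.2⁻¹ ≤ σ * D.alongFlow (D.U n) x.1 x.2.1 x.2.2.1 x.2.2.2 ∧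
      |σ * D.U n x.1 x.2.1 x.2.2.1 x.2.2.2| ≤ K := by
    filter_upwards [hC, hK, hsmall, eventually_time_pos A, eventually_strip A,
      (tendsto_scale_stripFilter hD A).eventually_lt_const one_pos] with x h1 h2 h3 h4 h5 h6
    have hs := D.scale_one_pos h4
    refine ⟨h4, ?_, by simpa [abs_mul, hσ] using h2⟩
    rw [Real.norm_eq_abs, Real.norm_eq_abs, abs_of_pos (pow_pos hs _), pow_succ'] at h1
    have h7 := hbound x.1 x.2.1 h5
    rw [inv_eq_scale_pow hD h4]
    -- The decisive use of `n ≤ 2q`: the drift is no slower than `h^{2q} = 1/t`, whose integral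
    -- diverges.
    have h8 : D.scale 1 x.2.2.2 ^ (2 * D.q) ≤ D.scale 1 x.2.2.2 ^ n :=
      pow_le_pow_of_le_one hs.le h6.le hn
    have hpn : 0 < D.scale 1 x.2.2.2 ^ n := pow_pos hs n
    have h9 : |σ * (D.alongFlow (D.U n) x.1 x.2.1 x.2.2.1 x.2.2.2
        - D.scale 1 x.2.2.2 ^ n * D.Lam n x.1 x.2.1)| ≤ c / 2 * D.scale 1 x.2.2.2 ^ n := by
      rw [abs_mul, hσ, one_mul]
      refine h1.trans ?_
      rw [← mul_assoc]
      exact mul_le_mul_of_nonneg_right h3.le hpn.le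
    have h10 := (abs_le.1 h9).1
    have h11 := mul_le_mul_of_nonneg_right h7 hpn.le
    have h12 := mul_le_mul_of_nonneg_left h8 (by positivity : 0 ≤ c / 2)
    nlinarith
  obtain ⟨t₁, ht₁⟩ := eventually_stripFilter.1 hrate
  set τ := max t₀ t₁
  have hall : ∀ t, τ ≤ t → 0 < t ∧
      c / 2 * t⁻¹ ≤ σ * D.alongFlow (D.U n) (R t) (Ψ t) (D.phase t) t ∧
      |σ * D.U n (R t) (Ψ t) (D.phase t) t| ≤ K := fun t ht =>
    ht₁ (R t) (Ψ t) (D.phase t) t (hA t ((le_max_left _ _).trans ht)) ((le_max_right _ _).trans ht)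
  have hder : ∀ t, τ ≤ t → HasDerivWithinAt
      (fun t => σ * D.U n (R t) (Ψ t) (D.phase t) t - c / 2 * Real.log t)
      (σ * D.alongFlow (D.U n) (R t) (Ψ t) (D.phase t) t - c / 2 * t⁻¹) (Set.Ici τ) t := by
    intro t ht
    have ht0 := (hall t ht).1
    have h1 := ((hflow t ((le_max_left _ _).trans ht)).hasDerivWithinAt ht0
      (contDiffAt_U hD hres n ht0)).mono (Set.Ici_subset_Ici.2 (le_max_left t₀ t₁))
    exact (h1.const_mul σ).sub
      ((Real.hasDerivAt_log ht0.ne').const_mul (c / 2)).hasDerivWithinAt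
  have hmono : MonotoneOn
      (fun t => σ * D.U n (R t) (Ψ t) (D.phase t) t - c / 2 * Real.log t) (Set.Ici τ) := by
    refine monotoneOn_of_hasDerivWithinAt_nonneg (convex_Ici τ)
      (fun t ht => (hder t ht).continuousWithinAt)
      (fun t ht => (hder t (interior_subset ht)).mono interior_subset)
      (fun t ht => sub_nonneg.2 (hall t (interior_subset ht)).2.1)
  -- Monotonicity gives `c/2 (log t - log τ) ≤ 2K`, as `σ U_n` lies between `-K` and `K`; the chosen
  -- `t` violates this.
  obtain ⟨t, ht, htτ⟩ := ((Real.tendsto_log_atTop.eventually_gt_atTop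
    (Real.log τ + 4 * K / c)).and (eventually_ge_atTop τ)).exists
  have h1 := hmono (Set.mem_Ici.2 le_rfl) (Set.mem_Ici.2 htτ) htτ
  have h2 := (abs_le.1 (hall t htτ).2.2).2
  have h3 := (abs_le.1 (hall τ le_rfl).2.2).1
  simp only at h1
  have h4 : c / 2 * Real.log t > c / 2 * Real.log τ + 2 * K := by
    have := mul_lt_mul_of_pos_left ht (by positivity : 0 < c / 2)
    have h5 : c / 2 * (4 * K / c) = 2 * K := by
      field_simp
      ring
    linarith
  linarith

/-- A solution of the original system in the variables `(R, Ψ)`. -/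
theorem IsSolution.flowAt {T : ℝ} {r φ : ℝ → ℝ} (h : D.IsSolution T r φ) (hT : 0 < T) {t : ℝ}
    (ht : T ≤ t) :
    D.FlowAt (fun t => t ^ ((1 : ℝ) / (2 * D.q)) * (r t - D.a))
      (fun t => φ t - (D.κ : ℝ) / D.ϰ * D.phase t) (Set.Ici T) t := by
  have ht0 := hT.trans_le ht
  obtain ⟨_, hr, hφ⟩ := h t ht
  have h1 : D.a + D.scale 1 t * (t ^ ((1 : ℝ) / (2 * D.q)) * (r t - D.a)) = r t := by
    rw [D.rpow_inv_two_q ht0, mul_inv_cancel_left₀ (D.scale_one_pos ht0).ne']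
    ring
  have h2 : (D.κ : ℝ) / D.ϰ * D.phase t + (φ t - (D.κ : ℝ) / D.ϰ * D.phase t) = φ t := by ring
  constructor
  · have h3 := Real.hasDerivAt_rpow_const (x := t) (p := (1 : ℝ) / (2 * D.q)) (Or.inl ht0.ne')
    have h4 := h3.hasDerivWithinAt.mul (hr.sub_const D.a)
    refine h4.congr_deriv ?_
    simp only [F, h1, h2]
    rw [Real.rpow_sub_one ht0.ne']
    ring
  · have h3 := (D.hasDerivAt_phase ht0).differentiableAt.hasDerivAt.const_mul
      ((D.κ : ℝ) / D.ϰ)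
    refine (hφ.sub h3.hasDerivWithinAt).congr_deriv ?_
    simp only [G, h1, h2]
    ring

/-- No solution of the original system satisfies `r(t) = a + O(t^{-1/(2q)})`. -/
theorem no_resonant_solution (hD : D.Regular) (hres : D.Resonant) {n : ℕ} (hn1 : 1 ≤ n)
    (hn : n ≤ 2 * D.q) (hLam : ∀ i, 1 ≤ i → i < n → ∀ ρ ψ, D.Lam i ρ ψ = 0)
    (hne : ∀ ρ ψ, D.Lam n ρ ψ ≠ 0) {T : ℝ} {r φ : ℝ → ℝ} (hT : 0 < T)
    (h : D.IsSolution T r φ) (C : ℝ) :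
    ∃ t, T ≤ t ∧ C < t ^ ((1 : ℝ) / (2 * D.q)) * |r t - D.a| := by
  by_contra! hcon
  refine not_bounded_flow hD hres hn1 hn hLam hne (A := C) (t₀ := T) (fun t ht => ?_)
    fun t ht => h.flowAt hT ht
  rw [abs_mul, abs_of_pos (Real.rpow_pos_of_pos (hT.trans_le ht) _)]
  exact hcon t ht

end OscSystem

/-! ### The averaging transformation as a perturbation of the identity. -/

namespace OscSystem

variable {D : OscSystem}

/-- The near-identity sums `∑ t^{-k/(2q)} w_k` become small Lipschitz on every strip. -/
theorem eventually_lipschitz (hD : D.Regular) (hϰ : 1 ≤ D.ϰ) {w : ℕ → ℝ → ℝ → ℝ → ℝ} {N : ℕ}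
    (hw : ∀ k ∈ Finset.Icc 1 N, PolyClass D.ϰ k (w k)) (L : ℝ) {δ : ℝ} (hδ : 0 < δ) :
    ∀ᶠ t in atTop, ∀ S R₁ Ψ₁ R₂ Ψ₂, |R₁| ≤ L → |R₂| ≤ L →
      |∑ k ∈ Finset.Icc 1 N, D.scale k t * w k R₁ Ψ₁ S
        - ∑ k ∈ Finset.Icc 1 N, D.scale k t * w k R₂ Ψ₂ S|
        ≤ δ * (|R₁ - R₂| + |Ψ₁ - Ψ₂|) := by
  have hsmall : ∀ z : ℕ → ℝ → ℝ → ℝ → ℝ, (∀ k ∈ Finset.Icc 1 N, PolyClass D.ϰ k (z k)) →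
      ∃ t₁, ∀ R Ψ S t, |R| ≤ L → t₁ ≤ t →
        |∑ k ∈ Finset.Icc 1 N, D.scale k t * z k R Ψ S| ≤ δ := by
    intro z hz
    have h1 : (fun x : ℝ × ℝ × ℝ × ℝ => ∑ k ∈ Finset.Icc 1 N, D.scale 1 x.2.2.2 ^ k *
        z k x.1 x.2.1 x.2.2.1) =O[stripFilter L] fun x => D.scale 1 x.2.2.2 ^ 1 :=
      IsBigO.fun_sum fun k hk => isBigO_pow_mul (scale_isBigO_one hD L)
        (Finset.mem_Icc.1 hk).1 ((hz k hk).isBigO_one hϰ L)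
    simp only [pow_one] at h1
    have h2 := (h1.trans_tendsto (tendsto_scale_stripFilter hD L)).abs
    rw [abs_zero] at h2
    obtain ⟨t₁, ht₁⟩ := eventually_stripFilter.1
      ((h2.eventually_lt_const hδ).and (eventually_time_pos L))
    refine ⟨t₁, fun R Ψ S t hR ht => ?_⟩
    obtain ⟨h3, h4⟩ := ht₁ R Ψ S t hR ht
    refine le_trans (le_of_eq (congrArg _ (Finset.sum_congr rfl fun k _ => ?_))) h3.le
    rw [D.scale_eq_pow k h4]
  obtain ⟨t₁, ht₁⟩ := hsmall (fun k R Ψ S => deriv (fun x => w k x Ψ S) R)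
    fun k hk => (hw k hk).deriv₁
  obtain ⟨t₂, ht₂⟩ := hsmall (fun k R Ψ S => deriv (fun x => w k R x S) Ψ)
    fun k hk => (hw k hk).deriv₂
  filter_upwards [eventually_ge_atTop t₁, eventually_ge_atTop t₂] with t h1 h2
  intro S R₁ Ψ₁ R₂ Ψ₂ hR₁ hR₂
  -- The path from `(R₁, Ψ₁)` to `(R₂, Ψ₂)` goes through `(R₂, Ψ₁)` and never leaves the strip; each
  -- leg uses one partial derivative.
  have hR := (convex_Icc (-L) L).norm_image_sub_le_of_norm_hasDerivWithin_le
    (f := fun R => ∑ k ∈ Finset.Icc 1 N, D.scale k t * w k R Ψ₁ S) (C := δ)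
    (fun R _ => (HasDerivAt.fun_sum fun k hk => (((hw k hk).smooth₁ Ψ₁ S).differentiable (by simp)
      R).hasDerivAt.const_mul (D.scale k t)).hasDerivWithinAt)
    (fun R hR => ht₁ R Ψ₁ S t (abs_le.2 hR) h1) (abs_le.1 hR₂) (abs_le.1 hR₁)
  have hΨ := convex_univ.norm_image_sub_le_of_norm_hasDerivWithin_le
    (f := fun Ψ => ∑ k ∈ Finset.Icc 1 N, D.scale k t * w k R₂ Ψ S) (C := δ)
    (fun Ψ _ => (HasDerivAt.fun_sum fun k hk => (((hw k hk).smooth₂ R₂ S).differentiable (by simp)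
      Ψ).hasDerivAt.const_mul (D.scale k t)).hasDerivWithinAt)
    (fun Ψ _ => ht₂ R₂ Ψ S t hR₂ h2) (Set.mem_univ Ψ₂) (Set.mem_univ Ψ₁)
  simp only [Real.norm_eq_abs] at hR hΨ
  rw [mul_add]
  exact (abs_sub_le _ _ _).trans (add_le_add hR hΨ)

theorem tendsto_rpow_neg_div (hD : D.Regular) {x : ℝ} (hx : 0 < x) :
    Tendsto (fun t : ℝ => t ^ (-x / (2 * D.q))) atTop (𝓝 0) := by
  have hq : (0 : ℝ) < D.q := by exact_mod_cast hD.q_pos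
  simpa [neg_div] using tendsto_rpow_neg_atTop (y := x / (2 * (D.q : ℝ))) (by positivity)

/-- The near-identity sums `∑ t^{-k/(2q)} w_k` become small on the whole slice of the domain. -/
theorem eventually_small_on_dom (hD : D.Regular) (hres : D.Resonant)
    {w : ℕ → ℝ → ℝ → ℝ → ℝ} {N : ℕ} (hw : ∀ k ∈ Finset.Icc 1 N, PolyClass D.ϰ k (w k))
    {ς : ℝ} (hς0 : 0 < ς) (hς1 : ς < 1) (t₀ : ℝ) :
    ∀ᶠ t in atTop, ∀ R Ψ S, (R, Ψ, t) ∈ D.dom ς 0 t₀ →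
      |∑ k ∈ Finset.Icc 1 N, D.scale k t * w k R Ψ S| ≤ 1 := by
  have hC : ∀ k, ∃ C, 0 ≤ C ∧ (k ∈ Finset.Icc 1 N → ∀ R Ψ S, |w k R Ψ S| ≤ C * (1 + |R|) ^ k) := by
    intro k
    by_cases hk : k ∈ Finset.Icc 1 N
    · obtain ⟨C, hC0, hC⟩ := (hw k hk).bounded hres.ϰ_pos
      exact ⟨C, hC0, fun _ => hC⟩
    · exact ⟨0, le_rfl, fun h => absurd h hk⟩
  choose C hC0 hC using hC
  -- On the domain `|R| t^{-(1-ς)/(2q)} ≤ Rmax + |a| ≤ 2 Rmax`, hence `h (1 + |R|) ≤ E t^{-ς/(2q)}`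
  -- for `t ≥ 1`. With degree at most `k`, the term of order `k` is then bounded by a constant times
  -- `(E t^{-ς/(2q)})^k`, which tends to zero.
  set E := 1 + 2 * D.Rmax
  have hlim : Tendsto (fun t : ℝ => ∑ k ∈ Finset.Icc 1 N, C k * (E * t ^ (-ς / (2 * D.q))) ^ k)
      atTop (𝓝 0) := by
    have h0 : ∑ k ∈ Finset.Icc 1 N, C k * (E * 0) ^ k = 0 :=
      Finset.sum_eq_zero fun k hk => by
        rw [mul_zero, zero_pow (by have := (Finset.mem_Icc.1 hk).1; omega), mul_zero]
    rw [← h0]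
    exact tendsto_finsetSum _ fun k _ =>
      (((tendsto_rpow_neg_div hD hς0).const_mul E).pow k).const_mul (C k)
  have hq : (0 : ℝ) < D.q := by exact_mod_cast hD.q_pos
  filter_upwards [hlim.eventually_lt_const one_pos, eventually_ge_atTop 1] with t ht ht1
  intro R Ψ S hR
  have ht0 : 0 < t := one_pos.trans_le ht1
  have hh := D.scale_one_pos ht0
  have hz : 0 < t ^ (-(1 - ς) / (2 * D.q)) := Real.rpow_pos_of_pos ht0 _
  have hsplit : D.scale 1 t = t ^ (-(1 - ς) / (2 * D.q)) * t ^ (-ς / (2 * D.q)) := by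
    rw [← Real.rpow_add ht0, scale]
    congr 1
    push_cast
    ring
  have hz1 : t ^ (-(1 - ς) / (2 * D.q)) ≤ 1 :=
    Real.rpow_le_one_of_one_le_of_nonpos ht1
      (div_nonpos_of_nonpos_of_nonneg (by linarith) (by positivity))
  have hy : 0 < t ^ (-ς / (2 * D.q)) := Real.rpow_pos_of_pos ht0 _
  have hRz : |R| * t ^ (-(1 - ς) / (2 * D.q)) ≤ 2 * D.Rmax := by
    have h1 : |R * t ^ (-(1 - ς) / (2 * D.q)) + D.a| < D.Rmax := by simpa using hR.1
    have h2 := abs_sub_abs_le_abs_add (R * t ^ (-(1 - ς) / (2 * D.q))) D.a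
    rw [abs_mul, abs_of_pos hz] at h2
    linarith [hres.a_lt]
  have hbase : D.scale 1 t * (1 + |R|) ≤ E * t ^ (-ς / (2 * D.q)) := by
    rw [hsplit]
    calc t ^ (-(1 - ς) / (2 * D.q)) * t ^ (-ς / (2 * D.q)) * (1 + |R|)
        = (t ^ (-(1 - ς) / (2 * D.q)) + |R| * t ^ (-(1 - ς) / (2 * D.q)))
          * t ^ (-ς / (2 * D.q)) := by ring
      _ ≤ E * t ^ (-ς / (2 * D.q)) := mul_le_mul_of_nonneg_right (add_le_add hz1 hRz) hy.le
  refine ((Finset.abs_sum_le_sum_abs _ _).trans (Finset.sum_le_sum fun k hk => ?_)).trans ht.le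
  rw [D.scale_eq_pow k ht0, abs_mul, abs_of_pos (pow_pos hh k)]
  calc D.scale 1 t ^ k * |w k R Ψ S| ≤ D.scale 1 t ^ k * (C k * (1 + |R|) ^ k) :=
        mul_le_mul_of_nonneg_left (hC k hk R Ψ S) (pow_pos hh k).le
    _ = C k * (D.scale 1 t * (1 + |R|)) ^ k := by rw [mul_pow]; ring
    _ ≤ C k * (E * t ^ (-ς / (2 * D.q))) ^ k := by
        refine mul_le_mul_of_nonneg_left (pow_le_pow_left₀ (by positivity) hbase k) (hC0 k)

/-- Times at which the averaging transformation is a controlled perturbation of the identity. -/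
structure GoodTime (D : OscSystem) (N : ℕ) (ς ε t₀ L t : ℝ) : Prop where
  pos : 0 < t
  near_U : ∀ R Ψ S, (R, Ψ, t) ∈ D.dom ς 0 t₀ → |D.U N R Ψ S t - R| ≤ 1
  near_V : ∀ R Ψ S, (R, Ψ, t) ∈ D.dom ς 0 t₀ → |D.V N R Ψ S t - Ψ| ≤ 1
  mem_dom : ∀ R Ψ, |R| ≤ L → (R, Ψ, t) ∈ D.dom ς ε t₀
  lip_U : ∀ S R₁ Ψ₁ R₂ Ψ₂, |R₁| ≤ L → |R₂| ≤ L →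
    |(D.U N R₁ Ψ₁ S t - R₁) - (D.U N R₂ Ψ₂ S t - R₂)| ≤ 1 / 4 * (|R₁ - R₂| + |Ψ₁ - Ψ₂|)
  lip_V : ∀ S R₁ Ψ₁ R₂ Ψ₂, |R₁| ≤ L → |R₂| ≤ L →
    |(D.V N R₁ Ψ₁ S t - Ψ₁) - (D.V N R₂ Ψ₂ S t - Ψ₂)| ≤ 1 / 4 * (|R₁ - R₂| + |Ψ₁ - Ψ₂|)
  amplitude : ∀ R, |R| ≤ L → |D.a + D.scale 1 t * R| < D.Rmax

theorem eventually_goodTime (hD : D.Regular) (hres : D.Resonant) (N : ℕ) {ς : ℝ} (hς0 : 0 < ς)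
    (hς1 : ς < 1) (ε t₀ L : ℝ) : ∀ᶠ t in atTop, D.GoodTime N ς ε t₀ L t := by
  have hu : ∀ k ∈ Finset.Icc 1 N, PolyClass D.ϰ k (D.coeff k).u := fun k hk =>
    (avgPoly_coeff hD hres (Finset.mem_Icc.1 hk).1).u
  have hv : ∀ k ∈ Finset.Icc 1 N, PolyClass D.ϰ k (D.coeff k).v := fun k hk =>
    (avgPoly_coeff hD hres (Finset.mem_Icc.1 hk).1).v
  have hz : Tendsto (fun t : ℝ => (|L| + ε) * t ^ (-(1 - ς) / (2 * D.q)) + |D.a|) atTop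
      (𝓝 |D.a|) := by
    simpa using ((tendsto_rpow_neg_div hD (sub_pos.2 hς1)).const_mul (|L| + ε)).add_const |D.a|
  have hamp : Tendsto (fun t : ℝ => |D.a| + D.scale 1 t * |L|) atTop (𝓝 |D.a|) := by
    simpa using ((tendsto_scale_one hD).mul_const |L|).const_add |D.a|
  filter_upwards [eventually_gt_atTop 0, eventually_ge_atTop t₀,
    eventually_small_on_dom hD hres hu hς0 hς1 t₀, eventually_small_on_dom hD hres hv hς0 hς1 t₀,
    eventually_lipschitz hD hres.ϰ_pos hu L (by norm_num : (0 : ℝ) < 1 / 4),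
    eventually_lipschitz hD hres.ϰ_pos hv L (by norm_num : (0 : ℝ) < 1 / 4),
    hz.eventually_lt_const hres.a_lt, hamp.eventually_lt_const hres.a_lt]
    with t h1 h2 h3 h4 h5 h6 h7 h8
  refine ⟨h1, fun R Ψ S hR => ?_, fun R Ψ S hR => ?_, fun R Ψ hR => ⟨?_, h2⟩,
    fun S R₁ Ψ₁ R₂ Ψ₂ hR₁ hR₂ => ?_, fun S R₁ Ψ₁ R₂ Ψ₂ hR₁ hR₂ => ?_, fun R hR => ?_⟩
  · simpa [U] using h3 R Ψ S hR
  · simpa [V] using h4 R Ψ S hR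
  · have hpos : 0 < t ^ (-(1 - ς) / (2 * D.q)) := Real.rpow_pos_of_pos h1 _
    have h9 := abs_add_le (R * t ^ (-(1 - ς) / (2 * D.q))) D.a
    rw [abs_mul, abs_of_pos hpos] at h9
    have h10 := mul_le_mul_of_nonneg_right (hR.trans (le_abs_self L)) hpos.le
    simp only
    linarith
  · simpa [U] using h5 S R₁ Ψ₁ R₂ Ψ₂ hR₁ hR₂
  · simpa [V] using h6 S R₁ Ψ₁ R₂ Ψ₂ hR₁ hR₂
  · refine (abs_add_le _ _).trans_lt ?_
    rw [abs_mul, abs_of_pos (D.scale_one_pos h1)]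
    have := mul_le_mul_of_nonneg_left (hR.trans (le_abs_self L)) (D.scale_one_pos h1).le
    linarith

namespace GoodTime

variable {N : ℕ} {ς ε t₀ L t : ℝ}

theorem mem_dom_zero (h : D.GoodTime N ς ε t₀ L t) (hε : 0 ≤ ε) {R : ℝ} (hR : |R| ≤ L) (Ψ : ℝ) :
    (R, Ψ, t) ∈ D.dom ς 0 t₀ := by
  obtain ⟨h1, h2⟩ := h.mem_dom R Ψ hR
  refine ⟨h1.trans_le ?_, h2⟩
  have := mul_nonneg hε (Real.rpow_pos_of_pos h.pos (-(1 - ς) / (2 * D.q))).le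
  simp only
  linarith

/-- The two corrections have Lipschitz constants `1/4`, together `1/2` in the sum norm. Identity
plus such a perturbation has an inverse with Lipschitz constant `2`. -/
theorem antilipschitz (h : D.GoodTime N ς ε t₀ L t) (S : ℝ) {R₁ Ψ₁ R₂ Ψ₂ : ℝ} (hR₁ : |R₁| ≤ L)
    (hR₂ : |R₂| ≤ L) : |R₁ - R₂| + |Ψ₁ - Ψ₂| ≤
      2 * (|D.U N R₁ Ψ₁ S t - D.U N R₂ Ψ₂ S t| + |D.V N R₁ Ψ₁ S t - D.V N R₂ Ψ₂ S t|) := by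
  have h1 := h.lip_U S R₁ Ψ₁ R₂ Ψ₂ hR₁ hR₂
  have h2 := h.lip_V S R₁ Ψ₁ R₂ Ψ₂ hR₁ hR₂
  have h3 := abs_sub (D.U N R₁ Ψ₁ S t - D.U N R₂ Ψ₂ S t)
    ((D.U N R₁ Ψ₁ S t - R₁) - (D.U N R₂ Ψ₂ S t - R₂))
  have h4 := abs_sub (D.V N R₁ Ψ₁ S t - D.V N R₂ Ψ₂ S t)
    ((D.V N R₁ Ψ₁ S t - Ψ₁) - (D.V N R₂ Ψ₂ S t - Ψ₂))
  rw [show D.U N R₁ Ψ₁ S t - D.U N R₂ Ψ₂ S t -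
    ((D.U N R₁ Ψ₁ S t - R₁) - (D.U N R₂ Ψ₂ S t - R₂)) = R₁ - R₂ by ring] at h3
  rw [show D.V N R₁ Ψ₁ S t - D.V N R₂ Ψ₂ S t -
    ((D.V N R₁ Ψ₁ S t - Ψ₁) - (D.V N R₂ Ψ₂ S t - Ψ₂)) = Ψ₁ - Ψ₂ by ring] at h4
  linarith

theorem abs_le_of_U (h : D.GoodTime N ς ε t₀ L t) {R Ψ S : ℝ} (hR : (R, Ψ, t) ∈ D.dom ς 0 t₀) :
    |R| ≤ |D.U N R Ψ S t| + 1 := by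
  have h1 := h.near_U R Ψ S hR
  have h2 := abs_sub_abs_le_abs_sub R (D.U N R Ψ S t)
  rw [abs_sub_comm] at h2
  linarith

theorem abs_U_le (h : D.GoodTime N ς ε t₀ L t) (hε : 0 ≤ ε) {R : ℝ} (hR : |R| ≤ L) (Ψ S : ℝ) :
    |D.U N R Ψ S t| ≤ |R| + 1 := by
  have h1 := h.near_U R Ψ S (h.mem_dom_zero hε hR Ψ)
  have h2 := abs_sub_abs_le_abs_sub (D.U N R Ψ S t) R
  linarith

theorem abs_le_of_V (h : D.GoodTime N ς ε t₀ L t) {R Ψ S : ℝ} (hR : (R, Ψ, t) ∈ D.dom ς 0 t₀) :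
    |Ψ| ≤ |D.V N R Ψ S t| + 1 := by
  have h1 := h.near_V R Ψ S hR
  have h2 := abs_sub_abs_le_abs_sub Ψ (D.V N R Ψ S t)
  rw [abs_sub_comm] at h2
  linarith

/-- In the sup norm the transformation is within `1/2` of the identity on the ball of radius `2`
about `(ρ, ψ)`, so its image contains the ball of radius `(1 - 1/2) · 2 = 1` about the image of the
centre. The centre moves by at most `1`, hence `(ρ, ψ)` is attained. The condition `|ρ| + 2 ≤ L`
keeps the ball in the strip. -/
theorem exists_preimage (h : D.GoodTime N ς ε t₀ L t) (hε : 0 ≤ ε) {ρ : ℝ} (hρ : |ρ| + 2 ≤ L)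
    (ψ S : ℝ) : ∃ p : ℝ × ℝ, (p.1, p.2, t) ∈ D.dom ς 0 t₀ ∧
      (D.U N p.1 p.2 S t, D.V N p.1 p.2 S t) = (ρ, ψ) := by
  set Φ : ℝ × ℝ → ℝ × ℝ := fun p => (D.U N p.1 p.2 S t, D.V N p.1 p.2 S t)
  have happ : ApproximatesLinearOn Φ
      ((ContinuousLinearEquiv.refl ℝ (ℝ × ℝ) : (ℝ × ℝ) ≃L[ℝ] ℝ × ℝ) : ℝ × ℝ →L[ℝ] ℝ × ℝ)
      {p | |p.1| ≤ L} (1 / 2) := by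
    intro x hx y hy
    have h1 := h.lip_U S x.1 x.2 y.1 y.2 hx hy
    have h2 := h.lip_V S x.1 x.2 y.1 y.2 hx hy
    have h3 : |x.1 - y.1| ≤ ‖x - y‖ := norm_fst_le (x - y)
    have h4 : |x.2 - y.2| ≤ ‖x - y‖ := norm_snd_le (x - y)
    have h5 : ((1 / 2 : NNReal) : ℝ) = 1 / 2 := by norm_num
    rw [h5]
    refine max_le ?_ ?_
    · refine le_trans (le_of_eq ?_) (h1.trans (by linarith))
      simp only [Φ, Real.norm_eq_abs]
      congr 1
      simp
      ring
    · refine le_trans (le_of_eq ?_) (h2.trans (by linarith))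
      simp only [Φ, Real.norm_eq_abs]
      congr 1
      simp
      ring
  have hball : Metric.closedBall ((ρ, ψ) : ℝ × ℝ) 2 ⊆ {p | |p.1| ≤ L} := by
    intro p hp
    have h1 : |p.1 - ρ| ≤ 2 := (norm_fst_le (p - (ρ, ψ))).trans (mem_closedBall_iff_norm.1 hp)
    have h2 := abs_sub_abs_le_abs_sub p.1 ρ
    simp only [Set.mem_ofPred_eq]
    linarith
  have hsurj := happ.surjOn_closedBall_of_nonlinearRightInverse
    (ContinuousLinearEquiv.refl ℝ (ℝ × ℝ)).toNonlinearRightInverse zero_le_two hball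
  have hmem : ((ρ, ψ) : ℝ × ℝ) ∈ Metric.closedBall (Φ (ρ, ψ))
      ((((ContinuousLinearEquiv.refl ℝ (ℝ × ℝ)).toNonlinearRightInverse.nnnorm : ℝ)⁻¹
        - ((1 / 2 : NNReal) : ℝ)) * 2) := by
    have h1 : ((ContinuousLinearEquiv.refl ℝ (ℝ × ℝ)).toNonlinearRightInverse.nnnorm : ℝ) = 1 := by
      change ‖(((ContinuousLinearEquiv.refl ℝ (ℝ × ℝ)).symm : (ℝ × ℝ) ≃L[ℝ] ℝ × ℝ) :
        ℝ × ℝ →L[ℝ] ℝ × ℝ)‖ = 1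
      exact ContinuousLinearMap.norm_id
    have h2 : (((1 : ℝ)⁻¹ - ((1 / 2 : NNReal) : ℝ)) * 2) = 1 := by norm_num
    rw [h1, h2, mem_closedBall_iff_norm']
    have h3 := h.mem_dom_zero hε (by linarith : |ρ| ≤ L) ψ
    exact max_le (h.near_U ρ ψ S h3) (h.near_V ρ ψ S h3)
  obtain ⟨p, hp, hpΦ⟩ := hsurj hmem
  exact ⟨p, h.mem_dom_zero hε (hball hp) p.2, hpΦ⟩

/-- `Function.invFunOn` may pick any preimage in the whole slice of `𝒟^0`. The displacement bound
holds on that whole slice, so every preimage satisfies `|R| ≤ |ρ| + 1` and falls into the strip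
where the transformation is controlled. -/
theorem inverseTransform_spec (h : D.GoodTime N ς ε t₀ L t) (hε : 0 ≤ ε) {ρ : ℝ}
    (hρ : |ρ| + 2 ≤ L) (ψ S : ℝ) {p : ℝ × ℝ} (hp : p = D.inverseTransform N ς t₀ ρ ψ S t) :
    |p.1| ≤ |ρ| + 1 ∧ |p.2| ≤ |ψ| + 1 ∧ D.U N p.1 p.2 S t = ρ ∧ D.V N p.1 p.2 S t = ψ := by
  have hex : ∃ p ∈ {p : ℝ × ℝ | (p.1, p.2, t) ∈ D.dom ς 0 t₀},
      (D.U N p.1 p.2 S t, D.V N p.1 p.2 S t) = (ρ, ψ) := h.exists_preimage hε hρ ψ S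
  have h1 : (p.1, p.2, t) ∈ D.dom ς 0 t₀ := by
    rw [hp]
    exact Function.invFunOn_mem hex
  have h2 : (D.U N p.1 p.2 S t, D.V N p.1 p.2 S t) = (ρ, ψ) := by
    rw [hp]
    exact Function.invFunOn_eq hex
  obtain ⟨h3, h4⟩ := Prod.mk.inj h2
  exact ⟨h3 ▸ h.abs_le_of_U h1, h4 ▸ h.abs_le_of_V h1, h3, h4⟩

/-- Both `(R, Ψ)` and the chosen preimage lie in the strip, where the anti-Lipschitz bound forces
them to agree. The margin `3` is `1` for passing from `R` to `U_N` plus the `2` needed to invert. -/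
theorem inverseTransform_apply (h : D.GoodTime N ς ε t₀ L t) (hε : 0 ≤ ε) {R : ℝ}
    (hR : |R| + 3 ≤ L) (Ψ S : ℝ) :
    D.inverseTransform N ς t₀ (D.U N R Ψ S t) (D.V N R Ψ S t) S t = (R, Ψ) := by
  have hU := h.abs_U_le hε (by linarith : |R| ≤ L) Ψ S
  obtain ⟨h1, _, h3, h4⟩ := h.inverseTransform_spec hε (by linarith : |D.U N R Ψ S t| + 2 ≤ L)
    (D.V N R Ψ S t) S rfl
  have h5 := h.antilipschitz S (Ψ₁ := (D.inverseTransform N ς t₀ (D.U N R Ψ S t)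
    (D.V N R Ψ S t) S t).2) (Ψ₂ := Ψ) (by linarith) (by linarith : |R| ≤ L) (R₁ :=
      (D.inverseTransform N ς t₀ (D.U N R Ψ S t) (D.V N R Ψ S t) S t).1)
  rw [h3, h4] at h5
  simp only [sub_self, abs_zero, add_zero, mul_zero] at h5
  have h6 := abs_nonneg ((D.inverseTransform N ς t₀ (D.U N R Ψ S t)
    (D.V N R Ψ S t) S t).1 - R)
  have h7 := abs_nonneg ((D.inverseTransform N ς t₀ (D.U N R Ψ S t)
    (D.V N R Ψ S t) S t).2 - Ψ)
  exact Prod.ext (sub_eq_zero.1 (abs_eq_zero.1 (by linarith)))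
    (sub_eq_zero.1 (abs_eq_zero.1 (by linarith)))

end GoodTime

/-- A trajectory of the transformed system comes from a trajectory in the variables `(R, Ψ)`. -/
theorem flowAt_of_transformed (hD : D.Regular) (hres : D.Resonant) {N : ℕ} {ς ε t₀ L : ℝ}
    {s : Set ℝ} (hgood : ∀ τ ∈ s, D.GoodTime N ς ε t₀ L τ) {R Ψ : ℝ → ℝ}
    (hR : ∀ τ ∈ s, |R τ| + 1 ≤ L) {t : ℝ} (ht : t ∈ s)
    (hU : HasDerivWithinAt (fun τ => D.U N (R τ) (Ψ τ) (D.phase τ) τ)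
      (D.alongFlow (D.U N) (R t) (Ψ t) (D.phase t) t) s t)
    (hV : HasDerivWithinAt (fun τ => D.V N (R τ) (Ψ τ) (D.phase τ) τ)
      (D.alongFlow (D.V N) (R t) (Ψ t) (D.phase t) t) s t) : D.FlowAt R Ψ s t := by
  have ht0 := (hgood t ht).pos
  set R' := D.F (R t) (Ψ t) (D.phase t) t
  set Ψ' := D.G (R t) (Ψ t) (D.phase t) t
  -- Straight lines through the current point with the velocity `(F, G)`. The chain rule gives
  -- `(U_N, V_N)` along them the same derivative at `t` as along `(R, Ψ)`, so the images differ by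
  -- `o(τ - t)`. The anti-Lipschitz bound carries this back to `(R - P, Ψ - Q)`, without assuming
  -- that the inverse is differentiable.
  set P : ℝ → ℝ := fun τ => R t + R' * (τ - t)
  set Q : ℝ → ℝ := fun τ => Ψ t + Ψ' * (τ - t)
  have hPt : P t = R t := by simp [P]
  have hQt : Q t = Ψ t := by simp [Q]
  have hlin : ∀ x y : ℝ, HasDerivWithinAt (fun τ => x + y * (τ - t)) y s t := fun x y => by
    simpa using ((((hasDerivAt_id t).sub_const t).const_mul y).const_add x).hasDerivWithinAt
  have hflow : D.FlowAt P Q s t :=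
    ⟨by rw [hPt, hQt]; exact hlin _ _, by rw [hPt, hQt]; exact hlin _ _⟩
  have hdU := hU.sub (hflow.hasDerivWithinAt ht0 (contDiffAt_U hD hres N ht0))
  have hdV := hV.sub (hflow.hasDerivWithinAt ht0 (contDiffAt_V hD hres N ht0))
  rw [hPt, hQt, sub_self] at hdU hdV
  rw [hasDerivWithinAt_iff_isLittleO] at hdU hdV
  simp only [Pi.sub_apply, hPt, hQt, sub_self, smul_zero, sub_zero] at hdU hdV
  -- The slack `1` in `|R t| + 1 ≤ L` keeps the straight line in the strip near `t`.
  have hPL : ∀ᶠ τ in 𝓝[s] t, |P τ| ≤ L := by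
    have h1 : ContinuousWithinAt (fun τ => |P τ|) s t := by
      simp only [P]
      fun_prop
    refine (h1.tendsto.eventually_lt_const (u := L) ?_).mono fun _ h => h.le
    rw [hPt]
    linarith [hR t ht]
  have hsum : (fun τ => |R τ - P τ| + |Ψ τ - Q τ|) =o[𝓝[s] t] fun τ => τ - t := by
    refine IsBigO.trans_isLittleO (IsBigO.of_bound 2 ?_) (hdU.norm_left.add hdV.norm_left)
    filter_upwards [hPL, self_mem_nhdsWithin] with τ h1 h2
    rw [Real.norm_of_nonneg (by positivity), Real.norm_of_nonneg (by positivity)]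
    exact (hgood τ h2).antilipschitz _ (by linarith [hR τ h2]) h1
  constructor
  · have h1 : HasDerivWithinAt (fun τ => R τ - P τ) 0 s t := by
      rw [hasDerivWithinAt_iff_isLittleO]
      simp only [hPt, sub_self, smul_zero, sub_zero]
      refine IsBigO.trans_isLittleO (IsBigO.of_bound 1 (Eventually.of_forall fun τ => ?_)) hsum
      rw [Real.norm_eq_abs, Real.norm_of_nonneg (by positivity)]
      linarith [abs_nonneg (Ψ τ - Q τ)]
    exact ((h1.add (hlin (R t) R')).congr (fun τ _ => by simp [P]) (by simp [P])).congr_deriv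
      (zero_add _)
  · have h1 : HasDerivWithinAt (fun τ => Ψ τ - Q τ) 0 s t := by
      rw [hasDerivWithinAt_iff_isLittleO]
      simp only [hQt, sub_self, smul_zero, sub_zero]
      refine IsBigO.trans_isLittleO (IsBigO.of_bound 1 (Eventually.of_forall fun τ => ?_)) hsum
      rw [Real.norm_eq_abs, Real.norm_of_nonneg (by positivity)]
      linarith [abs_nonneg (R τ - P τ)]
    exact ((h1.add (hlin (Ψ t) Ψ')).congr (fun τ _ => by simp [Q]) (by simp [Q])).congr_deriv
      (zero_add _)

end OscSystem

/-! ### Continuation of bounded trajectories past a finite time. -/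

/-- An integral curve on `[t₁, b)` that stays in a compact set extends beyond `b`. -/
theorem exists_integralCurve_extension {E : Type*} [NormedAddCommGroup E] [NormedSpace ℝ E]
    [FiniteDimensional ℝ E] {v : E → E} {K : Set E} (hK : IsCompact K)
    (hv : ∀ x ∈ K, ContDiffAt ℝ 1 v x) {γ : ℝ → E} {t₁ b : ℝ} (htb : t₁ < b)
    (hγK : ∀ t ∈ Set.Ico t₁ b, γ t ∈ K)
    (hγ : ∀ t ∈ Set.Ico t₁ b, HasDerivWithinAt γ (v (γ t)) (Set.Ico t₁ b) t) :
    ∃ ε > 0, ∃ β : ℝ → E, (∀ t ∈ Set.Ico t₁ b, β t = γ t) ∧ β b ∈ K ∧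
      ∀ t ∈ Set.Ico t₁ (b + ε), HasDerivWithinAt β (v (β t)) (Set.Ico t₁ (b + ε)) t := by
  have : CompleteSpace E := FiniteDimensional.complete ℝ E
  obtain ⟨C, hC⟩ := hK.exists_bound_of_continuousOn
    fun x hx => (hv x hx).continuousAt.continuousWithinAt
  -- Bounded velocity makes the curve Lipschitz; a Lipschitz extension to the line then supplies the
  -- endpoint value at `b`.
  have hlip : LipschitzOnWith (Real.toNNReal C) γ (Set.Ico t₁ b) :=
    (convex_Ico t₁ b).lipschitzOnWith_of_nnnorm_hasDerivWithin_le hγ fun t ht => by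
      rw [← NNReal.coe_le_coe, coe_nnnorm]
      exact (hC _ (hγK t ht)).trans (Real.le_coe_toNNReal C)
  obtain ⟨g, hg, hgγ⟩ := hlip.extend_finite_dimension
  have hgc : Continuous g := hg.continuous
  have hIoo : Set.Ioo t₁ b ∈ 𝓝[<] b := Ioo_mem_nhdsLT htb
  have hgb : g b ∈ K := by
    refine hK.isClosed.mem_of_tendsto (hgc.continuousAt.tendsto.mono_left nhdsWithin_le_nhds)
      (f := g) (b := 𝓝[<] b) ?_
    filter_upwards [hIoo] with t ht
    rw [← hgγ ⟨ht.1.le, ht.2⟩]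
    exact hγK t ⟨ht.1.le, ht.2⟩
  have hgd : ∀ t ∈ Set.Ioo t₁ b, HasDerivAt g (v (g t)) t := by
    intro t ht
    have h1 := (hγ t ⟨ht.1.le, ht.2⟩).hasDerivAt (Ico_mem_nhds ht.1 ht.2)
    rw [hgγ ⟨ht.1.le, ht.2⟩] at h1
    refine h1.congr_of_eventuallyEq ?_
    filter_upwards [Ioo_mem_nhds ht.1 ht.2] with τ hτ
    exact (hgγ ⟨hτ.1.le, hτ.2⟩).symm
  -- The one-sided derivative at `b` is the limit of the derivatives from the left. It matches the
  -- velocity of the local solution started at `g b`, so the glued curve is differentiable at `b`.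
  have hleft : HasDerivWithinAt g (v (g b)) (Set.Iic b) b := by
    refine hasDerivWithinAt_Iic_of_tendsto_deriv
      (fun t ht => (hgd t ht).differentiableAt.differentiableWithinAt)
      hgc.continuousWithinAt hIoo ?_
    have h1 : Tendsto (fun t => v (g t)) (𝓝[<] b) (𝓝 (v (g b))) :=
      ((hv _ hgb).continuousAt.comp hgc.continuousAt).tendsto.mono_left nhdsWithin_le_nhds
    refine h1.congr' ?_
    filter_upwards [hIoo] with t ht
    exact (hgd t ht).deriv.symm
  obtain ⟨α, hαb, ε, hε, hα⟩ :=
    (hv _ hgb).exists_forall_mem_closedBall_exists_eq_forall_mem_Ioo_hasDerivAt₀ b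
  set β : ℝ → E := fun t => if t < b then g t else α t
  have hβlt : ∀ t, t < b → β t = g t := fun t ht => if_pos ht
  have hβge : ∀ t, b ≤ t → β t = α t := fun t ht => if_neg (not_lt.2 ht)
  have hβle : ∀ t, t ≤ b → β t = g t := fun t ht => by
    rcases ht.lt_or_eq with h | rfl
    · exact hβlt t h
    · rw [hβge t le_rfl, hαb]
  refine ⟨ε, hε, β, fun t ht => (hβlt t ht.2).trans (hgγ ht).symm, by rwa [hβle b le_rfl],
    fun t ht => ?_⟩
  rcases lt_trichotomy t b with h | rfl | h
  · have h1 := hγ t ⟨ht.1, h⟩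
    rw [hgγ ⟨ht.1, h⟩, ← hβlt t h] at h1
    refine (h1.congr (fun τ hτ => (hβlt τ hτ.2).trans (hgγ hτ).symm)
      ((hβlt t h).trans (hgγ ⟨ht.1, h⟩).symm)).mono_of_mem_nhdsWithin ?_
    exact mem_nhdsWithin.2 ⟨Set.Iio b, isOpen_Iio, h, fun τ hτ => ⟨hτ.2.1, hτ.1⟩⟩
  · have h1 : HasDerivWithinAt β (v (β t)) (Set.Iic t) t := by
      rw [hβle t le_rfl]
      exact hleft.congr (fun τ hτ => hβle τ hτ) (hβle t le_rfl)
    have h2 : HasDerivWithinAt β (v (β t)) (Set.Ici t) t := by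
      have h3 := (hα t ⟨by linarith, by linarith⟩).hasDerivWithinAt (s := Set.Ici t)
      rw [← hβge t le_rfl] at h3
      exact h3.congr (fun τ hτ => hβge τ hτ) (hβge t le_rfl)
    exact (h1.union h2).mono fun τ _ => le_total τ t
  · have h1 := hα t ⟨by linarith, ht.2⟩
    rw [← hβge t h.le] at h1
    refine (h1.congr_of_eventuallyEq ?_).hasDerivWithinAt
    filter_upwards [Ioi_mem_nhds h] with τ hτ
    exact hβge τ (le_of_lt hτ)

namespace OscSystem

variable {D : OscSystem}

theorem contDiffAt_transformedArgs (D : OscSystem) {h : ℝ → ℝ → ℝ → ℝ → ℝ}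
    (hh : ContDiffOn ℝ ∞ (fun x : ℝ × ℝ × ℝ × ℝ => h x.1 x.2.1 x.2.2.1 x.2.2.2)
      (Set.Icc (-D.Rmax) D.Rmax ×ˢ Set.univ ×ˢ Set.univ ×ˢ Set.Ioi 0)) {y : ℝ × ℝ × ℝ}
    (hy : 0 < y.2.2) (hamp : |D.a + D.scale 1 y.2.2 * y.1| < D.Rmax) :
    ContDiffAt ℝ ∞ (fun y : ℝ × ℝ × ℝ => h (D.a + D.scale 1 y.2.2 * y.1)
      ((D.κ : ℝ) / D.ϰ * D.phase y.2.2 + y.2.1) (D.phase y.2.2) y.2.2) y := by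
  have hsc : ContDiffAt ℝ ∞ (fun y : ℝ × ℝ × ℝ => D.scale 1 y.2.2) y :=
    (D.contDiffAt_scale 1 hy).comp y (f := fun y : ℝ × ℝ × ℝ => y.2.2) (by fun_prop)
  have hph : ContDiffAt ℝ ∞ (fun y : ℝ × ℝ × ℝ => D.phase y.2.2) y :=
    (D.contDiffAt_phase hy).comp y (f := fun y : ℝ × ℝ × ℝ => y.2.2) (by fun_prop)
  have hmem : Set.Icc (-D.Rmax) D.Rmax ×ˢ (Set.univ : Set ℝ) ×ˢ (Set.univ : Set ℝ) ×ˢ Set.Ioi 0 ∈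
      𝓝 ((D.a + D.scale 1 y.2.2 * y.1, (D.κ : ℝ) / D.ϰ * D.phase y.2.2 + y.2.1,
        D.phase y.2.2, y.2.2) : ℝ × ℝ × ℝ × ℝ) :=
    prod_mem_nhds (Icc_mem_nhds (abs_lt.1 hamp).1 (abs_lt.1 hamp).2)
      (prod_mem_nhds univ_mem (prod_mem_nhds univ_mem (Ioi_mem_nhds hy)))
  exact (hh.contDiffAt hmem).comp y (f := fun y : ℝ × ℝ × ℝ => (D.a + D.scale 1 y.2.2 * y.1,
    (D.κ : ℝ) / D.ϰ * D.phase y.2.2 + y.2.1, D.phase y.2.2, y.2.2)) (by fun_prop)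

/-- The system for `(R, Ψ)` as an autonomous vector field on the extended phase space. -/
noncomputable def extendedField (D : OscSystem) (y : ℝ × ℝ × ℝ) : ℝ × ℝ × ℝ :=
  (D.F y.1 y.2.1 (D.phase y.2.2) y.2.2, D.G y.1 y.2.1 (D.phase y.2.2) y.2.2, 1)

theorem contDiffAt_extendedField (hD : D.Regular) {y : ℝ × ℝ × ℝ}
    (hy : 0 < y.2.2) (hamp : |D.a + D.scale 1 y.2.2 * y.1| < D.Rmax) :
    ContDiffAt ℝ ∞ D.extendedField y := by
  have hsc : ContDiffAt ℝ ∞ (fun y : ℝ × ℝ × ℝ => D.scale 1 y.2.2) y :=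
    (D.contDiffAt_scale 1 hy).comp y (f := fun y : ℝ × ℝ × ℝ => y.2.2) (by fun_prop)
  have hpow : ContDiffAt ℝ ∞ (fun y : ℝ × ℝ × ℝ => y.2.2 ^ ((1 : ℝ) / (2 * D.q))) y :=
    (Real.contDiffAt_rpow_const_of_ne hy.ne').comp y (f := fun y : ℝ × ℝ × ℝ => y.2.2)
      (by fun_prop)
  have hinv : ContDiffAt ℝ ∞ (fun y : ℝ × ℝ × ℝ => y.2.2⁻¹) y :=
    (contDiffAt_inv ℝ hy.ne').comp y (f := fun y : ℝ × ℝ × ℝ => y.2.2) (by fun_prop)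
  have hdph : ContDiffAt ℝ ∞ (fun y : ℝ × ℝ × ℝ => deriv D.phase y.2.2) y := by
    have h1 : ContDiffAt ℝ ∞ (deriv D.phase) y.2.2 := by
      have h2 : ContDiffOn ℝ ∞ D.phase (Set.Ioi 0) := fun t ht =>
        (D.contDiffAt_phase ht).contDiffWithinAt
      exact ((contDiffOn_infty_iff_deriv_of_isOpen isOpen_Ioi).1 h2).2.contDiffAt
        (Ioi_mem_nhds hy)
    exact h1.comp y (f := fun y : ℝ × ℝ × ℝ => y.2.2) (by fun_prop)
  have hω : ContDiffAt ℝ ∞ (fun y : ℝ × ℝ × ℝ => D.ω (D.a + D.scale 1 y.2.2 * y.1)) y :=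
    (hD.ω_smooth.contDiffAt (Icc_mem_nhds (abs_lt.1 hamp).1 (abs_lt.1 hamp).2)).comp y
      (f := fun y : ℝ × ℝ × ℝ => D.a + D.scale 1 y.2.2 * y.1) (by fun_prop)
  have hf := D.contDiffAt_transformedArgs hD.f_smooth hy hamp
  have hg := D.contDiffAt_transformedArgs hD.g_smooth hy hamp
  refine ContDiffAt.prodMk ?_ (ContDiffAt.prodMk ?_ contDiffAt_const)
  · exact (hpow.mul hf).add (hinv.mul (contDiffAt_fst.div_const _))
  · exact (hω.sub (contDiffAt_const.mul hdph)).add hg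

theorem timeInterval_coe (T b : ℝ) : timeInterval T (b : EReal) = Set.Ico T b := by
  ext t
  simp [timeInterval]

theorem timeInterval_top (T : ℝ) : timeInterval T ⊤ = Set.Ici T := by
  ext t
  simp [timeInterval]

/-- Continuation of a bounded trajectory in the variables `(R, Ψ)` beyond a finite time. -/
theorem exists_flow_extension (hD : D.Regular) {R Ψ : ℝ → ℝ} {A t₁ b : ℝ} (ht₁ : 0 < t₁)
    (htb : t₁ < b) (hamp : ∀ t ∈ Set.Icc t₁ b, ∀ R, |R| ≤ A → |D.a + D.scale 1 t * R| < D.Rmax)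
    (hR : ∀ t ∈ Set.Ico t₁ b, |R t| ≤ A) (hΨ : ∀ t ∈ Set.Ico t₁ b, |Ψ t| ≤ A)
    (hflow : ∀ t ∈ Set.Ico t₁ b, D.FlowAt R Ψ (Set.Ico t₁ b) t) :
    ∃ b' > b, ∃ P Q : ℝ → ℝ, (∀ t ∈ Set.Ico t₁ b, P t = R t ∧ Q t = Ψ t) ∧
      ∀ t ∈ Set.Ico t₁ b', |P t| ≤ A + 1 ∧ D.FlowAt P Q (Set.Ico t₁ b') t := by
  set K : Set (ℝ × ℝ × ℝ) := Set.Icc (-A) A ×ˢ Set.Icc (-A) A ×ˢ Set.Icc t₁ b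
  have hK : IsCompact K := isCompact_Icc.prod (isCompact_Icc.prod isCompact_Icc)
  obtain ⟨ε, hε, β, hβeq, hβK, hβ⟩ := exists_integralCurve_extension (v := D.extendedField)
    (γ := fun t => (R t, Ψ t, t)) hK
    (fun x hx => (contDiffAt_extendedField hD (ht₁.trans_le hx.2.2.1)
      (hamp _ hx.2.2 _ (abs_le.2 hx.1))).of_le (by exact_mod_cast le_top)) htb
    (fun t ht => ⟨abs_le.1 (hR t ht), abs_le.1 (hΨ t ht), ht.1, ht.2.le⟩)
    (fun t ht => (hflow t ht).left.prodMk ((hflow t ht).right.prodMk (hasDerivWithinAt_id t _)))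
  have hβ1 : ∀ t ∈ Set.Ico t₁ (b + ε), HasDerivWithinAt (fun t => (β t).1)
      (D.F (β t).1 (β t).2.1 (D.phase (β t).2.2) (β t).2.2) (Set.Ico t₁ (b + ε)) t :=
    fun t ht => (hβ t ht).fst
  have hβ2 : ∀ t ∈ Set.Ico t₁ (b + ε), HasDerivWithinAt (fun t => (β t).2.1)
      (D.G (β t).1 (β t).2.1 (D.phase (β t).2.2) (β t).2.2) (Set.Ico t₁ (b + ε)) t :=
    fun t ht => (hβ t ht).snd.fst
  have hβ3 : ∀ t ∈ Set.Ico t₁ (b + ε), HasDerivWithinAt (fun t => (β t).2.2)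
      1 (Set.Ico t₁ (b + ε)) t := fun t ht => (hβ t ht).snd.snd
  -- The third component has unit speed and starts at `t₁`, so it is time itself and the autonomous
  -- curve solves the original nonautonomous system.
  have htime : ∀ t ∈ Set.Ico t₁ (b + ε), (β t).2.2 = t := by
    intro t ht
    have h0 : t₁ ∈ Set.Ico t₁ (b + ε) := ⟨le_rfl, by linarith⟩
    have h1 := (convex_Ico t₁ (b + ε)).norm_image_sub_le_of_norm_hasDerivWithin_le (C := 0)
      (f := fun t => (β t).2.2 - t)
      (fun t ht => (hβ3 t ht).sub (hasDerivWithinAt_id t _)) (fun t _ => by simp) h0 ht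
    have h2 : (β t₁).2.2 = t₁ := by rw [hβeq t₁ ⟨le_rfl, htb⟩]
    rw [zero_mul, h2, sub_self, sub_zero, norm_le_zero_iff, sub_eq_zero] at h1
    exact h1
  have hcont : ∀ᶠ t in 𝓝 b, |(β t).1| < A + 1 := by
    have h1 : ContinuousAt (fun t => |(β t).1|) b :=
      ((hβ1 b ⟨htb.le, by linarith⟩).hasDerivAt
        (Ico_mem_nhds htb (by linarith))).continuousAt.abs
    refine h1.tendsto.eventually_lt_const ?_
    linarith [abs_le.2 hβK.1]
  obtain ⟨δ, hδ, hball⟩ := Metric.eventually_nhds_iff.1 hcont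
  refine ⟨b + min ε δ, by linarith [lt_min hε hδ], fun t => (β t).1, fun t => (β t).2.1,
    fun t ht => by simp [hβeq t ht], fun t ht => ?_⟩
  have hsub : Set.Ico t₁ (b + min ε δ) ⊆ Set.Ico t₁ (b + ε) :=
    Set.Ico_subset_Ico_right (by linarith [min_le_left ε δ])
  refine ⟨?_, ?_⟩
  · rcases lt_or_ge t b with h | h
    · simp only [hβeq t ⟨ht.1, h⟩]
      linarith [hR t ⟨ht.1, h⟩]
    · refine (hball ?_).le
      rw [Real.dist_eq, abs_of_nonneg (by linarith)]
      linarith [ht.2, min_le_right ε δ]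
  · have h1 := (hβ1 t (hsub ht)).mono hsub
    have h2 := (hβ2 t (hsub ht)).mono hsub
    rw [htime t (hsub ht)] at h1 h2
    exact ⟨h1, h2⟩

/-! ### Exit from bounded sets. -/

/-- Solutions of the transformed system leave every bounded set. -/
theorem exit_bounded (hD : D.Regular) (hres : D.Resonant) {n : ℕ} (hn1 : 1 ≤ n)
    (hn : n ≤ 2 * D.q) (hLam : ∀ i, 1 ≤ i → i < n → ∀ ρ ψ, D.Lam i ρ ψ = 0)
    (hne : ∀ ρ ψ, D.Lam n ρ ψ ≠ 0) (N : ℕ) {ς ε : ℝ} (t₀ : ℝ) (hς0 : 0 < ς) (hς1 : ς < 1)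
    (hε : 0 < ε) {B : Set (ℝ × ℝ)} (hB : Bornology.IsBounded B) :
    ∃ T₁ : ℝ, t₀ ≤ T₁ ∧ ∀ (T : ℝ) (b : EReal) (ρ ψ : ℝ → ℝ), t₀ ≤ T →
      D.IsMaximalTransformedSolution N ς ε t₀ T b ρ ψ →
      ∀ t₁ ∈ timeInterval T b, T₁ ≤ t₁ → ∃ t₂ ∈ timeInterval T b, t₁ ≤ t₂ ∧ (ρ t₂, ψ t₂) ∉ B := by
  obtain ⟨A, hA⟩ := hB.exists_norm_le
  -- The width `A + 6` covers all margins: `|ρ| ≤ A`, `|R| ≤ A + 1` for the pulled back trajectory,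
  -- `|R| ≤ A + 2` on its continuation, and `3` more to invert there.
  obtain ⟨T₁, hT₁⟩ := eventually_atTop.1 (eventually_goodTime hD hres N hς0 hς1 ε t₀ (A + 6))
  refine ⟨max t₀ T₁, le_max_left _ _, fun T b ρ ψ _ hmax t₁ ht₁ hT₁t => ?_⟩
  by_contra! hcon
  obtain ⟨⟨hTb, hsol⟩, hnoext⟩ := hmax
  have hgood : ∀ t, t₁ ≤ t → D.GoodTime N ς ε t₀ (A + 6) t := fun t ht =>
    hT₁ t (((le_max_right _ _).trans hT₁t).trans ht)
  have hsub : timeInterval t₁ b ⊆ timeInterval T b := fun t ht => ⟨ht₁.1.trans ht.1, ht.2⟩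
  have hρ : ∀ t ∈ timeInterval t₁ b, |ρ t| ≤ A := fun t ht =>
    (norm_fst_le (ρ t, ψ t)).trans (hA _ (hcon t (hsub ht) ht.1))
  have hψ : ∀ t ∈ timeInterval t₁ b, |ψ t| ≤ A := fun t ht =>
    (norm_snd_le (ρ t, ψ t)).trans (hA _ (hcon t (hsub ht) ht.1))
  set p : ℝ → ℝ × ℝ := fun t => D.inverseTransform N ς t₀ (ρ t) (ψ t) (D.phase t) t
  have hp : ∀ t ∈ timeInterval t₁ b, |(p t).1| ≤ A + 1 ∧ |(p t).2| ≤ A + 1 ∧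
      D.U N (p t).1 (p t).2 (D.phase t) t = ρ t ∧ D.V N (p t).1 (p t).2 (D.phase t) t = ψ t := by
    intro t ht
    obtain ⟨h1, h2, h3⟩ := (hgood t ht.1).inverseTransform_spec hε.le
      (by linarith [hρ t ht] : |ρ t| + 2 ≤ A + 6) (ψ t) (D.phase t) (p := p t) rfl
    exact ⟨by linarith [hρ t ht], by linarith [hψ t ht], h3⟩
  -- Since `U_N` and `V_N` along `p` reproduce `ρ` and `ψ`, the transformed equations say that these
  -- composites have the derivatives `alongFlow`, as required for the pullback.
  have hflow : ∀ t ∈ timeInterval t₁ b,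
      D.FlowAt (fun t => (p t).1) (fun t => (p t).2) (timeInterval t₁ b) t := by
    intro t ht
    refine flowAt_of_transformed hD hres (fun τ hτ => hgood τ hτ.1)
      (fun τ hτ => by linarith [(hp τ hτ).1]) ht ?_ ?_
    · exact ((hsol t (hsub ht)).2.1.mono hsub).congr (fun τ hτ => (hp τ hτ).2.2.1) (hp t ht).2.2.1
    · exact ((hsol t (hsub ht)).2.2.mono hsub).congr (fun τ hτ => (hp τ hτ).2.2.2) (hp t ht).2.2.2
  induction b with
  | bot => exact not_lt_bot hTb
  -- A global pullback has bounded `R`, which the drift of `U_n` excludes.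
  | top =>
    rw [timeInterval_top] at hflow hp
    exact not_bounded_flow hD hres hn1 hn hLam hne (fun t ht => (hp t ht).1) hflow
  | coe b =>
    simp only [timeInterval_coe] at *
    have ht₁0 := (hgood t₁ le_rfl).pos
    obtain ⟨b', hb', P, Q, hPQ, hext⟩ := exists_flow_extension hD (A := A + 1) ht₁0 ht₁.2
      (fun t ht R hR => (hgood t ht.1).amplitude R (by linarith)) (fun t ht => (hp t ht).1)
      (fun t ht => (hp t ht).2.1) hflow
    -- The old solution before `b`, the image of the continued `(R, Ψ)` trajectory from `b` on. On
    -- all of `[t₁, b')` this is the image of `(P, Q)`, so no matching at `b` remains to be checked.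
    set ρ' : ℝ → ℝ := fun t => if t < b then ρ t else D.U N (P t) (Q t) (D.phase t) t
    set ψ' : ℝ → ℝ := fun t => if t < b then ψ t else D.V N (P t) (Q t) (D.phase t) t
    have hρlt : ∀ t, t < b → ρ' t = ρ t := fun t ht => if_pos ht
    have hψlt : ∀ t, t < b → ψ' t = ψ t := fun t ht => if_pos ht
    have hρU : ∀ t ∈ Set.Ico t₁ b', ρ' t = D.U N (P t) (Q t) (D.phase t) t := fun t ht => by
      rcases lt_or_ge t b with h | h
      · rw [hρlt t h, (hPQ t ⟨ht.1, h⟩).1, (hPQ t ⟨ht.1, h⟩).2, (hp t ⟨ht.1, h⟩).2.2.1]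
      · exact if_neg (not_lt.2 h)
    have hψV : ∀ t ∈ Set.Ico t₁ b', ψ' t = D.V N (P t) (Q t) (D.phase t) t := fun t ht => by
      rcases lt_or_ge t b with h | h
      · rw [hψlt t h, (hPQ t ⟨ht.1, h⟩).1, (hPQ t ⟨ht.1, h⟩).2, (hp t ⟨ht.1, h⟩).2.2.2]
      · exact if_neg (not_lt.2 h)
    refine hnoext b' ρ' ψ' (EReal.coe_lt_coe_iff.2 hb') ⟨EReal.coe_lt_coe_iff.2
      ((EReal.coe_lt_coe_iff.1 hTb).trans hb'), ?_⟩ fun t ht => ⟨hρlt t ht.2, hψlt t ht.2⟩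
    rw [timeInterval_coe]
    intro t ht
    rcases lt_or_ge t b with h | h
    · obtain ⟨h1, h2, h3⟩ := hsol t ⟨ht.1, h⟩
      have hnhds : Set.Ico T b ∈ 𝓝[Set.Ico T b'] t :=
        mem_nhdsWithin.2 ⟨Set.Iio b, isOpen_Iio, h, fun τ hτ => ⟨hτ.2.1, hτ.1⟩⟩
      rw [hρlt t h, hψlt t h]
      exact ⟨h1, (h2.congr (fun τ hτ => hρlt τ hτ.2) (hρlt t h)).mono_of_mem_nhdsWithin hnhds,
        (h3.congr (fun τ hτ => hψlt τ hτ.2) (hψlt t h)).mono_of_mem_nhdsWithin hnhds⟩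
    · have ht' : t ∈ Set.Ico t₁ b' := ⟨ht₁.2.le.trans h, ht.2⟩
      obtain ⟨hP, hfl⟩ := hext t ht'
      have hgt := hgood t ht'.1
      -- Because `t₁ < b ≤ t`, derivatives within `[t₁, b')` at `t` are derivatives within `[T,
      -- b')`.
      have hnhds : Set.Ico t₁ b' ∈ 𝓝[Set.Ico T b'] t :=
        mem_nhdsWithin.2 ⟨Set.Ioi t₁, isOpen_Ioi, ht₁.2.trans_le h, fun τ hτ =>
          ⟨le_of_lt hτ.1, hτ.2.2⟩⟩
      have hinv := hgt.inverseTransform_apply hε.le (by linarith : |P t| + 3 ≤ A + 6) (Q t)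
        (D.phase t)
      rw [fieldLam, fieldOm, hρU t ht', hψV t ht', hinv]
      -- At good times the strip lies inside `𝒟^ε`, so the boundary of the domain does not obstruct
      -- the continuation.
      refine ⟨hgt.mem_dom _ _ ?_, ?_, ?_⟩
      · linarith [hgt.abs_U_le hε.le (by linarith : |P t| ≤ A + 6) (Q t) (D.phase t)]
      · exact ((hfl.hasDerivWithinAt hgt.pos (contDiffAt_U hD hres N hgt.pos)).congr hρU
          (hρU t ht')).mono_of_mem_nhdsWithin hnhds
      · exact ((hfl.hasDerivWithinAt hgt.pos (contDiffAt_V hD hres N hgt.pos)).congr hψV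
          (hψV t ht')).mono_of_mem_nhdsWithin hnhds

end OscSystem

end

/-! ### The theorem. -/

theorem mainTheorem6 (D : OscSystem) (hD : D.Regular) (hres : D.Resonant)
    (n m : ℕ) (hn : 1 ≤ n ∧ n ≤ 2 * D.q) (hm : 2 ≤ m ∧ m ≤ 2 * D.q)
    (hLam_zero : ∀ i, 1 ≤ i → i < n → ∀ ρ ψ, D.Lam i ρ ψ = 0)
    (hLam : ∃ ρ ψ, D.Lam n ρ ψ ≠ 0)
    (hOm_zero : ∀ j, 1 < j → j < m → ∀ ρ ψ, D.Om j ρ ψ = 0)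
    (hOm : ∃ ρ ψ, D.Om m ρ ψ ≠ 0)
    (hne : ∀ ρ ψ, D.Lam n ρ ψ ≠ 0) :
    -- solutions of the transformed system leave every bounded domain in finite time
    (∀ (N : ℕ) (ς ε t₀ : ℝ), 1 ≤ N → 0 < ς → ς < 1 → 0 < ε → ε < D.Rmax → 1 ≤ t₀ →
      ∀ B : Set (ℝ × ℝ), Bornology.IsBounded B → ∃ T₁ : ℝ, t₀ ≤ T₁ ∧
        ∀ (T : ℝ) (b : EReal) (ρ ψ : ℝ → ℝ), t₀ ≤ T →
          D.IsMaximalTransformedSolution N ς ε t₀ T b ρ ψ →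
          ∀ t₁ ∈ OscSystem.timeInterval T b, T₁ ≤ t₁ →
            ∃ t₂ ∈ OscSystem.timeInterval T b, t₁ ≤ t₂ ∧ (ρ t₂, ψ t₂) ∉ B) ∧
    -- the original system has no solution with `r(t) = a + O(t^{-1/(2q)})`
    (∀ (T : ℝ) (r φ : ℝ → ℝ), 0 < T → D.IsSolution T r φ →
      ∀ C : ℝ, ∃ t, T ≤ t ∧ C < t ^ ((1 : ℝ) / (2 * D.q)) * |r t - D.a|) := by
  refine ⟨fun N ς ε t₀ _ hς0 hς1 hε _ _ B hB => ?_, fun T r φ hT h C => ?_⟩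
  · exact OscSystem.exit_bounded hD hres hn.1 hn.2 hLam_zero hne N t₀ hς0 hς1 hε hB
  · exact OscSystem.no_resonant_solution hD hres hn.1 hn.2 hLam_zero hne hT h C
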